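/- Notation. For $p=(p_i)_{i}$ in $[0,1]$ let the Poisson binomial distribution (PBD) with parameters $p_i$ be the law on $\mathbb N$ of a sum of independent Bernoulli($p_i$) variables; $d_{TV}(\mathbf P,\mathbf Q)=\sup_A|\mathbf P(A)-\mathbf Q(A)|$; and $\widehat{\mathbf P}(\xi)=\sum_j e^{-2\pi i\xi j/M}\mathbf P(j)$ is the DFT modulo $M$. Patterns. A pattern consists of $R\in(0,1/4]$, an integer $L\ge 0$, and finitely many triples $(m_j,a_j,b_j)$, $1\le j\le k$, with integers $m_j\ge 1$. Put $B_i=R^{2^i}$. Each $[a_j,b_j]$ is labelled as $[0,0]$, $[1,1]$, $I_i$ or $J_i$ with $0\le i\le L+1$, where $I_0=[B_0,1/2]$, $I_{i+1}=[B_{i+1},B_i]$ for $0\le i<L$, $I_{L+1}=[0,B_L]$, and $J_i=1-I_i$. For an implied constant $C$, the pattern is admissible for $\epsilon$, $\mathbf P$ if: $R=1/4$ or $R^2\mathrm{Var}[\mathbf P]\ge \log(1/\epsilon)/C$; $R^2\mathrm{Var}[\mathbf P]\le C\log(1/\epsilon)$ (that is, $R=\Theta(\min\{1/4,\sqrt{\log(1/\epsilon)/\mathrm{Var}[\mathbf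 P]}\})$); $\epsilon^C\le B_L$ and $B_L^C\le\epsilon$; $[0,0]$ and $[1,1]$ each label at most one triple; for $0\le i\le L$ each of $I_i,J_i$ labels at most $C\log(1/\epsilon)/\log(1/B_i)$ triples, with multiplicities adding up to at most $C\,\mathrm{Var}[\mathbf P]/B_i$; each of $I_{L+1},J_{L+1}$ has total multiplicity at most $1$; and the multiplicity of $[1,1]$ differs from $\mathbb E[\mathbf P]$ by at most $(1/\epsilon)^C$. Theorem. There is $c_0>0$ such that for every $\alpha$ there is $\beta>0$ such that for every natural number $C$ there is $K$ with the following property. Let $0<\epsilon\le 1/2$, let $\tilde\sigma,\tilde\mu\in\mathbb R$, let $M,\ell$ be natural numbers with $\beta\log(1/\epsilon)\le\ell\le C\log(1/\epsilon)$, let $h_\xi\in\mathbb C$ for $|\xi|\le\ell$, and let a pattern be given. Then there is a system $\mathcal P$ of polynomial inequalities with rational coefficients in real unknowns $q_1,\dots,q_k$ and further auxiliary real unknowns, determined by these data, such that for every PBD $\mathbf P$ with - $\mathrm{Var}[\mathbf P]\le(1/\epsilon)^C$, $\tilde\sigma\in[\sqrt{\mathrm{Var}[\mathbf P]}/2,\,2\sqrt{\mathrm{Var}[\mathbf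 P]}+1]$ and $|\mathbb E[\mathbf P]-\tilde\mu|\le\tilde\sigma$, - $c_0X\le M\le\alpha X$, where $X=\log(1/\epsilon)+\sqrt{\mathrm{Var}[\mathbf P]\log(1/\epsilon)}$, - $\sum_{|\xi|\le\ell}|h_\xi-\widehat{\mathbf P}(\xi)|^2<\epsilon^2/16$, - the pattern admissible for $\epsilon$, $\mathbf P$ with constant $C$, the system has at most $K\log(1/\epsilon)$ inequalities and at most $K\log(1/\epsilon)$ auxiliary unknowns, each polynomial has total degree at most $K\log(1/\epsilon)$, each coefficient has encoding size at most $K\log^2(1/\epsilon)$ bits, and: (i) if $q_j\in[a_j,b_j]$ for all $j$ and the PBD $\mathbf Q$ with parameters $q_j$ of multiplicity $m_j$ satisfies $d_{TV}(\mathbf P,\mathbf Q)<\epsilon/\ell$, $\mathbb E[\mathbf Q]=\mathbb E[\mathbf P]$ and $\mathrm{Var}[\mathbf P]\ge\mathrm{Var}[\mathbf Q]\ge\mathrm{Var}[\mathbf P]/2$, then $(q_j)$, with suitable values of the auxiliary unknowns, solves $\mathcal P$; (ii) if $(q_j)$, with some values of the auxiliary unknowns, solves $\mathcal P$, then $q_j\in[0,1]$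 and $a_j-\epsilon^C\le q_j\le b_j+\epsilon^C$ for all $j$, and the PBD $\mathbf Q$ with parameters $q_j$ of multiplicity $m_j$ satisfies $d_{TV}(\mathbf P,\mathbf Q)<\epsilon/2$. -/

import Mathlib

open MeasureTheory ProbabilityTheory
open scoped unitInterval

noncomputable section

/-! ### Poisson binomial distributions -/

/-- The Poisson binomial distribution with parameters `p`: the law of the sum of independent
Bernoulli variables `X i` with `X i = 1` with probability `p i` and `X i = 0` otherwise. -/
def pbd {ι : Type*} [Fintype ι] (p : ι → I) : Measure ℕ :=
  (Measure.pi fun i => bernoulliMeasure (1 : ℕ) 0 (p i)).map fun x => ∑ i, x i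

/-- The Poisson binomial distribution in which the parameter `q j` has multiplicity `m j`. -/
def pbdMult {k : ℕ} (m : Fin k → ℕ) (q : Fin k → I) : Measure ℕ :=
  pbd fun s : (j : Fin k) × Fin (m j) => q s.1

/-- Expectation of a distribution on `ℕ`. -/
def distMean (P : Measure ℕ) : ℝ := ∫ j : ℕ, (j : ℝ) ∂P

/-- Variance of a distribution on `ℕ`. -/
def distVar (P : Measure ℕ) : ℝ := variance (fun j : ℕ => (j : ℝ)) P

/-- Total variation distance of two probability distributions on `ℕ`. -/
def tvDist (P Q : Measure ℕ) : ℝ := ⨆ S : Set ℕ, |P.real S - Q.real S|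

/-- Discrete Fourier transform modulo `M`: `ξ ↦ ∑ j, e(-ξ j / M) P(j)`, `e(x) = exp(2 π i x)`. -/
def dft (M : ℕ) (P : Measure ℕ) (ξ : ℤ) : ℂ :=
  ∫ j : ℕ, Complex.exp (2 * Real.pi * Complex.I * (-(ξ : ℂ) * (j : ℂ) / (M : ℂ))) ∂P

/-! ### Multiplicity and interval patterns -/

/-- `B_i = R ^ (2 ^ i)`. -/
def cut (R : ℝ) (i : ℕ) : ℝ := R ^ (2 ^ i)

/-- Labels for `[0,0]`, `[1,1]` and (the closures of) the intervals `I_i` and `J_i`. -/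
inductive Cell
  | zero
  | one
  | lower (i : ℕ)
  | upper (i : ℕ)
  deriving DecidableEq

/-- Lower end of `I_i`: it is `B_i` for `i ≤ L` and `0` for the last interval `I_{L+1}`. -/
def bandLo (R : ℝ) (L i : ℕ) : ℝ := if i ≤ L then cut R i else 0

/-- Upper end of `I_i`: `1/2` for `i = 0` and `B_{i-1}` for `i ≥ 1`. -/
def bandHi (R : ℝ) : ℕ → ℝ
  | 0 => 1 / 2
  | i + 1 => cut R i

/-- Left end of an interval of the partition. -/
def Cell.lo (R : ℝ) (L : ℕ) : Cell → ℝ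
  | .zero => 0
  | .one => 1
  | .lower i => bandLo R L i
  | .upper i => 1 - bandHi R i

/-- Right end of an interval of the partition. -/
def Cell.hi (R : ℝ) (L : ℕ) : Cell → ℝ
  | .zero => 0
  | .one => 1
  | .lower i => bandHi R i
  | .upper i => 1 - bandLo R L i

/-- The data of a pattern: the partition (`R` and `L`), and `k` parameters, the `j`-th of which
has multiplicity `mult j` and has to lie in the interval labelled `cell j`. -/
structure Pattern (k : ℕ) where
  R : ℝ
  L : ℕ
  cell : Fin k → Cell
  mult : Fin k → ℕ

namespace Pattern

variable {k : ℕ}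

/-- Left end `a_j` of the interval of the `j`-th parameter. -/
def a (T : Pattern k) (j : Fin k) : ℝ := (T.cell j).lo T.R T.L

/-- Right end `b_j` of the interval of the `j`-th parameter. -/
def b (T : Pattern k) (j : Fin k) : ℝ := (T.cell j).hi T.R T.L

/-- Number of distinct parameters that the pattern puts into the interval `c`. -/
def distinctIn (T : Pattern k) (c : Cell) : ℕ := (Finset.univ.filter fun j => T.cell j = c).card

/-- Number of parameters, with multiplicity, that the pattern puts into the interval `c`. -/
def countIn (T : Pattern k) (c : Cell) : ℕ := ∑ j with T.cell j = c, T.mult j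

/-- The pattern has the required form for accuracy `ε`, mean `μ` and variance `V`; `C` is the
constant implied in all `O(·)`, `Θ(·)` and `poly(·)`. -/
structure Admissible (T : Pattern k) (C : ℕ) (ε μ V : ℝ) : Prop where
  R_pos : 0 < T.R
  R_le : T.R ≤ 1 / 4
  /-- Together with the next field: `R = Θ(min {1/4, √(log (1/ε) / V)})`. -/
  R_lower : T.R = 1 / 4 ∨ Real.log (1 / ε) ≤ C * (T.R ^ 2 * V)
  R_upper : T.R ^ 2 * V ≤ C * Real.log (1 / ε)
  /-- Together with the next field: `B_L = poly(ε)`. -/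
  last_lower : ε ^ C ≤ cut T.R T.L
  last_upper : cut T.R T.L ^ C ≤ ε
  index_le : ∀ j i, (T.cell j = .lower i ∨ T.cell j = .upper i) → i ≤ T.L + 1
  mult_pos : ∀ j, 1 ≤ T.mult j
  zero_le_one : T.distinctIn .zero ≤ 1
  one_le_one : T.distinctIn .one ≤ 1
  /-- (i) `O(log (1/ε) / log (1/B_i))` distinct parameters in `I_i` and in `J_i`. -/
  distinct_le : ∀ i ≤ T.L, ∀ c, (c = .lower i ∨ c = .upper i) →
    (T.distinctIn c : ℝ) ≤ C * (Real.log (1 / ε) / Real.log (1 / cut T.R i))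
  /-- (ii) at most one parameter in each of the two extreme intervals. -/
  last_le_one : ∀ c, (c = .lower (T.L + 1) ∨ c = .upper (T.L + 1)) → T.countIn c ≤ 1
  /-- (iii) the number of parameters equal to `1` is within `poly(1/ε)` of the mean. -/
  ones_near : |(T.countIn .one : ℝ) - μ| ≤ (1 / ε) ^ C
  /-- (iv) `O(V / B_i)` parameters in `I_i` and in `J_i`. -/
  count_le : ∀ i ≤ T.L, ∀ c, (c = .lower i ∨ c = .upper i) →
    (T.countIn c : ℝ) ≤ C * (V / cut T.R i)

end Pattern

/-! ### Systems of polynomial inequalities -/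

/-- A finite system of inequalities `0 ≤ poly i` with rational coefficients, in `k` main unknowns
and `aux` auxiliary real unknowns. -/
structure PolySystem (k : ℕ) where
  aux : ℕ
  num : ℕ
  poly : Fin num → MvPolynomial (Fin k ⊕ Fin aux) ℚ

/-- `x` solves the system: for suitable values of the auxiliary unknowns all inequalities hold. -/
def PolySystem.IsSolution {k : ℕ} (S : PolySystem k) (x : Fin k → ℝ) : Prop :=
  ∃ y : Fin S.aux → ℝ, ∀ i, 0 ≤ MvPolynomial.aeval (Sum.elim x y) (S.poly i)

/-- Number of bits of a rational number: sign, numerator and denominator. -/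
def ratBits (r : ℚ) : ℕ := 1 + Nat.size r.num.natAbs + Nat.size r.den

end

/-! Throughout, V is the variance of the unknown distribution P, L = log(1/ε), and θ = 2πξ/M is a
Fourier angle.

Two facts turn closeness in total variation into finitely many Fourier conditions. By a Chernoff
bound, two PBDs with nearby means and variance O(V + 1) both live, up to O(ε) mass, in a window of
width O(L + √(VL)); since M exceeds this width, reduction modulo M loses nothing there. Parseval and
Cauchy–Schwarz then bound the distance by the ℓ² distance of the transforms (`tvDist_le_of_dft`).
Moreover |P̂(ξ)|² ≤ exp(-16V(ξ/M)²), so frequencies above ℓ contribute O(ε²) when V is a large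
multiple of L, while for smaller V there are none, because ℓ ≥ M/2. This gives
`tvDist_lt_of_fourier`. Conversely each Fourier coefficient moves by at most twice the total
variation distance (`sum_norm_sub_dft_sq_le_of_tvDist`). It thus suffices to impose bounds on mean
and variance, and ℓ² closeness of Q̂ to the given h.

The obstacle is the degree: Q̂(ξ) = ∏ (1 + q_j(e^{-iθ} - 1))^{m_j} has multiplicities polynomial in
1/ε or larger. Each q_j is therefore measured from the nearer end r_j of [0,1], which extracts a
pure rotation; a further rotation by the guessed mean is applied. Parameters with r_j|θ| bounded by
about 1/4 are rewritten as exp(∑ m_j log(1 + r_j w)), with w = e^{±iθ} - 1. In this exponent the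
linear terms cancel against the rotation up to the error in the mean and the contribution of the
remaining parameters, and the rest is O(θ²V). All of this is O(L), because |θ|²V = O(L). Hence
Taylor polynomials of log and exp with D = O(L) terms are accurate to 2^{-D} times a polynomial in
1/ε (`norm_approx_sub_le`). The remaining parameters are left as powers: they lie in intervals with
B_i bounded below, and the pattern gives them total multiplicity O(L) (`sum_mult_big_le`).

Auxiliary unknowns stand for the real and imaginary part of the exponent at each frequency, so the
degrees of the log and exp polynomials do not multiply. All constants are rounded to D + 1 binary
places. Degrees and bit lengths are tracked by `IsRatPoly` (degree, common denominator, normalised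
sum of absolute coefficients), which leads to `exists_fourierSystem`.

The truncated residual is required to be at most 0.3ε in ℓ², and truncation costs at most 0.03ε
(`fourier_gap`). A good Q has true residual at most 0.26ε, hence is accepted (`feasible`). An
accepted Q has true residual at most 0.33ε, which the Fourier criterion turns into distance below
ε/2 (`sound`). -/

noncomputable section

/-! ### Generating function, moments, Fourier decay and tails of Poisson binomial laws. -/

section PoissonBinomial

variable {ι : Type*} [Fintype ι]

instance isProbabilityMeasure_pbd (p : ι → I) : IsProbabilityMeasure (pbd p) :=
  Measure.isProbabilityMeasure_map (by fun_prop)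

theorem integral_pbd {E : Type*} [NormedAddCommGroup E] [NormedSpace ℝ E] (p : ι → I)
    (f : ℕ → E) : ∫ j, f j ∂(pbd p) =
      ∫ x : ι → ℕ, f (∑ i, x i) ∂(Measure.pi fun i => bernoulliMeasure (1 : ℕ) 0 (p i)) := by
  rw [pbd, integral_map (by fun_prop) StronglyMeasurable.of_discrete.aestronglyMeasurable]

theorem ae_le_card_pbd (p : ι → I) : ∀ᵐ j ∂(pbd p), j ≤ Fintype.card ι := by
  rw [pbd, ae_map_iff (by fun_prop) (MeasurableSet.of_discrete)]
  have h : ∀ i, ∀ᵐ x ∂(Measure.pi fun i => bernoulliMeasure (1 : ℕ) 0 (p i)), x i ≤ 1 := by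
    intro i
    have h1 : ∀ᵐ y ∂(bernoulliMeasure (1 : ℕ) 0 (p i)), y ≤ 1 := by
      rw [ae_iff, bernoulliMeasure_apply_of_notMem_of_notMem] <;> simp
    exact (measurePreserving_eval (fun i => bernoulliMeasure (1 : ℕ) 0 (p i)) i).quasiMeasurePreserving.ae h1
  filter_upwards [ae_all_iff.2 h] with x hx
  calc ∑ i, x i ≤ ∑ _i : ι, 1 := Finset.sum_le_sum fun i _ => hx i
    _ = _ := by simp

theorem integrable_pbd {E : Type*} [NormedAddCommGroup E] (p : ι → I) (f : ℕ → E) :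
    Integrable f (pbd p) := by
  refine Integrable.of_bound StronglyMeasurable.of_discrete.aestronglyMeasurable
    (∑ j ∈ Finset.range (Fintype.card ι + 1), ‖f j‖) ?_
  filter_upwards [ae_le_card_pbd p] with j hj
  exact Finset.single_le_sum (f := fun j => ‖f j‖) (fun _ _ => norm_nonneg _)
    (Finset.mem_range.2 (by omega))

/-- Independence turns the expectation of a power of the sum into a product. The field is left
general so that the same formula yields the Fourier transform (a on the unit circle) and the
exponential moments (a = e^t). -/
theorem integral_pow_pbd {𝕜 : Type*} [RCLike 𝕜] (p : ι → I) (a : 𝕜) :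
    ∫ j, a ^ j ∂(pbd p) = ∏ i, (1 + ((p i : ℝ) : 𝕜) * (a - 1)) := by
  rw [integral_pbd]
  simp_rw [← Finset.prod_pow_eq_pow_sum]
  rw [integral_fintype_prod_eq_prod (fun _ (j : ℕ) => a ^ j)]
  refine Finset.prod_congr rfl fun i _ => ?_
  rw [integral_bernoulliMeasure]
  simp only [RCLike.real_smul_eq_coe_mul]
  push_cast
  ring

theorem distMean_pbd (p : ι → I) : distMean (pbd p) = ∑ i, (p i : ℝ) := by
  rw [distMean, integral_pbd]
  have hi : ∀ i, Integrable (fun x : ι → ℕ => ((x i : ℕ) : ℝ))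
      (Measure.pi fun i => bernoulliMeasure (1 : ℕ) 0 (p i)) := fun i =>
    (measurePreserving_eval (fun i => bernoulliMeasure (1 : ℕ) 0 (p i)) i).integrable_comp_of_integrable
      (integrable_bernoulliMeasure 1 0 (p i) (fun j : ℕ => (j : ℝ)))
  push_cast
  rw [integral_finsetSum _ fun i _ => hi i]
  refine Finset.sum_congr rfl fun i _ => ?_
  have := integral_map (μ := Measure.pi fun i => bernoulliMeasure (1 : ℕ) 0 (p i))
    (φ := fun x => x i) (f := fun j : ℕ => (j : ℝ)) (measurable_pi_apply i).aemeasurable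
    (Measurable.of_discrete.aestronglyMeasurable)
  rw [← this, (measurePreserving_eval (fun i => bernoulliMeasure (1 : ℕ) 0 (p i)) i).map_eq,
    integral_bernoulliMeasure]
  simp

theorem distVar_pbd (p : ι → I) : distVar (pbd p) = ∑ i, (p i : ℝ) * (1 - p i) := by
  rw [distVar, pbd, variance_map (Measurable.of_discrete.aemeasurable) (by fun_prop)]
  have h2 : ∀ i, MemLp (fun j : ℕ => (j : ℝ)) 2 (bernoulliMeasure (1 : ℕ) 0 (p i)) := fun i =>
    (memLp_two_iff_integrable_sq (Measurable.of_discrete.aestronglyMeasurable)).2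
      (integrable_bernoulliMeasure _ _ _ _)
  have := variance_sum_pi h2
  rw [show ((fun j : ℕ => (j : ℝ)) ∘ fun x : ι → ℕ => ∑ i, x i) =
    ∑ i, fun x : ι → ℕ => ((x i : ℕ) : ℝ) from by ext x; simp, this]
  refine Finset.sum_congr rfl fun i _ => ?_
  rw [variance_eq_sub (h2 i), integral_bernoulliMeasure, integral_bernoulliMeasure]
  simp
  ring

theorem dft_eq_integral_pow (M : ℕ) (P : Measure ℕ) (ξ : ℤ) :
    dft M P ξ = ∫ j, Complex.exp ((-(2 * Real.pi * ξ / M) : ℝ) * Complex.I) ^ j ∂P := by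
  rw [dft]
  congr 1
  ext j
  rw [← Complex.exp_nat_mul]
  congr 1
  push_cast
  ring

theorem dft_pbd (M : ℕ) (p : ι → I) (ξ : ℤ) : dft M (pbd p) ξ =
    ∏ i, (1 + (p i : ℂ) * (Complex.exp ((-(2 * Real.pi * ξ / M) : ℝ) * Complex.I) - 1)) := by
  rw [dft_eq_integral_pow, integral_pow_pbd]
  rfl

/-- One Bernoulli factor of the Fourier transform. -/
theorem normSq_one_add_mul_exp_sub_one (p θ : ℝ) :
    ‖1 + (p : ℂ) * (Complex.exp (θ * Complex.I) - 1)‖ ^ 2 =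
      1 - 2 * (p * (1 - p)) * (1 - Real.cos θ) := by
  rw [← Complex.normSq_eq_norm_sq, Complex.normSq_apply]
  simp [Complex.exp_ofReal_mul_I_re, Complex.exp_ofReal_mul_I_im]
  linear_combination p ^ 2 * Real.sin_sq_add_cos_sq θ

theorem norm_one_add_mul_exp_sub_one_le {p : ℝ} (h0 : 0 ≤ p) (h1 : p ≤ 1) (θ : ℝ) :
    ‖1 + (p : ℂ) * (Complex.exp (θ * Complex.I) - 1)‖ ≤ 1 := by
  have h := normSq_one_add_mul_exp_sub_one p θ
  have := mul_nonneg (mul_nonneg h0 (sub_nonneg.2 h1)) (sub_nonneg.2 (Real.cos_le_one θ))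
  exact abs_le_one_iff_mul_self_le_one.2 (by nlinarith) |> (abs_le.1 · |>.2)

/-- Applying 1 - x ≤ e^{-x} to each Bernoulli factor collects the p(1 - p) into the variance. -/
theorem norm_dft_pbd_sq_le (M : ℕ) (p : ι → I) (ξ : ℤ) : ‖dft M (pbd p) ξ‖ ^ 2 ≤
    Real.exp (-(2 * distVar (pbd p) * (1 - Real.cos (2 * Real.pi * ξ / M)))) := by
  rw [dft_pbd, norm_prod, ← Finset.prod_pow, distVar_pbd]
  have : -(2 * (∑ i, (p i : ℝ) * (1 - p i)) * (1 - Real.cos (2 * Real.pi * ξ / M))) =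
      ∑ i, -(2 * ((p i : ℝ) * (1 - p i)) * (1 - Real.cos (2 * Real.pi * ξ / M))) := by
    rw [Finset.sum_neg_distrib, Finset.mul_sum, Finset.sum_mul]
  rw [this, Real.exp_sum]
  refine Finset.prod_le_prod (fun i _ => by positivity) fun i _ => ?_
  rw [normSq_one_add_mul_exp_sub_one, Real.cos_neg]
  have := Real.add_one_le_exp (-(2 * ((p i : ℝ) * (1 - p i)) * (1 - Real.cos (2 * Real.pi * ξ / M))))
  linarith

/-- For one centred Bernoulli variable use e^y ≤ 1 + y + y² for |y| ≤ 1: the linear terms cancel,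
and the quadratic ones add up to t²q(1 - q). -/
theorem mgf_pbd_le (p : ι → I) {t : ℝ} (ht : |t| ≤ 1) :
    ∫ j : ℕ, Real.exp (t * (j - distMean (pbd p))) ∂(pbd p) ≤
      Real.exp (t ^ 2 * distVar (pbd p)) := by
  have h1 : ∀ j : ℕ, Real.exp (t * (j - distMean (pbd p))) =
      Real.exp (-(t * distMean (pbd p))) * Real.exp t ^ j := by
    intro j
    rw [← Real.exp_nat_mul, ← Real.exp_add]
    ring_nf
  simp_rw [h1]
  rw [integral_const_mul, integral_pow_pbd, distMean_pbd, distVar_pbd, Finset.mul_sum,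
    Finset.mul_sum, ← Finset.sum_neg_distrib, Real.exp_sum, Real.exp_sum, ← Finset.prod_mul_distrib]
  refine Finset.prod_le_prod (fun i _ => ?_) fun i _ => ?_
  · have := (p i).2.1
    have := (p i).2.2
    have := Real.exp_pos t
    refine mul_nonneg (Real.exp_pos _).le ?_
    simp only [RCLike.ofReal_real_eq_id, id_eq]
    nlinarith
  · obtain ⟨q, h0, h1⟩ := p i
    simp only [RCLike.ofReal_real_eq_id, id_eq]
    obtain ⟨ht1, ht2⟩ := abs_le.1 ht
    have key : ∀ y : ℝ, |y| ≤ 1 → Real.exp y ≤ 1 + y + y ^ 2 := by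
      intro y hy
      have := Real.abs_exp_sub_one_sub_id_le hy
      linarith [(abs_le.1 this).2]
    have e1 := key (t * (1 - q)) (by rw [abs_mul, abs_of_nonneg (by linarith : 0 ≤ 1 - q)]; nlinarith [abs_nonneg t])
    have e2 := key (-(t * q)) (by rw [abs_neg, abs_mul, abs_of_nonneg h0]; nlinarith [abs_nonneg t])
    have e3 := Real.add_one_le_exp (t ^ 2 * (q * (1 - q)))
    have e4 : Real.exp (-(t * q)) * (1 + q * (Real.exp t - 1)) =
        (1 - q) * Real.exp (-(t * q)) + q * Real.exp (t * (1 - q)) := by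
      rw [show t * (1 - q) = -(t * q) + t by ring, Real.exp_add]
      ring
    rw [e4]
    nlinarith [mul_le_mul_of_nonneg_left e1 h0, mul_le_mul_of_nonneg_left e2 (by linarith : 0 ≤ 1 - q)]

theorem pbd_tail_le (p : ι → I) {t : ℝ} (ht0 : 0 ≤ t) (ht : t ≤ 1) (r : ℝ) :
    (pbd p).real {j : ℕ | r < |(j : ℝ) - distMean (pbd p)|} ≤
      2 * Real.exp (-(t * r) + t ^ 2 * distVar (pbd p)) := by
  have hup := measure_ge_le_exp_mul_mgf (μ := pbd p)
    (X := fun j : ℕ => (j : ℝ) - distMean (pbd p)) r ht0 (integrable_pbd _ _)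
  have hlo := measure_le_le_exp_mul_mgf (μ := pbd p) (t := -t)
    (X := fun j : ℕ => (j : ℝ) - distMean (pbd p)) (-r) (by linarith) (integrable_pbd _ _)
  have m1 := mgf_pbd_le p (t := t) (abs_le.2 ⟨by linarith, ht⟩)
  have m2 := mgf_pbd_le p (t := -t) (abs_le.2 ⟨by linarith, by linarith⟩)
  have hsub : {j : ℕ | r < |(j : ℝ) - distMean (pbd p)|} ⊆
      {j : ℕ | r ≤ (j : ℝ) - distMean (pbd p)} ∪ {j : ℕ | (j : ℝ) - distMean (pbd p) ≤ -r} := by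
    intro j hj
    rcases lt_abs.1 (show r < |(j : ℝ) - distMean (pbd p)| from hj) with h | h
    · exact Or.inl h.le
    · exact Or.inr (show (j : ℝ) - distMean (pbd p) ≤ -r by linarith)
  have h1 := (measureReal_mono hsub).trans (measureReal_union_le (μ := pbd p) _ _)
  have h2 : Real.exp (-t * r) * mgf (fun j : ℕ => (j : ℝ) - distMean (pbd p)) (pbd p) t ≤
      Real.exp (-(t * r) + t ^ 2 * distVar (pbd p)) := by
    rw [Real.exp_add, neg_mul]
    exact mul_le_mul_of_nonneg_left m1 (Real.exp_pos _).le
  have h3 : Real.exp (- -t * -r) * mgf (fun j : ℕ => (j : ℝ) - distMean (pbd p)) (pbd p) (-t) ≤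
      Real.exp (-(t * r) + t ^ 2 * distVar (pbd p)) := by
    rw [Real.exp_add, neg_neg, mul_neg]
    rw [neg_sq] at m2
    exact mul_le_mul_of_nonneg_left m2 (Real.exp_pos _).le
  linarith

theorem prod_sigma_mult {k : ℕ} {E : Type*} [CommMonoid E] (m : Fin k → ℕ) (f : Fin k → E) :
    ∏ s : (j : Fin k) × Fin (m j), f s.1 = ∏ j, f j ^ m j := by
  rw [Fintype.prod_sigma]
  simp

theorem distMean_pbdMult {k : ℕ} (m : Fin k → ℕ) (q : Fin k → I) :
    distMean (pbdMult m q) = ∑ j, m j * (q j : ℝ) := by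
  rw [pbdMult, distMean_pbd, Fintype.sum_sigma]
  simp

theorem distVar_pbdMult {k : ℕ} (m : Fin k → ℕ) (q : Fin k → I) :
    distVar (pbdMult m q) = ∑ j, m j * ((q j : ℝ) * (1 - q j)) := by
  rw [pbdMult, distVar_pbd, Fintype.sum_sigma]
  simp

theorem dft_pbdMult {k : ℕ} (M : ℕ) (m : Fin k → ℕ) (q : Fin k → I) (ξ : ℤ) :
    dft M (pbdMult m q) ξ = ∏ j, (1 + (q j : ℂ) *
      (Complex.exp ((-(2 * Real.pi * ξ / M) : ℝ) * Complex.I) - 1)) ^ m j := by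
  rw [pbdMult, dft_pbd]
  exact prod_sigma_mult m fun j => 1 + (q j : ℂ) *
    (Complex.exp ((-(2 * Real.pi * ξ / M) : ℝ) * Complex.I) - 1)

end PoissonBinomial

/-! ### Total variation distance tested against bounded functions. -/

section TotalVariation

theorem le_tvDist (P Q : Measure ℕ) [IsProbabilityMeasure P] [IsProbabilityMeasure Q] (S : Set ℕ) :
    |P.real S - Q.real S| ≤ tvDist P Q := by
  refine le_ciSup (f := fun S : Set ℕ => |P.real S - Q.real S|) ⟨1, ?_⟩ S
  rintro _ ⟨S, rfl⟩
  exact abs_le.2 ⟨by linarith [measureReal_nonneg (μ := P) (s := S), measureReal_le_one (μ := Q) (s := S)],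
    by linarith [measureReal_nonneg (μ := Q) (s := S), measureReal_le_one (μ := P) (s := S)]⟩

theorem integral_pbd_eq_sum {ι : Type*} [Fintype ι] (p : ι → I) (f : ℕ → ℂ) {n : ℕ}
    (hn : Fintype.card ι < n) :
    ∫ j, f j ∂(pbd p) = ∑ j ∈ Finset.range n, (pbd p).real {j} • f j := by
  rw [← setIntegral_finset _ (integrable_pbd p f).integrableOn,
    Measure.restrict_eq_self_of_ae_mem]
  filter_upwards [ae_le_card_pbd p] with j hj
  simpa using by omega

/-- Split by the sign of the difference: each half is a difference of the measures of one set. -/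
theorem sum_abs_sub_le_tvDist (P Q : Measure ℕ) [IsProbabilityMeasure P] [IsProbabilityMeasure Q]
    (s : Finset ℕ) : ∑ j ∈ s, |P.real {j} - Q.real {j}| ≤ 2 * tvDist P Q := by
  classical
  have h : ∀ t : Finset ℕ, |∑ j ∈ t, (P.real {j} - Q.real {j})| ≤ tvDist P Q := by
    intro t
    rw [Finset.sum_sub_distrib, sum_measureReal_singleton, sum_measureReal_singleton]
    exact le_tvDist P Q _
  rw [← Finset.sum_filter_add_sum_filter_not s (fun j => 0 ≤ P.real {j} - Q.real {j})]
  have h1 : ∑ j ∈ s with 0 ≤ P.real {j} - Q.real {j}, |P.real {j} - Q.real {j}| ≤ tvDist P Q := by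
    refine le_trans (le_of_eq ?_) ((le_abs_self _).trans
      (h (s.filter fun j => 0 ≤ P.real {j} - Q.real {j})))
    exact Finset.sum_congr rfl fun j hj => abs_of_nonneg (Finset.mem_filter.1 hj).2
  have h2 : ∑ j ∈ s with ¬ 0 ≤ P.real {j} - Q.real {j}, |P.real {j} - Q.real {j}| ≤ tvDist P Q := by
    refine le_trans (le_of_eq ?_) ((neg_le_abs _).trans
      (h (s.filter fun j => ¬ 0 ≤ P.real {j} - Q.real {j})))
    rw [← Finset.sum_neg_distrib]
    exact Finset.sum_congr rfl fun j hj => abs_of_neg (not_le.1 (Finset.mem_filter.1 hj).2)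
  linarith

theorem norm_integral_sub_integral_le_tvDist {ι κ : Type*} [Fintype ι] [Fintype κ] (p : ι → I)
    (q : κ → I) (f : ℕ → ℂ) (hf : ∀ j, ‖f j‖ ≤ 1) :
    ‖∫ j, f j ∂(pbd p) - ∫ j, f j ∂(pbd q)‖ ≤ 2 * tvDist (pbd p) (pbd q) := by
  rw [integral_pbd_eq_sum p f (n := Fintype.card ι + Fintype.card κ + 1) (by omega),
    integral_pbd_eq_sum q f (n := Fintype.card ι + Fintype.card κ + 1) (by omega),
    ← Finset.sum_sub_distrib]
  refine (norm_sum_le _ _).trans (le_trans (Finset.sum_le_sum fun j _ => ?_)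
    (sum_abs_sub_le_tvDist (pbd p) (pbd q) (Finset.range (Fintype.card ι + Fintype.card κ + 1))))
  rw [← sub_smul, norm_smul, Real.norm_eq_abs]
  exact mul_le_of_le_one_right (abs_nonneg _) (hf j)

theorem norm_dft_sub_dft_le_tvDist {ι κ : Type*} [Fintype ι] [Fintype κ] (p : ι → I)
    (q : κ → I) (M : ℕ) (ξ : ℤ) :
    ‖dft M (pbd p) ξ - dft M (pbd q) ξ‖ ≤ 2 * tvDist (pbd p) (pbd q) := by
  rw [dft_eq_integral_pow, dft_eq_integral_pow]
  refine norm_integral_sub_integral_le_tvDist p q _ fun j => ?_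
  rw [norm_pow, Complex.norm_exp_ofReal_mul_I, one_pow]

/-- Testing with the ±1 function of a set, instead of its indicator, saves a factor 2: a bound D on
the difference of the integrals gives D/2 for the set. -/
theorem integral_sign_pbd {ι : Type*} [Fintype ι] (p : ι → I) (S : Set ℕ) :
    ∫ j, (2 * S.indicator 1 j - 1 : ℂ) ∂(pbd p) = 2 * (pbd p).real S - 1 := by
  rw [integral_sub (integrable_pbd _ _) (integrable_pbd _ _), integral_const_mul,
    integral_indicator MeasurableSet.of_discrete]
  simp

theorem injOn_natCast_of_abs_sub_le {M : ℕ} {r c : ℝ} (h : 2 * r < M) :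
    Set.InjOn (fun j : ℕ => (j : ZMod M)) {j : ℕ | |(j : ℝ) - c| ≤ r} := by
  intro i hi j hj hij
  have hi : |(i : ℝ) - c| ≤ r := hi
  have hj : |(j : ℝ) - c| ≤ r := hj
  have h1 : (M : ℤ) ∣ (j : ℤ) - i :=
    (Nat.modEq_iff_dvd).1 ((ZMod.natCast_eq_natCast_iff i j M).1 hij)
  have h2 : |((j : ℤ) - i : ℤ)| < M := by
    have : |(j : ℝ) - i| < M := by
      have := abs_sub_le (j : ℝ) c i
      rw [abs_sub_comm c] at this
      linarith
    exact_mod_cast this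
  have := Int.eq_zero_of_abs_lt_dvd h1 h2
  omega

end TotalVariation

/-! ### Parseval modulo M and the splitting into low and high frequencies. -/

section Fourier

open ZMod

variable {M : ℕ} [NeZero M]

theorem conj_zmodDFT (g : ZMod M → ℂ) (k : ZMod M) :
    starRingEnd ℂ (ZMod.dft g k) = ∑ j, stdAddChar (j * k) * starRingEnd ℂ (g j) := by
  rw [dft_apply, map_sum]
  refine Finset.sum_congr rfl fun j _ => ?_
  rw [smul_eq_mul, map_mul, AddChar.map_neg_eq_conj, Complex.conj_conj]

/-- Parseval's identity, read off from the inversion formula `dft_dft`. -/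
theorem sum_norm_zmodDFT_sq (g : ZMod M → ℂ) :
    ∑ k, ‖ZMod.dft g k‖ ^ 2 = M * ∑ j, ‖g j‖ ^ 2 := by
  have h : ((∑ k, ‖ZMod.dft g k‖ ^ 2 : ℝ) : ℂ) = ((M * ∑ j, ‖g j‖ ^ 2 : ℝ) : ℂ) := by
    push_cast
    simp_rw [← Complex.conj_mul', conj_zmodDFT, Finset.sum_mul]
    rw [Finset.sum_comm, Finset.mul_sum]
    refine Finset.sum_congr rfl fun j _ => ?_
    have h2 := congrFun (dft_dft g) (-j)
    rw [dft_apply, neg_neg, smul_eq_mul] at h2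
    rw [mul_left_comm, ← h2, Finset.mul_sum]
    refine Finset.sum_congr rfl fun k _ => ?_
    rw [smul_eq_mul, show -(k * -j) = j * k by ring]
    ring
  exact_mod_cast h

/-- Links integer frequencies with characters of ℤ/M. The representative of least absolute value is
used because the decay estimate holds for 2|ξ| ≤ M. -/
theorem dft_eq_integral_stdAddChar (P : Measure ℕ) (ξ : ZMod M) :
    dft M P ξ.valMinAbs = ∫ j : ℕ, stdAddChar (-((j : ZMod M) * ξ)) ∂P := by
  rw [_root_.dft]
  congr 1
  ext j
  have := stdAddChar_coe (N := M) (-(j * ξ.valMinAbs))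
  push_cast [coe_valMinAbs] at this
  rw [this]
  congr 1
  ring

/-- Total variation distance through Fourier coefficients modulo `M`, for distributions
concentrated on a set that embeds into `ℤ / M`. -/
theorem tvDist_le_of_dft {ι κ : Type*} [Fintype ι] [Fintype κ] (p : ι → I) (q : κ → I)
    (W : Set ℕ) (hW : Set.InjOn (fun j : ℕ => (j : ZMod M)) W) {δ D : ℝ}
    (hp : (pbd p).real Wᶜ ≤ δ) (hq : (pbd q).real Wᶜ ≤ δ) (hD0 : 0 ≤ D)
    (hD : ∑ ξ : ZMod M, ‖dft M (pbd p) ξ.valMinAbs - dft M (pbd q) ξ.valMinAbs‖ ^ 2 ≤ D ^ 2) :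
    tvDist (pbd p) (pbd q) ≤ D / 2 + 2 * δ := by
  classical
  refine ciSup_le fun S => ?_
  let f : ℕ → ℂ := fun j => 2 * S.indicator 1 j - 1
  have hf1 : ∀ j, ‖f j‖ ≤ 1 := fun j => by
    by_cases h : j ∈ S <;> simp [f, h]
    norm_num
  -- Transport of the test function to residues; it is unambiguous because the window embeds, and
  -- residues missed by the window get 0.
  let g : ZMod M → ℂ := fun r => if h : ∃ j ∈ W, (j : ZMod M) = r then f h.choose else 0
  have hg1 : ∀ r, ‖g r‖ ≤ 1 := fun r => by
    simp only [g]
    split_ifs with h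
    · exact hf1 _
    · simp
  have hgW : ∀ j ∈ W, g (j : ZMod M) = f j := by
    intro j hj
    have h : ∃ j' ∈ W, (j' : ZMod M) = (j : ZMod M) := ⟨j, hj, rfl⟩
    simp only [g, dif_pos h]
    rw [hW h.choose_spec.1 hj h.choose_spec.2]
  have happ : ∀ P : Measure ℕ, (∀ u : ℕ → ℂ, Integrable u P) → (∀ u : ℕ → ℝ, Integrable u P) →
      P.real Wᶜ ≤ δ → ‖∫ j, f j ∂P - ∫ j, g (j : ZMod M) ∂P‖ ≤ 2 * δ := by
    intro P hP hP2 hPW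
    rw [← integral_sub (hP _) (hP _)]
    refine (norm_integral_le_integral_norm _).trans ?_
    have h1 : ∀ j : ℕ, ‖f j - g (j : ZMod M)‖ ≤ Wᶜ.indicator (fun _ => (2 : ℝ)) j := by
      intro j
      by_cases h : j ∈ W
      · simp [hgW j h, h]
      · rw [Set.indicator_of_mem (by exact h)]
        exact (norm_sub_le _ _).trans (by linarith [hf1 j, hg1 (j : ZMod M)])
    refine (integral_mono (hP2 _) (hP2 _) h1).trans ?_
    rw [integral_indicator MeasurableSet.of_discrete]
    simp
    linarith
  have hM0 : (0 : ℝ) < M := Nat.cast_pos.2 (NeZero.pos M)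
  have hexp : ∀ P : Measure ℕ, (∀ u : ℕ → ℂ, Integrable u P) → ∫ j, g (j : ZMod M) ∂P =
      ∑ ξ : ZMod M, (M : ℂ)⁻¹ * ZMod.dft g (-ξ) * dft M P ξ.valMinAbs := by
    intro P hP
    have h1 : ∀ j : ℕ, g (j : ZMod M) =
        ∑ ξ : ZMod M, (M : ℂ)⁻¹ * ZMod.dft g (-ξ) * stdAddChar (-((j : ZMod M) * ξ)) := by
      intro j
      have h2 := congrFun (dft_dft g) (-(j : ZMod M))
      rw [dft_apply, neg_neg, smul_eq_mul] at h2
      have h3 : g (j : ZMod M) = (M : ℂ)⁻¹ * (M * g j) := by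
        rw [inv_mul_cancel_left₀]
        exact_mod_cast hM0.ne'
      rw [h3, ← h2, Finset.mul_sum, ← Equiv.sum_comp (Equiv.neg (ZMod M))]
      refine Finset.sum_congr rfl fun k _ => ?_
      rw [smul_eq_mul, Equiv.neg_apply, show -(-k * -(j : ZMod M)) = -((j : ZMod M) * k) by ring]
      ring
    simp_rw [h1]
    rw [integral_finsetSum _ fun _ _ => hP _]
    refine Finset.sum_congr rfl fun ξ _ => ?_
    rw [integral_const_mul, dft_eq_integral_stdAddChar]
  have hdiff : ‖∫ j, g (j : ZMod M) ∂(pbd p) - ∫ j, g (j : ZMod M) ∂(pbd q)‖ ≤ D := by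
    rw [hexp _ (integrable_pbd p), hexp _ (integrable_pbd q), ← Finset.sum_sub_distrib]
    simp_rw [← mul_sub]
    refine (norm_sum_le _ _).trans ?_
    simp_rw [norm_mul]
    refine (Real.sum_mul_le_sqrt_mul_sqrt _ _ _).trans ?_
    -- By Parseval and |g| ≤ 1 the sum is at most M⁻² · M · M.
    have h1 : ∑ ξ : ZMod M, (‖(M : ℂ)⁻¹‖ * ‖ZMod.dft g (-ξ)‖) ^ 2 ≤ 1 := by
      simp_rw [mul_pow]
      have h0 := Equiv.sum_comp (Equiv.neg (ZMod M)) (fun k => ‖ZMod.dft g k‖ ^ 2)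
      simp only [Equiv.neg_apply] at h0
      rw [← Finset.mul_sum, h0, sum_norm_zmodDFT_sq]
      have h2 : ∑ j : ZMod M, ‖g j‖ ^ 2 ≤ M := by
        calc ∑ j : ZMod M, ‖g j‖ ^ 2 ≤ ∑ _j : ZMod M, (1 : ℝ) :=
              Finset.sum_le_sum fun j _ => pow_le_one₀ (norm_nonneg _) (hg1 j)
          _ = M := by simp [ZMod.card]
      rw [norm_inv, Complex.norm_natCast, inv_pow, inv_mul_le_iff₀ (by positivity)]
      nlinarith
    have h2 : √(∑ ξ : ZMod M, ‖dft M (pbd p) ξ.valMinAbs - dft M (pbd q) ξ.valMinAbs‖ ^ 2) ≤ D :=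
      (Real.sqrt_le_left hD0).2 hD
    have h3 := Real.sqrt_le_one.2 h1
    calc _ ≤ 1 * D := mul_le_mul h3 h2 (Real.sqrt_nonneg _) zero_le_one
      _ = D := one_mul D
  have h1 := happ (pbd p) (integrable_pbd p) (integrable_pbd p) hp
  have h2 := happ (pbd q) (integrable_pbd q) (integrable_pbd q) hq
  have h3 : ‖∫ j, f j ∂(pbd p) - ∫ j, f j ∂(pbd q)‖ ≤ D + 4 * δ := by
    have e : ∫ j, f j ∂(pbd p) - ∫ j, f j ∂(pbd q) =
        (∫ j, f j ∂(pbd p) - ∫ j, g (j : ZMod M) ∂(pbd p)) +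
        (∫ j, g (j : ZMod M) ∂(pbd p) - ∫ j, g (j : ZMod M) ∂(pbd q)) -
        (∫ j, f j ∂(pbd q) - ∫ j, g (j : ZMod M) ∂(pbd q)) := by ring
    rw [e]
    refine (norm_sub_le _ _).trans ?_
    have := norm_add_le (∫ j, f j ∂(pbd p) - ∫ j, g (j : ZMod M) ∂(pbd p))
      (∫ j, g (j : ZMod M) ∂(pbd p) - ∫ j, g (j : ZMod M) ∂(pbd q))
    linarith
  rw [integral_sign_pbd p, integral_sign_pbd q] at h3
  have e : (2 * ((pbd p).real S : ℂ) - 1) - (2 * (pbd q).real S - 1) =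
      ((2 * ((pbd p).real S - (pbd q).real S) : ℝ) : ℂ) := by push_cast; ring
  rw [e, Complex.norm_real, Real.norm_eq_abs, abs_mul, abs_two] at h3
  linarith

theorem sum_two_inv_pow_natAbs_le (s : Finset ℤ) : ∑ n ∈ s, (1 / 2 : ℝ) ^ n.natAbs ≤ 4 := by
  classical
  have h : ∀ t : Finset ℤ, Set.InjOn Int.natAbs t → ∑ n ∈ t, (1 / 2 : ℝ) ^ n.natAbs ≤ 2 := by
    intro t ht
    rw [← Finset.sum_image (f := fun n : ℕ => (1 / 2 : ℝ) ^ n) ht]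
    refine le_of_le_of_eq ?_ tsum_geometric_two
    exact summable_geometric_two.sum_le_tsum _ fun _ _ => by positivity
  rw [← Finset.sum_filter_add_sum_filter_not s (fun n => 0 ≤ n)]
  have h1 := h (s.filter fun n => 0 ≤ n) (by
    intro a ha b hb hab
    simp only [Finset.coe_filter, Set.mem_ofPred_eq] at ha hb
    have hab : a.natAbs = b.natAbs := hab
    omega)
  have h2 := h (s.filter fun n => ¬ 0 ≤ n) (by
    intro a ha b hb hab
    simp only [Finset.coe_filter, Set.mem_ofPred_eq] at ha hb
    have hab : a.natAbs = b.natAbs := hab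
    omega)
  linarith

/-- Sum over residues modulo `M` split at frequency `l`. -/
theorem sum_zmod_le_of_tail (F : ℤ → ℝ) (hF : ∀ n, 0 ≤ F n) (l : ℕ) {B : ℝ} (hB : 0 ≤ B)
    (htail : ∀ n : ℤ, l < n.natAbs → 2 * n.natAbs ≤ M → F n ≤ B * (1 / 2) ^ n.natAbs) :
    ∑ ξ : ZMod M, F ξ.valMinAbs ≤ ∑ ξ ∈ Finset.Icc (-(l : ℤ)) l, F ξ + 4 * B := by
  classical
  rw [← Finset.sum_filter_add_sum_filter_not Finset.univ (fun ξ : ZMod M => ξ.valMinAbs.natAbs ≤ l)]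
  refine add_le_add ?_ ?_
  · rw [← Finset.sum_image (f := F) (injective_valMinAbs.injOn)]
    refine Finset.sum_le_sum_of_subset_of_nonneg ?_ fun _ _ _ => hF _
    intro n hn
    obtain ⟨ξ, hξ, rfl⟩ := Finset.mem_image.1 hn
    have := (Finset.mem_filter.1 hξ).2
    exact Finset.mem_Icc.2 (by omega)
  · calc _ ≤ ∑ ξ : ZMod M with ¬ ξ.valMinAbs.natAbs ≤ l, B * (1 / 2) ^ ξ.valMinAbs.natAbs := by
          refine Finset.sum_le_sum fun ξ hξ => htail _ ?_ ?_
          · exact not_le.1 (Finset.mem_filter.1 hξ).2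
          · have := natAbs_valMinAbs_le ξ
            omega
      _ ≤ _ := by
          rw [← Finset.mul_sum, mul_comm 4 B,
            ← Finset.sum_image (f := fun n : ℤ => (1 / 2 : ℝ) ^ n.natAbs) (injective_valMinAbs.injOn)]
          exact mul_le_mul_of_nonneg_left (sum_two_inv_pow_natAbs_le _) hB

/-- On |x| ≤ π one has 1 - cos x ≥ (2/π²)x², and 2|n| ≤ M keeps the angle 2πn/M in that range. -/
theorem norm_dft_pbd_sq_le_gaussian {ι : Type*} [Fintype ι] (p : ι → I) (n : ℤ)
    (hn : 2 * n.natAbs ≤ M) :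
    ‖dft M (pbd p) n‖ ^ 2 ≤ Real.exp (-(16 * distVar (pbd p) * (n.natAbs / M) ^ 2)) := by
  refine (norm_dft_pbd_sq_le M p n).trans (Real.exp_le_exp.2 (neg_le_neg ?_))
  have hM0 : (0 : ℝ) < M := Nat.cast_pos.2 (NeZero.pos M)
  have hV : 0 ≤ distVar (pbd p) := variance_nonneg _ _
  have habs : |2 * Real.pi * n / M| = 2 * Real.pi * (n.natAbs / M) := by
    rw [abs_div, abs_mul, abs_of_pos (by positivity : (0 : ℝ) < 2 * Real.pi), Nat.abs_cast,
      Nat.cast_natAbs, Int.cast_abs]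
    ring
  have h2 : (n.natAbs : ℝ) / M ≤ 1 / 2 := by
    rw [div_le_iff₀ hM0]
    have : (2 * n.natAbs : ℝ) ≤ M := by exact_mod_cast hn
    linarith
  have h1 := Real.cos_le_one_sub_mul_cos_sq (x := 2 * Real.pi * n / M) (by
    rw [habs]
    nlinarith [Real.pi_pos])
  rw [← sq_abs (2 * Real.pi * n / M), habs] at h1
  have e : 2 / Real.pi ^ 2 * (2 * Real.pi * ((n.natAbs : ℝ) / M)) ^ 2 = 8 * (n.natAbs / M) ^ 2 := by
    field_simp
    ring
  rw [e] at h1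
  nlinarith

end Fourier

/-! ### Low-frequency closeness implies closeness in total variation, and conversely. -/

section Soundness

/-- A decimal lower bound for log 2; it lets additive constants be absorbed into multiples of
log(1/ε). -/
theorem log_one_div_ge {ε : ℝ} (h0 : 0 < ε) (h1 : ε ≤ 1 / 2) : 0.69 ≤ Real.log (1 / ε) := by
  have h : Real.log 2 ≤ Real.log (1 / ε) :=
    Real.log_le_log (by norm_num) (by rw [le_div_iff₀ h0]; linarith)
  have := Real.log_two_gt_d9
  linarith

theorem exp_neg_mul_log_one_div {ε : ℝ} (h0 : 0 < ε) (n : ℕ) :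
    Real.exp (-(n * Real.log (1 / ε))) = ε ^ n := by
  rw [one_div, Real.log_inv, mul_neg, neg_neg, Real.exp_nat_mul, Real.exp_log h0]

/-- Concentration window around a point near the mean. -/
theorem pbd_window_compl_le {ι : Type*} [Fintype ι] (p : ι → I) {ε V c : ℝ} (h0 : 0 < ε)
    (h1 : ε ≤ 1 / 2) (hV : 0 ≤ V) (hvar : distVar (pbd p) ≤ 32 * V + 9)
    (hmean : |distMean (pbd p) - c| ≤ 4 * √V + 5) :
    (pbd p).real {j : ℕ | |(j : ℝ) - c| ≤
      70 * (Real.log (1 / ε) + √(V * Real.log (1 / ε)))}ᶜ ≤ ε / 500 := by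
  have hL := log_one_div_ge h0 h1
  have hexp := exp_neg_mul_log_one_div h0 11
  generalize Real.log (1 / ε) = L at hL hexp
  set Y := √(V * L) with hY
  have hY0 : 0 ≤ Y := Real.sqrt_nonneg _
  have hY2 : Y ^ 2 = V * L := Real.sq_sqrt (by nlinarith)
  have hs0 := Real.sqrt_nonneg V
  have hs2 := Real.sq_sqrt hV
  have hsY : √V ≤ 1.25 * Y := by
    apply Real.sqrt_le_iff.2 ⟨by positivity, ?_⟩
    nlinarith
  -- This Chernoff parameter serves every size of V: t(L + Y) = L, while t²V ≤ L because tY ≤ L.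
  set t := L / (L + Y) with ht
  have hX : 0 < L + Y := by linarith
  have ht0 : 0 ≤ t := by positivity
  have ht1 : t ≤ 1 := by rw [ht, div_le_one hX]; linarith
  have htX : t * (L + Y) = L := div_mul_cancel₀ _ hX.ne'
  have htV : t ^ 2 * V ≤ L := by
    have h2 : t ^ 2 * V * L ≤ L * L := by
      calc t ^ 2 * V * L = (t * Y) ^ 2 := by rw [mul_pow, hY2]; ring
        _ ≤ L ^ 2 := pow_le_pow_left₀ (by positivity) (by nlinarith) 2
        _ = L * L := sq L
    exact le_of_mul_le_mul_right h2 (by linarith)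
  -- The offset 4√V + 5 between c and the mean is at most 13(L + Y), which leaves 57 of the 70.
  have hsub : {j : ℕ | |(j : ℝ) - c| ≤ 70 * (L + Y)}ᶜ ⊆
      {j : ℕ | 57 * (L + Y) < |(j : ℝ) - distMean (pbd p)|} := by
    intro j hj
    have hj : ¬ |(j : ℝ) - c| ≤ 70 * (L + Y) := hj
    have := abs_sub_le (j : ℝ) (distMean (pbd p)) c
    show 57 * (L + Y) < _
    nlinarith
  have htvar : t ^ 2 * distVar (pbd p) ≤ 46 * L := by
    have : t ^ 2 ≤ 1 := pow_le_one₀ ht0 ht1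
    nlinarith [mul_le_mul_of_nonneg_left hvar (sq_nonneg t)]
  refine (measureReal_mono hsub).trans ((pbd_tail_le p ht0 ht1 _).trans ?_)
  -- The exponent is at most -57L + 46L = -11L; below, ten of these powers of ε beat the remaining
  -- constants.
  have e1 : Real.exp (-(t * (57 * (L + Y))) + t ^ 2 * distVar (pbd p)) ≤ ε ^ 11 := by
    rw [← hexp]
    apply Real.exp_le_exp.2
    push_cast
    nlinarith
  have e2 : ε ^ 11 ≤ ε * (1 / 2) ^ 10 := by
    rw [pow_succ' ε 10]
    exact mul_le_mul_of_nonneg_left (pow_le_pow_left₀ h0.le h1 10) h0.le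
  norm_num at e2
  linarith

/-- Gaussian decay of the Fourier transform beyond the frequency cutoff. -/
theorem norm_dft_pbd_sq_le_tail {ι : Type*} [Fintype ι] (p : ι → I) {ε V α β : ℝ} (h0 : 0 < ε)
    (h1 : ε ≤ 1 / 2) (hα : 0 < α) (hβ : 128 * α ^ 2 + 100 ≤ β) {M l : ℕ} [NeZero M]
    (hV : Real.log (1 / ε) ≤ V) (hvar : V / 256 ≤ distVar (pbd p))
    (hM : (M : ℝ) ≤ α * (Real.log (1 / ε) + √(V * Real.log (1 / ε))))
    (hl : β * Real.log (1 / ε) ≤ l) (n : ℤ) (hn : l < n.natAbs) (hnM : 2 * n.natAbs ≤ M) :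
    ‖dft M (pbd p) n‖ ^ 2 ≤ ε ^ 2 / 1600 * (1 / 2) ^ n.natAbs := by
  have hL := log_one_div_ge h0 h1
  have hexp := exp_neg_mul_log_one_div h0 14
  generalize Real.log (1 / ε) = L at hL hexp hV hM hl
  refine (norm_dft_pbd_sq_le_gaussian p n hnM).trans ?_
  generalize n.natAbs = N at hn hnM
  have hM0 : (0 : ℝ) < M := Nat.cast_pos.2 (NeZero.pos M)
  have hN : (l : ℝ) ≤ N := by exact_mod_cast hn.le
  have hLs : L ≤ √(V * L) := Real.le_sqrt_of_sq_le (by nlinarith)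
  have hM2 : (M : ℝ) ^ 2 ≤ 4 * α ^ 2 * (V * L) := by
    have : (M : ℝ) ≤ 2 * α * √(V * L) := by nlinarith
    calc (M : ℝ) ^ 2 ≤ (2 * α * √(V * L)) ^ 2 := pow_le_pow_left₀ hM0.le this 2
      _ = _ := by rw [mul_pow, Real.sq_sqrt (by nlinarith)]; ring
  have hN0 : β * L ≤ N := hl.trans hN
  have hNpos : (0 : ℝ) < N := by nlinarith [sq_nonneg α]
  -- Half of the Gaussian exponent pays for the geometric factor in N; the other half, as N ≥ 100L,
  -- pays for ε^14.
  have key : (N : ℝ) + 14 * L ≤ 16 * distVar (pbd p) * (N / M) ^ 2 := by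
    have h2 : (2 : ℝ) * N ≤ V / 16 * (N / M) ^ 2 := by
      rw [div_pow, ← mul_div_assoc, le_div_iff₀ (by positivity)]
      have h3 : 128 * α ^ 2 * L ≤ N := by nlinarith
      calc (2 : ℝ) * N * M ^ 2 ≤ 2 * N * (4 * α ^ 2 * (V * L)) := by gcongr
        _ = V / 16 * N * (128 * α ^ 2 * L) := by ring
        _ ≤ V / 16 * N * N := mul_le_mul_of_nonneg_left h3 (mul_nonneg (by linarith) hNpos.le)
        _ = _ := by ring
    have h3 : V / 16 * ((N : ℝ) / M) ^ 2 ≤ 16 * distVar (pbd p) * (N / M) ^ 2 := by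
      gcongr
      linarith
    nlinarith [sq_nonneg α]
  calc Real.exp (-(16 * distVar (pbd p) * (N / M) ^ 2)) ≤ Real.exp (-(14 * L)) * Real.exp (-(N : ℝ)) := by
        rw [← Real.exp_add]
        exact Real.exp_le_exp.2 (by linarith)
    _ ≤ (ε ^ 2 / 1600) * (1 / 2) ^ N := by
        gcongr
        · push_cast at hexp
          rw [hexp]
          have : ε ^ 12 ≤ (1 / 2) ^ 12 := pow_le_pow_left₀ h0.le h1 12
          norm_num at this
          calc ε ^ 14 = ε ^ 2 * ε ^ 12 := by ring
            _ ≤ ε ^ 2 * (1 / 1600) := by gcongr; linarith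
            _ = _ := by ring
        · rw [show -(N : ℝ) = N * (-1) by ring, Real.exp_nat_mul]
          refine pow_le_pow_left₀ (Real.exp_pos _).le ?_ N
          rw [Real.exp_neg, one_div]
          exact inv_anti₀ (by norm_num) (by linarith [Real.exp_one_gt_d9])

/-- Minkowski's inequality in ℓ², in the squared form in which the inequalities of the system are
stated. -/
theorem sum_norm_sub_sq_le {E : Type*} (s : Finset E) (f g : E → ℂ) {a b : ℝ} (ha : 0 ≤ a)
    (hb : 0 ≤ b) (hf : ∑ x ∈ s, ‖f x‖ ^ 2 ≤ a ^ 2) (hg : ∑ x ∈ s, ‖g x‖ ^ 2 ≤ b ^ 2) :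
    ∑ x ∈ s, ‖f x - g x‖ ^ 2 ≤ (a + b) ^ 2 := by
  have h1 : ∑ x ∈ s, ‖f x‖ * ‖g x‖ ≤ a * b :=
    (Real.sum_mul_le_sqrt_mul_sqrt s _ _).trans
      (mul_le_mul ((Real.sqrt_le_left ha).2 hf) ((Real.sqrt_le_left hb).2 hg) (Real.sqrt_nonneg _) ha)
  calc ∑ x ∈ s, ‖f x - g x‖ ^ 2 ≤ ∑ x ∈ s, (‖f x‖ ^ 2 + 2 * (‖f x‖ * ‖g x‖) + ‖g x‖ ^ 2) := by
        refine Finset.sum_le_sum fun x _ => ?_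
        nlinarith [pow_le_pow_left₀ (norm_nonneg _) (norm_sub_le (f x) (g x)) 2]
    _ ≤ (a + b) ^ 2 := by
        rw [Finset.sum_add_distrib, Finset.sum_add_distrib, ← Finset.mul_sum]
        linarith

/-- The analytic criterion behind soundness. The lower variance bound on the second law is needed
only where V is large enough for frequencies above the cutoff to matter. -/
theorem tvDist_lt_of_fourier {ι κ : Type*} [Fintype ι] [Fintype κ] (p : ι → I) (q : κ → I)
    {ε α β : ℝ} (h0 : 0 < ε) (h1 : ε ≤ 1 / 2) (hβ : 17 * |α| + 128 * α ^ 2 + 100 ≤ β) {M l : ℕ}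
    (hMlo : 150 * (Real.log (1 / ε) + √(distVar (pbd p) * Real.log (1 / ε))) ≤ M)
    (hM : (M : ℝ) ≤ α * (Real.log (1 / ε) + √(distVar (pbd p) * Real.log (1 / ε))))
    (hl : β * Real.log (1 / ε) ≤ l)
    (hvar : distVar (pbd q) ≤ 32 * distVar (pbd p) + 9)
    (hvar' : 1000 * Real.log (1 / ε) ≤ distVar (pbd p) → distVar (pbd p) / 256 ≤ distVar (pbd q))
    (hmean : |distMean (pbd q) - distMean (pbd p)| ≤ 4 * √(distVar (pbd p)) + 5) (h : ℤ → ℂ)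
    (hp : ∑ ξ ∈ Finset.Icc (-(l : ℤ)) l, ‖h ξ - dft M (pbd p) ξ‖ ^ 2 ≤ ε ^ 2 / 16)
    (hq : ∑ ξ ∈ Finset.Icc (-(l : ℤ)) l, ‖h ξ - dft M (pbd q) ξ‖ ^ 2 ≤ (0.35 * ε) ^ 2) :
    tvDist (pbd p) (pbd q) < ε / 2 := by
  have hL := log_one_div_ge h0 h1
  have hV : 0 ≤ distVar (pbd p) := variance_nonneg _ _
  set V := distVar (pbd p) with hVdef
  have hX : 0 < Real.log (1 / ε) + √(V * Real.log (1 / ε)) := by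
    linarith [Real.sqrt_nonneg (V * Real.log (1 / ε))]
  have hM0 : (0 : ℝ) < M := by linarith
  have : NeZero M := ⟨by rintro rfl; simp at hM0⟩
  have hα : 0 < α := by
    by_contra hneg
    nlinarith
  rw [abs_of_pos hα] at hβ
  have htail : ∀ n : ℤ, l < n.natAbs → 2 * n.natAbs ≤ M →
      ‖dft M (pbd p) n - dft M (pbd q) n‖ ^ 2 ≤ ε ^ 2 / 400 * (1 / 2) ^ n.natAbs := by
    intro n hn hnM
    by_cases hc : 1000 * Real.log (1 / ε) ≤ V
    · have t1 := norm_dft_pbd_sq_le_tail p h0 h1 hα (by nlinarith) (V := V) (by linarith)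
        (by rw [← hVdef]; linarith) hM hl n hn hnM
      have t2 := norm_dft_pbd_sq_le_tail q h0 h1 hα (by nlinarith) (V := V) (by linarith)
        (hvar' hc) hM hl n hn hnM
      have := pow_le_pow_left₀ (norm_nonneg _) (norm_sub_le (dft M (pbd p) n) (dft M (pbd q) n)) 2
      nlinarith [sq_nonneg (‖dft M (pbd p) n‖ - ‖dft M (pbd q) n‖)]
    · exfalso
      -- Here V < 1000L, so M ≤ 33αL, whereas 2l ≥ 34αL: no frequency lies between l and M/2.
      have hs : √(V * Real.log (1 / ε)) ≤ 32 * Real.log (1 / ε) :=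
        Real.sqrt_le_iff.2 ⟨by linarith, by nlinarith⟩
      have h2 : (M : ℝ) ≤ α * (33 * Real.log (1 / ε)) :=
        hM.trans (mul_le_mul_of_nonneg_left (by linarith) hα.le)
      have h3 : (2 * l : ℝ) ≤ M := by exact_mod_cast (by omega : 2 * l ≤ M)
      nlinarith [sq_nonneg α]
  have hsum := sum_zmod_le_of_tail (M := M)
    (fun n => ‖dft M (pbd p) n - dft M (pbd q) n‖ ^ 2) (fun _ => by positivity) l
    (B := ε ^ 2 / 400) (by positivity) htail
  have hmid : ∑ ξ ∈ Finset.Icc (-(l : ℤ)) l, ‖dft M (pbd p) ξ - dft M (pbd q) ξ‖ ^ 2 ≤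
      (0.35 * ε + ε / 4) ^ 2 := by
    have := sum_norm_sub_sq_le (Finset.Icc (-(l : ℤ)) l) (fun ξ => h ξ - dft M (pbd q) ξ)
      (fun ξ => h ξ - dft M (pbd p) ξ) (a := 0.35 * ε) (b := ε / 4) (by linarith) (by linarith) hq
      (by rw [div_pow]; linarith)
    simpa using this
  have hw1 := pbd_window_compl_le p h0 h1 hV (c := distMean (pbd p)) (by linarith) (by
    rw [sub_self, abs_zero]; positivity)
  have hw2 := pbd_window_compl_le q h0 h1 hV hvar hmean
  -- Error budget: 0.6² + 4/400 = 0.37 < 0.62², and 0.62/2 + 2/500 < 1/2. The two windows have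
  -- diameter at most 140X < 150X ≤ M, with X the sum in the bound on M.
  have := tvDist_le_of_dft p q _ (injOn_natCast_of_abs_sub_le (M := M) (by linarith)) hw1 hw2
    (D := 0.62 * ε) (by linarith) (by nlinarith)
  linarith

/-- Completeness side: closeness in total variation gives closeness of the Fourier coefficients. -/
theorem sum_norm_sub_dft_sq_le_of_tvDist {ι κ : Type*} [Fintype ι] [Fintype κ] (p : ι → I)
    (q : κ → I) {ε : ℝ} (h0 : 0 < ε) {M l : ℕ} (hl : 120000 ≤ l) (h : ℤ → ℂ)
    (hp : ∑ ξ ∈ Finset.Icc (-(l : ℤ)) l, ‖h ξ - dft M (pbd p) ξ‖ ^ 2 ≤ ε ^ 2 / 16)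
    (htv : tvDist (pbd p) (pbd q) ≤ ε / l) :
    ∑ ξ ∈ Finset.Icc (-(l : ℤ)) l, ‖h ξ - dft M (pbd q) ξ‖ ^ 2 ≤ (0.26 * ε) ^ 2 := by
  have hl' : (120000 : ℝ) ≤ l := by exact_mod_cast hl
  -- There are 2l + 1 terms of size (2ε/l)², about 8ε²/l in total; l ≥ 120000 brings this below
  -- 10⁻⁴ε².
  have h2 : ∑ ξ ∈ Finset.Icc (-(l : ℤ)) l, ‖dft M (pbd q) ξ - dft M (pbd p) ξ‖ ^ 2 ≤
      (0.01 * ε) ^ 2 := by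
    calc _ ≤ ∑ _ξ ∈ Finset.Icc (-(l : ℤ)) l, (2 * (ε / l)) ^ 2 := by
          refine Finset.sum_le_sum fun ξ _ => pow_le_pow_left₀ (norm_nonneg _) ?_ 2
          rw [norm_sub_rev]
          exact (norm_dft_sub_dft_le_tvDist p q M ξ).trans (by linarith)
      _ = (2 * l + 1) * (2 * (ε / l)) ^ 2 := by
          rw [Finset.sum_const, Int.card_Icc, nsmul_eq_mul]
          congr 1
          rw [show ((l : ℤ) + 1 - -l).toNat = 2 * l + 1 by omega]
          push_cast
          ring
      _ ≤ (0.01 * ε) ^ 2 := by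
          rw [mul_pow, div_pow, mul_pow, ← mul_div_assoc, ← mul_div_assoc, div_le_iff₀ (by positivity)]
          nlinarith [mul_nonneg (sq_nonneg ε) (by linarith : (0 : ℝ) ≤ l),
            mul_nonneg (sq_nonneg ε) (by nlinarith : (0 : ℝ) ≤ l * (l - 120000) + (l - 120000))]
  have := sum_norm_sub_sq_le (Finset.Icc (-(l : ℤ)) l) (fun ξ => h ξ - dft M (pbd p) ξ)
    (fun ξ => dft M (pbd q) ξ - dft M (pbd p) ξ) (a := ε / 4) (b := 0.01 * ε) (by linarith)
    (by linarith) (by rw [div_pow]; linarith) h2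
  simp only [sub_sub_sub_cancel_right] at this
  exact this.trans (le_of_eq (by ring))

end Soundness

/-! ### Bookkeeping of degree, denominator and coefficient size of polynomial functions. -/

section Representation

variable {ν : Type*}

/-- Sum of the absolute values of the coefficients. -/
def coeffNorm (P : MvPolynomial ν ℤ) : ℕ := ∑ s ∈ P.support, (P.coeff s).natAbs

theorem coeffNorm_eq_sum (P : MvPolynomial ν ℤ) {t : Finset (ν →₀ ℕ)} (ht : P.support ⊆ t) :
    coeffNorm P = ∑ s ∈ t, (P.coeff s).natAbs :=
  Finset.sum_subset ht fun s _ hs => by simpa using hs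

theorem coeffNorm_add_le (P Q : MvPolynomial ν ℤ) :
    coeffNorm (P + Q) ≤ coeffNorm P + coeffNorm Q := by
  classical
  rw [coeffNorm_eq_sum (P + Q) MvPolynomial.support_add,
    coeffNorm_eq_sum P (Finset.subset_union_left (s₂ := Q.support)),
    coeffNorm_eq_sum Q (Finset.subset_union_right (s₁ := P.support)), ← Finset.sum_add_distrib]
  refine Finset.sum_le_sum fun s _ => ?_
  rw [MvPolynomial.coeff_add]
  exact Int.natAbs_add_le _ _

theorem coeffNorm_monomial_mul (s : ν →₀ ℕ) (c : ℤ) (Q : MvPolynomial ν ℤ) :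
    coeffNorm (MvPolynomial.monomial s c * Q) ≤ c.natAbs * coeffNorm Q := by
  classical
  have hsub : (MvPolynomial.monomial s c * Q).support ⊆ Q.support.image (s + ·) := by
    intro u hu
    rw [MvPolynomial.mem_support_iff, MvPolynomial.coeff_monomial_mul'] at hu
    split_ifs at hu with h
    · refine Finset.mem_image.2 ⟨u - s, ?_, add_tsub_cancel_of_le h⟩
      rw [MvPolynomial.mem_support_iff]
      rintro h0
      rw [h0, mul_zero] at hu
      exact hu rfl
    · exact absurd rfl hu
  rw [coeffNorm_eq_sum _ hsub, Finset.sum_image fun a _ b _ h => add_left_cancel h, coeffNorm,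
    Finset.mul_sum]
  refine Finset.sum_le_sum fun u _ => ?_
  rw [MvPolynomial.coeff_monomial_mul, Int.natAbs_mul]

theorem coeffNorm_mul_le (P Q : MvPolynomial ν ℤ) :
    coeffNorm (P * Q) ≤ coeffNorm P * coeffNorm Q := by
  have hsum : ∀ (t : Finset (ν →₀ ℕ)) (f : (ν →₀ ℕ) → MvPolynomial ν ℤ),
      coeffNorm (∑ s ∈ t, f s) ≤ ∑ s ∈ t, coeffNorm (f s) := fun t f =>
    Finset.le_sum_of_subadditive coeffNorm (by simp [coeffNorm]) coeffNorm_add_le t f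
  conv_lhs => rw [P.as_sum, Finset.sum_mul]
  refine (hsum _ _).trans ?_
  rw [coeffNorm.eq_def P, Finset.sum_mul]
  exact Finset.sum_le_sum fun s _ => coeffNorm_monomial_mul _ _ _

/-- `f` is a polynomial function of degree at most `d`, with coefficients in `D⁻¹ ℤ` whose
absolute values add up to at most `H`. -/
def IsRatPoly (d D : ℕ) (H : ℝ) (f : (ν → ℝ) → ℝ) : Prop :=
  ∃ P : MvPolynomial ν ℤ, P.totalDegree ≤ d ∧ (coeffNorm P : ℝ) ≤ H * D ∧
    ∀ y, MvPolynomial.aeval y P = D * f y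

namespace IsRatPoly

variable {d d' D D' : ℕ} {H H' : ℝ} {f g : (ν → ℝ) → ℝ}

/-- Enlarging the common denominator multiplies the integer polynomial by the cofactor; the bound H
is normalised by the denominator and so survives. -/
theorem mono (h : IsRatPoly d D H f) (hd : d ≤ d') (hD : D ∣ D') (hH : H ≤ H') :
    IsRatPoly d' D' H' f := by
  obtain ⟨c, rfl⟩ := hD
  obtain ⟨P, h1, h2, h3⟩ := h
  refine ⟨MvPolynomial.C (c : ℤ) * P, ?_, ?_, fun y => ?_⟩
  · refine (MvPolynomial.totalDegree_mul _ _).trans ?_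
    rw [MvPolynomial.totalDegree_C, zero_add]
    exact h1.trans hd
  · have h4 : coeffNorm (MvPolynomial.C (c : ℤ) * P) ≤ c * coeffNorm P := by
      simpa using coeffNorm_monomial_mul 0 (c : ℤ) P
    have h5 : (coeffNorm (MvPolynomial.C (c : ℤ) * P) : ℝ) ≤ c * coeffNorm P := by exact_mod_cast h4
    push_cast
    calc _ ≤ (c : ℝ) * coeffNorm P := h5
      _ ≤ c * (H' * D) := by
        refine mul_le_mul_of_nonneg_left (h2.trans ?_) (Nat.cast_nonneg _)
        exact mul_le_mul_of_nonneg_right hH (Nat.cast_nonneg _)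
      _ = _ := by ring
  · rw [map_mul, h3]
    simp
    ring

theorem div_const (n : ℤ) {D : ℕ} (hD : 0 < D) :
    IsRatPoly 0 D |(n : ℝ) / D| (fun _ : ν → ℝ => (n : ℝ) / D) := by
  have hD' : (0 : ℝ) < D := Nat.cast_pos.2 hD
  refine ⟨MvPolynomial.C n, (MvPolynomial.totalDegree_C n).le, ?_, fun y => ?_⟩
  · have : coeffNorm (MvPolynomial.C n : MvPolynomial ν ℤ) ≤ n.natAbs := by
      have := coeffNorm_monomial_mul (0 : ν →₀ ℕ) n 1
      rw [mul_one] at this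
      refine this.trans (le_of_eq ?_)
      rw [coeffNorm_eq_sum (t := {0}) _ (by
        rw [← MvPolynomial.C_1]; exact MvPolynomial.support_monomial_subset)]
      simp
    rw [abs_div, abs_of_pos hD', div_mul_cancel₀ _ hD'.ne']
    have h : ((n.natAbs : ℕ) : ℝ) = |(n : ℝ)| := by rw [Nat.cast_natAbs, Int.cast_abs]
    rw [← h]
    exact_mod_cast this
  · rw [MvPolynomial.aeval_C, mul_div_cancel₀ _ hD'.ne']
    simp

theorem int_const (n : ℤ) : IsRatPoly 0 1 |(n : ℝ)| (fun _ : ν → ℝ => (n : ℝ)) := by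
  simpa using div_const (ν := ν) n one_pos

theorem var (i : ν) : IsRatPoly 1 1 1 (fun y : ν → ℝ => y i) := by
  refine ⟨MvPolynomial.X i, (MvPolynomial.totalDegree_X i).le, ?_, fun y => by simp⟩
  have h := coeffNorm_monomial_mul (Finsupp.single i 1) 1 1
  rw [mul_one] at h
  have h2 : coeffNorm (MvPolynomial.X i : MvPolynomial ν ℤ) ≤ 1 := by
    refine h.trans (le_of_eq ?_)
    rw [coeffNorm_eq_sum (t := {0}) _ (by
        rw [← MvPolynomial.C_1]; exact MvPolynomial.support_monomial_subset)]
    simp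
  simpa using h2

theorem add (hf : IsRatPoly d D H f) (hg : IsRatPoly d D H' g) :
    IsRatPoly d D (H + H') (fun y => f y + g y) := by
  obtain ⟨P, h1, h2, h3⟩ := hf
  obtain ⟨Q, k1, k2, k3⟩ := hg
  refine ⟨P + Q, (MvPolynomial.totalDegree_add _ _).trans (max_le h1 k1), ?_, fun y => ?_⟩
  · have : (coeffNorm (P + Q) : ℝ) ≤ coeffNorm P + coeffNorm Q := by
      exact_mod_cast coeffNorm_add_le P Q
    linarith
  · rw [map_add, h3, k3]
    ring

theorem mul (hf : IsRatPoly d D H f) (hg : IsRatPoly d' D' H' g) :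
    IsRatPoly (d + d') (D * D') (H * H') (fun y => f y * g y) := by
  obtain ⟨P, h1, h2, h3⟩ := hf
  obtain ⟨Q, k1, k2, k3⟩ := hg
  refine ⟨P * Q, (MvPolynomial.totalDegree_mul _ _).trans (add_le_add h1 k1), ?_, fun y => ?_⟩
  · have : (coeffNorm (P * Q) : ℝ) ≤ coeffNorm P * coeffNorm Q := by
      exact_mod_cast coeffNorm_mul_le P Q
    push_cast
    calc _ ≤ (coeffNorm P : ℝ) * coeffNorm Q := this
      _ ≤ (H * D) * (H' * D') := by
        gcongr
        exact (Nat.cast_nonneg _).trans h2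
      _ = _ := by ring
  · rw [map_mul, h3, k3]
    push_cast
    ring

theorem neg (hf : IsRatPoly d D H f) : IsRatPoly d D H (fun y => - f y) := by
  simpa using (int_const (ν := ν) (-1)).mul hf

theorem sub (hf : IsRatPoly d D H f) (hg : IsRatPoly d D H' g) :
    IsRatPoly d D (H + H') (fun y => f y - g y) := by
  simpa [sub_eq_add_neg] using hf.add hg.neg

theorem sum {ι : Type*} (s : Finset ι) {f : ι → (ν → ℝ) → ℝ} {H : ι → ℝ}
    (h : ∀ i ∈ s, IsRatPoly d D (H i) (f i)) :
    IsRatPoly d D (∑ i ∈ s, H i) (fun y => ∑ i ∈ s, f i y) := by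
  classical
  induction s using Finset.induction_on with
  | empty => exact ⟨0, by simp, by simp [coeffNorm], by simp⟩
  | insert a s ha ih =>
    simp only [Finset.sum_insert ha]
    exact (h a (Finset.mem_insert_self a s)).add (ih fun i hi => h i (Finset.mem_insert_of_mem hi))

end IsRatPoly

/-- Complex-valued version of `IsRatPoly`. -/
def IsRatPolyC (d D : ℕ) (H : ℝ) (f : (ν → ℝ) → ℂ) : Prop :=
  ∃ H₁ H₂ : ℝ, H₁ + H₂ ≤ H ∧ IsRatPoly d D H₁ (fun y => (f y).re) ∧
    IsRatPoly d D H₂ (fun y => (f y).im)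

namespace IsRatPolyC

variable {d d' D D' : ℕ} {H H' : ℝ} {f g : (ν → ℝ) → ℂ}

theorem mono (h : IsRatPolyC d D H f) (hd : d ≤ d') (hD : D ∣ D') (hH : H ≤ H') :
    IsRatPolyC d' D' H' f := by
  obtain ⟨a, b, h1, h2, h3⟩ := h
  exact ⟨a, b, h1.trans hH, h2.mono hd hD le_rfl, h3.mono hd hD le_rfl⟩

theorem nonneg_of (hD : 0 < D) {f : (ν → ℝ) → ℝ} (h : IsRatPoly d D H f) : 0 ≤ H := by
  obtain ⟨P, -, h2, -⟩ := h
  have : (0 : ℝ) < D := Nat.cast_pos.2 hD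
  exact nonneg_of_mul_nonneg_left ((Nat.cast_nonneg _).trans h2) this

theorem of_re_im (h1 : IsRatPoly d D H (fun y => (f y).re))
    (h2 : IsRatPoly d D H' (fun y => (f y).im)) : IsRatPolyC d D (H + H') f :=
  ⟨H, H', le_rfl, h1, h2⟩

theorem zero_poly : IsRatPoly 0 D 0 (fun _ : ν → ℝ => 0) :=
  ⟨0, by simp, by simp [coeffNorm], by simp⟩

theorem ofReal {f : (ν → ℝ) → ℝ} (h : IsRatPoly d D H f) : IsRatPolyC d D H (fun y => (f y : ℂ)) :=
  ⟨H, 0, by simp, by simpa using h, by simpa using zero_poly.mono (Nat.zero_le d) dvd_rfl le_rfl⟩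

theorem one : IsRatPolyC 0 1 1 (fun _ : ν → ℝ => (1 : ℂ)) := by
  simpa using ofReal (IsRatPoly.int_const (ν := ν) 1)

theorem add (hf : IsRatPolyC d D H f) (hg : IsRatPolyC d D H' g) :
    IsRatPolyC d D (H + H') (fun y => f y + g y) := by
  obtain ⟨a, b, h1, h2, h3⟩ := hf
  obtain ⟨a', b', k1, k2, k3⟩ := hg
  exact ⟨a + a', b + b', by linarith, by simpa using h2.add k2, by simpa using h3.add k3⟩

theorem sub (hf : IsRatPolyC d D H f) (hg : IsRatPolyC d D H' g) :
    IsRatPolyC d D (H + H') (fun y => f y - g y) := by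
  obtain ⟨a, b, h1, h2, h3⟩ := hf
  obtain ⟨a', b', k1, k2, k3⟩ := hg
  exact ⟨a + a', b + b', by linarith, by simpa using h2.sub k2, by simpa using h3.sub k3⟩

/-- Adding the sizes of real and imaginary part makes the size submultiplicative: (aa' + bb') + (ab'
+ ba') = (a + b)(a' + b'). -/
theorem mul (hD : 0 < D) (hD' : 0 < D') (hf : IsRatPolyC d D H f) (hg : IsRatPolyC d' D' H' g) :
    IsRatPolyC (d + d') (D * D') (H * H') (fun y => f y * g y) := by
  obtain ⟨a, b, h1, h2, h3⟩ := hf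
  obtain ⟨a', b', k1, k2, k3⟩ := hg
  have := nonneg_of hD h2
  have := nonneg_of hD h3
  have := nonneg_of hD' k2
  have := nonneg_of hD' k3
  refine ⟨a * a' + b * b', a * b' + b * a', ?_, ?_, ?_⟩
  · calc _ = (a + b) * (a' + b') := by ring
      _ ≤ H * H' := mul_le_mul h1 k1 (by linarith) (by linarith)
  · simpa using (h2.mul k2).sub (h3.mul k3)
  · simpa using (h2.mul k3).add (h3.mul k2)

theorem sum {ι : Type*} (s : Finset ι) {f : ι → (ν → ℝ) → ℂ} {H : ι → ℝ}
    (h : ∀ i ∈ s, IsRatPolyC d D (H i) (f i)) :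
    IsRatPolyC d D (∑ i ∈ s, H i) (fun y => ∑ i ∈ s, f i y) := by
  classical
  induction s using Finset.induction_on with
  | empty => exact ⟨0, 0, by simp, by simpa using zero_poly.mono (Nat.zero_le d) dvd_rfl le_rfl,
      by simpa using zero_poly.mono (Nat.zero_le d) dvd_rfl le_rfl⟩
  | insert a s ha ih =>
    simp only [Finset.sum_insert ha]
    exact (h a (Finset.mem_insert_self a s)).add (ih fun i hi => h i (Finset.mem_insert_of_mem hi))

theorem pow (hD : 0 < D) (hf : IsRatPolyC d D H f) (n : ℕ) :
    IsRatPolyC (n * d) (D ^ n) (H ^ n) (fun y => f y ^ n) := by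
  induction n with
  | zero => simpa using one
  | succ n ih =>
    simp only [pow_succ, Nat.succ_mul]
    exact ih.mul (by positivity) hD hf

theorem prod_pow {ι : Type*} (s : Finset ι) (hD : 0 < D) {f : ι → (ν → ℝ) → ℂ} (m : ι → ℕ)
    (h : ∀ i ∈ s, IsRatPolyC d D H (f i)) :
    IsRatPolyC ((∑ i ∈ s, m i) * d) (D ^ ∑ i ∈ s, m i) (H ^ ∑ i ∈ s, m i)
      (fun y => ∏ i ∈ s, f i y ^ m i) := by
  classical
  induction s using Finset.induction_on with
  | empty => simpa using one
  | insert a s ha ih =>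
    simp only [Finset.sum_insert ha, Finset.prod_insert ha, pow_add, add_mul]
    exact ((h a (Finset.mem_insert_self a s)).pow hD (m a)).mul (by positivity) (by positivity)
      (ih fun i hi => h i (Finset.mem_insert_of_mem hi))

theorem norm_sq (hD : 0 < D) (hf : IsRatPolyC d D H f) :
    IsRatPoly (d + d) (D * D) (H * H) (fun y => ‖f y‖ ^ 2) := by
  obtain ⟨a, b, h1, h2, h3⟩ := hf
  have := nonneg_of hD h2
  have := nonneg_of hD h3
  have h := ((h2.mul h2).add (h3.mul h3)).mono le_rfl dvd_rfl
    (show a * a + b * b ≤ H * H by nlinarith)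
  convert h using 2 with y
  rw [← Complex.normSq_eq_norm_sq, Complex.normSq_apply]

end IsRatPolyC

/-- A family of inequalities between rational polynomial functions is a `PolySystem`. -/
theorem exists_polySystem {k aux : ℕ} {γ : Type*} [Fintype γ]
    (F : γ → (Fin k ⊕ Fin aux → ℝ) → ℝ) (d b : ℕ)
    (hF : ∀ i, ∃ (D : ℕ) (H : ℝ), 0 < D ∧ H * D < 2 ^ b ∧ IsRatPoly d D H (F i)) :
    ∃ S : PolySystem k, S.aux = aux ∧ S.num = Fintype.card γ ∧
      (∀ i, (S.poly i).totalDegree ≤ d) ∧ (∀ i s, ratBits ((S.poly i).coeff s) ≤ b + 2) ∧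
      ∀ x, S.IsSolution x ↔ ∃ y : Fin aux → ℝ, ∀ i, 0 ≤ F i (Sum.elim x y) := by
  choose D H hD hb P hP1 hP2 hP3 using hF
  let e := Fintype.equivFin γ
  -- Multiplying by the positive denominators keeps the signs and makes all coefficients integers,
  -- so beyond the b bits of the numerator only a sign bit and the denominator 1 are counted.
  refine ⟨⟨aux, Fintype.card γ, fun i => MvPolynomial.map (Int.castRingHom ℚ) (P (e.symm i))⟩,
    rfl, rfl, fun i => ?_, fun i s => ?_, fun x => ?_⟩
  · exact (Finset.sup_mono (MvPolynomial.support_map_subset _ _)).trans (hP1 _)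
  · simp only [MvPolynomial.coeff_map, eq_intCast, ratBits, Rat.num_intCast, Rat.den_intCast]
    have h1 : (MvPolynomial.coeff s (P (e.symm i))).natAbs ≤ coeffNorm (P (e.symm i)) := by
      by_cases hs : s ∈ (P (e.symm i)).support
      · exact Finset.single_le_sum (f := fun s => (MvPolynomial.coeff s (P (e.symm i))).natAbs)
          (fun _ _ => Nat.zero_le _) hs
      · rw [MvPolynomial.notMem_support_iff.1 hs]
        simp
    have h2 : (MvPolynomial.coeff s (P (e.symm i))).natAbs < 2 ^ b := by
      have h3 : (((MvPolynomial.coeff s (P (e.symm i))).natAbs : ℕ) : ℝ) < 2 ^ b :=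
        lt_of_le_of_lt (Nat.cast_le.2 h1) (lt_of_le_of_lt (hP2 _) (hb _))
      exact_mod_cast h3
    have h4 := Nat.size_le.2 h2
    simp only [Nat.size_one]
    omega
  · refine exists_congr fun y => ?_
    have key : ∀ g : γ, (0 ≤ MvPolynomial.aeval (Sum.elim x y)
        (MvPolynomial.map (Int.castRingHom ℚ) (P g))) ↔ 0 ≤ F g (Sum.elim x y) := by
      intro g
      have h1 : MvPolynomial.aeval (Sum.elim x y) (MvPolynomial.map (Int.castRingHom ℚ) (P g)) =
          MvPolynomial.aeval (Sum.elim x y) (P g) := by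
        rw [MvPolynomial.aeval_def, MvPolynomial.eval₂_map, MvPolynomial.aeval_def]
        congr 1
      rw [h1, hP3]
      have : (0 : ℝ) < D g := Nat.cast_pos.2 (hD g)
      exact ⟨fun h => nonneg_of_mul_nonneg_right h this, fun h => mul_nonneg this.le h⟩
    simp only [key]
    exact ⟨fun h g => by simpa using h (e g), fun h i => h _⟩

end Representation

/-! ### Truncated logarithms and exponentials approximate the Fourier transform. -/

section Approximation

/-- Second-order Taylor estimate for |θ| ≤ 1; beyond that, both pieces are at most |θ| ≤ θ². -/
theorem norm_exp_sub_one_add_le (θ : ℝ) :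
    ‖Complex.exp (θ * Complex.I) - 1 - θ * Complex.I‖ ≤ 2 * θ ^ 2 := by
  have hn : ‖(θ : ℂ) * Complex.I‖ = |θ| := by simp
  by_cases h : |θ| ≤ 1
  · have := Complex.norm_exp_sub_one_sub_id_le (x := θ * Complex.I) (by rwa [hn])
    rw [hn, sq_abs] at this
    nlinarith [sq_nonneg θ]
  · have h1 : ‖Complex.exp (θ * Complex.I) - 1‖ ≤ |θ| := by
      have := Real.norm_exp_I_mul_ofReal_sub_one_le (x := θ)
      rwa [mul_comm Complex.I] at this
    have h2 := norm_sub_le (Complex.exp (θ * Complex.I) - 1) (θ * Complex.I)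
    rw [hn] at h2
    nlinarith [sq_abs θ]

theorem norm_exp_mul_I_sub_one_le (θ : ℝ) : ‖Complex.exp (θ * Complex.I) - 1‖ ≤ |θ| := by
  have := Real.norm_exp_I_mul_ofReal_sub_one_le (x := θ)
  rwa [mul_comm Complex.I] at this

/-- Mean value inequality on a convex disc, where the derivative 1/(1 + u) is at most 3/2. -/
theorem norm_log_sub_log_le {a b : ℂ} (ha : ‖a‖ ≤ 1 / 3) (hb : ‖b‖ ≤ 1 / 3) :
    ‖Complex.log (1 + a) - Complex.log (1 + b)‖ ≤ 2 * ‖a - b‖ := by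
  have hs : Convex ℝ (Metric.closedBall (0 : ℂ) (1 / 3)) := convex_closedBall _ _
  refine hs.norm_image_sub_le_of_norm_hasDerivWithin_le (f := fun u => Complex.log (1 + u))
    (f' := fun u => (1 + u)⁻¹) (fun u hu => ?_) (fun u hu => ?_) (by simpa using hb) (by simpa using ha)
  · have hu : ‖u‖ ≤ 1 / 3 := by simpa using hu
    have := ((hasDerivAt_id u).const_add 1).clog
      (Complex.mem_slitPlane_of_norm_lt_one (by simpa using by linarith : ‖u‖ < 1))
    simpa using this.hasDerivWithinAt
  · have hu : ‖u‖ ≤ 1 / 3 := by simpa using hu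
    have h1 : 1 - ‖u‖ ≤ ‖1 + u‖ := by
      have := norm_sub_norm_le (1 : ℂ) (-u)
      rwa [norm_one, norm_neg, sub_neg_eq_add] at this
    rw [norm_inv]
    refine inv_le_of_inv_le₀ (by norm_num) ?_
    norm_num
    linarith

theorem norm_logTaylor_sub_log_le (D : ℕ) {u : ℂ} (hu : ‖u‖ ≤ 1 / 3) :
    ‖Complex.logTaylor (D + 1) u - Complex.log (1 + u)‖ ≤ (1 / 2) ^ D := by
  rw [norm_sub_rev]
  refine (Complex.norm_log_sub_logTaylor_le D (by linarith : ‖u‖ < 1)).trans ?_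
  have h1 : ‖u‖ ^ (D + 1) ≤ (1 / 3) ^ (D + 1) := pow_le_pow_left₀ (norm_nonneg _) hu _
  have h2 : (1 - ‖u‖)⁻¹ ≤ 3 / 2 := by
    refine inv_le_of_inv_le₀ (by norm_num) ?_
    norm_num
    linarith
  have h3 : (0 : ℝ) ≤ (1 - ‖u‖)⁻¹ := inv_nonneg.2 (by linarith)
  calc ‖u‖ ^ (D + 1) * (1 - ‖u‖)⁻¹ / (D + 1) ≤ ‖u‖ ^ (D + 1) * (1 - ‖u‖)⁻¹ :=
        div_le_self (by positivity) (by linarith [(Nat.cast_nonneg D : (0 : ℝ) ≤ D)])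
    _ ≤ (1 / 3) ^ (D + 1) * (3 / 2) := by gcongr
    _ = (1 / 3) ^ D * (1 / 2) := by ring
    _ ≤ (1 / 2) ^ D * 1 := by gcongr <;> norm_num
    _ = _ := mul_one _

/-- The error is linear in r, not only quadratic in rθ. Summed with multiplicities it is therefore
θ² times ∑ m_j r_j, which is comparable to the variance. -/
theorem norm_log_one_add_sub_linear_le {r θ : ℝ} (h0 : 0 ≤ r) (h1 : r ≤ 1) (hr : r * |θ| ≤ 1 / 3) :
    ‖Complex.log (1 + r * (Complex.exp (θ * Complex.I) - 1)) - r * θ * Complex.I‖ ≤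
      3 * θ ^ 2 * r := by
  set z := Complex.exp (θ * Complex.I) - 1 with hz
  have hzn : ‖z‖ ≤ |θ| := norm_exp_mul_I_sub_one_le θ
  have hrz : ‖(r : ℂ) * z‖ = r * ‖z‖ := by rw [norm_mul, Complex.norm_real, Real.norm_of_nonneg h0]
  have hu : ‖(r : ℂ) * z‖ ≤ 1 / 3 := by
    rw [hrz]
    exact (mul_le_mul_of_nonneg_left hzn h0).trans hr
  have e1 : ‖Complex.log (1 + r * z) - r * z‖ ≤ θ ^ 2 * r := by
    refine (Complex.norm_log_one_add_sub_self_le (by linarith : ‖(r : ℂ) * z‖ < 1)).trans ?_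
    have h2 : (1 - ‖(r : ℂ) * z‖)⁻¹ ≤ 3 / 2 := by
      refine inv_le_of_inv_le₀ (by norm_num) ?_
      rw [show ((3 : ℝ) / 2)⁻¹ = 2 / 3 by norm_num]
      linarith
    have h3 : ‖(r : ℂ) * z‖ ^ 2 ≤ r * θ ^ 2 := by
      rw [hrz, mul_pow, ← sq_abs θ]
      have : ‖z‖ ^ 2 ≤ |θ| ^ 2 := pow_le_pow_left₀ (norm_nonneg _) hzn 2
      have : r ^ 2 ≤ r := by nlinarith
      gcongr
    nlinarith [mul_le_mul_of_nonneg_left h2 (sq_nonneg ‖(r : ℂ) * z‖)]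
  have e2 : ‖(r : ℂ) * z - r * θ * Complex.I‖ ≤ 2 * θ ^ 2 * r := by
    rw [show (r : ℂ) * z - r * θ * Complex.I = r * (z - θ * Complex.I) by ring, norm_mul,
      Complex.norm_real, Real.norm_of_nonneg h0, mul_comm]
    exact mul_le_mul_of_nonneg_right (norm_exp_sub_one_add_le θ) h0
  have := norm_add_le (Complex.log (1 + r * z) - r * z) (r * z - r * θ * Complex.I)
  rw [sub_add_sub_cancel] at this
  linarith

/-- From (6Γ)^D / D! ≤ D^D / D! ≤ e^D ≤ 3^D one gets Γ^D / D! ≤ 2^{-D}. -/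
theorem norm_exp_sub_taylor_le {g : ℂ} {Γ : ℝ} {D : ℕ} (hg : ‖g‖ ≤ Γ) (hD : 6 * Γ ≤ D) :
    ‖(∑ i ∈ Finset.range D, g ^ i / i.factorial) - Complex.exp g‖ ≤ 2 * (1 / 2) ^ D := by
  rw [norm_sub_rev]
  have hΓ : 0 ≤ Γ := (norm_nonneg _).trans hg
  refine (Complex.exp_bound' (x := g) (n := D) ?_).trans ?_
  · rw [div_le_iff₀ (by positivity)]
    push_cast
    linarith
  · have hf : (0 : ℝ) < D.factorial := by positivity
    have h1 : (6 * Γ) ^ D / D.factorial ≤ Real.exp D :=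
      (div_le_div_of_nonneg_right (pow_le_pow_left₀ (by positivity) hD D) hf.le).trans
        (Real.pow_div_factorial_le_exp _ (Nat.cast_nonneg D) D)
    have h2 : Real.exp D ≤ 3 ^ D := by
      rw [← mul_one (D : ℝ), Real.exp_nat_mul]
      exact pow_le_pow_left₀ (Real.exp_pos _).le (by linarith [Real.exp_one_lt_d9]) D
    have h3 : Γ ^ D / D.factorial ≤ (1 / 2) ^ D := by
      rw [mul_pow, mul_div_assoc] at h1
      have h4 : (6 : ℝ) ^ D = 3 ^ D * 2 ^ D := by rw [← mul_pow]; norm_num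
      rw [one_div, inv_pow, ← one_div, le_div_iff₀ (by positivity)]
      rw [h4] at h1
      have h5 : (0 : ℝ) < 3 ^ D := by positivity
      have h6 := h1.trans h2
      refine le_of_mul_le_mul_left (le_trans (le_of_eq ?_) (h6.trans (mul_one _).ge)) h5
      ring
    have h4 : ‖g‖ ^ D / D.factorial ≤ Γ ^ D / D.factorial := by gcongr
    linarith

theorem norm_prod_pow_sub_prod_pow_le {ι : Type*} (s : Finset ι) (m : ι → ℕ) (a b : ι → ℂ) {η : ℝ}
    (h0 : 0 ≤ η) (hb : ∀ i ∈ s, ‖b i‖ ≤ 1) (hab : ∀ i ∈ s, ‖a i - b i‖ ≤ η)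
    (hη : (∑ i ∈ s, m i : ℕ) * η ≤ 1) :
    ‖∏ i ∈ s, a i ^ m i - ∏ i ∈ s, b i ^ m i‖ ≤ 2 * ((∑ i ∈ s, m i : ℕ) * η) := by
  classical
  -- Recording an error as x - 1 makes the bounds multiply, so that the whole product is off by at
  -- most (1 + η)^n - 1 with n the total multiplicity.
  have hmul : ∀ (a a' b b' : ℂ) (x y : ℝ), ‖b‖ ≤ 1 → ‖b'‖ ≤ 1 → ‖a - b‖ ≤ x - 1 →
      ‖a' - b'‖ ≤ y - 1 → ‖a * a' - b * b'‖ ≤ x * y - 1 := by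
    intro a a' b b' x y h1 h2 h3 h4
    have e : a * a' - b * b' = (a - b) * (a' - b') + (a - b) * b' + b * (a' - b') := by ring
    rw [e]
    refine (norm_add₃_le).trans ?_
    rw [norm_mul, norm_mul, norm_mul]
    have := mul_le_mul h3 h4 (norm_nonneg _) ((norm_nonneg _).trans h3)
    have := mul_le_mul h3 h2 (norm_nonneg _) ((norm_nonneg _).trans h3)
    have := mul_le_mul h1 h4 (norm_nonneg _) zero_le_one
    nlinarith
  have hpow : ∀ i ∈ s, ∀ n : ℕ, ‖a i ^ n - b i ^ n‖ ≤ (1 + η) ^ n - 1 := by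
    intro i hi n
    induction n with
    | zero => simp
    | succ n ih =>
      rw [pow_succ, pow_succ, pow_succ]
      refine hmul _ _ _ _ _ _ ?_ (hb i hi) ih (by linarith [hab i hi])
      rw [norm_pow]
      exact pow_le_one₀ (norm_nonneg _) (hb i hi)
  have hprod : ‖∏ i ∈ s, a i ^ m i - ∏ i ∈ s, b i ^ m i‖ ≤ (1 + η) ^ (∑ i ∈ s, m i) - 1 := by
    clear hη
    induction s using Finset.induction_on with
    | empty => simp
    | insert j s hj ih =>
      rw [Finset.prod_insert hj, Finset.prod_insert hj, Finset.sum_insert hj, pow_add]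
      refine hmul _ _ _ _ _ _ ?_ ?_ (hpow j (Finset.mem_insert_self _ _) _)
        (ih (fun i hi => hb i (Finset.mem_insert_of_mem hi))
          (fun i hi => hab i (Finset.mem_insert_of_mem hi))
          fun i hi => hpow i (Finset.mem_insert_of_mem hi))
      · rw [norm_pow]
        exact pow_le_one₀ (norm_nonneg _) (hb j (Finset.mem_insert_self _ _))
      · rw [norm_prod]
        refine Finset.prod_le_one (fun _ _ => norm_nonneg _) fun i hi => ?_
        rw [norm_pow]
        exact pow_le_one₀ (norm_nonneg _) (hb i (Finset.mem_insert_of_mem hi))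
  refine hprod.trans ?_
  generalize (∑ i ∈ s, m i) = n at hη
  have h1 : (1 + η) ^ n ≤ Real.exp (n * η) := by
    rw [Real.exp_nat_mul]
    exact pow_le_pow_left₀ (by linarith) (by linarith [Real.add_one_le_exp η]) n
  have h2 := Real.abs_exp_sub_one_le (x := n * η) (by rwa [abs_of_nonneg (by positivity)])
  rw [abs_of_nonneg (by positivity : 0 ≤ (n : ℝ) * η)] at h2
  linarith [(abs_le.1 h2).2]

theorem norm_exp_sub_exp_le {a b : ℂ} (hb : ‖Complex.exp b‖ ≤ 1) (hab : ‖a - b‖ ≤ 1) :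
    ‖Complex.exp a - Complex.exp b‖ ≤ 2 * ‖a - b‖ := by
  have e : Complex.exp a - Complex.exp b = Complex.exp b * (Complex.exp (a - b) - 1) := by
    rw [mul_sub, ← Complex.exp_add]
    ring_nf
  rw [e, norm_mul]
  have := Complex.norm_exp_sub_one_le hab
  nlinarith [norm_nonneg (Complex.exp (a - b) - 1)]

variable {ι : Type*} [Fintype ι]

/-- Orientation of a parameter: `1` if it is measured from `0`, `-1` if it is measured from `1`. -/
def orient (u : Bool) : ℝ := if u then -1 else 1

/-- Parameter measured from the end given by `u`. -/
def measureFrom (u : Bool) (x : ℝ) : ℝ := if u then 1 - x else x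

/-- For u true this is the reflection X = 1 - X' of a Bernoulli variable: the parameter becomes 1 -
x, the angle changes sign, and a rotation comes out. -/
theorem one_add_mul_measureFrom (u : Bool) (x θ : ℝ) :
    1 + (x : ℂ) * (Complex.exp ((-θ : ℝ) * Complex.I) - 1) =
      (if u then Complex.exp ((-θ : ℝ) * Complex.I) else 1) *
        (1 + (measureFrom u x : ℂ) * (Complex.exp ((-orient u * θ : ℝ) * Complex.I) - 1)) := by
  unfold measureFrom orient
  split_ifs
  · have : Complex.exp ((-θ : ℝ) * Complex.I) * Complex.exp ((-(-1) * θ : ℝ) * Complex.I) = 1 := by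
      rw [← Complex.exp_add]
      push_cast
      simp
    push_cast at this ⊢
    linear_combination (-(1 - (x : ℂ))) * this
  · simp

/-- The approximation of the (rotated) Fourier coefficient `∏ (1 + r z) ^ m` by the exponential
Taylor polynomial of a truncated logarithm of the factors in `small`, times the factors in `big`. -/
theorem norm_approx_sub_le (m : ι → ℕ) (u : ι → Bool) (r : ι → ℝ)
    (small big : Finset ι) (hdisj : Disjoint small big)
    (hr0 : ∀ j, 0 ≤ r j) (hr1 : ∀ j, r j ≤ 1) (hout : ∀ j, j ∉ small → j ∉ big → r j = 0)
    {θ η a τ Δ S Γ : ℝ} {D : ℕ} (hη : η = (1 / 2) ^ D) (w : Bool → ℂ)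
    (hsmall : ∀ j ∈ small, r j * (|θ| + η) ≤ 1 / 3)
    (hw : ∀ j, ‖w (u j) - (Complex.exp ((-orient (u j) * θ : ℝ) * Complex.I) - 1)‖ ≤ η)
    (ha : |a - θ * τ| ≤ η)
    (hτ : |τ - ∑ j, orient (u j) * (m j * r j)| ≤ Δ) (hS : ∑ j, m j * r j ≤ S)
    (hη1 : (3 * (∑ j ∈ small, m j : ℕ) + (∑ j ∈ big, m j : ℕ) + 1) * η ≤ 1 / 2)
    (hΓ : 1 + 3 * θ ^ 2 * S + |θ| * Δ + |θ| * (∑ j ∈ big, m j : ℕ) ≤ Γ) (hD : 6 * Γ ≤ D)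
    {g : ℂ} (hg : g = ∑ j ∈ small, m j * Complex.logTaylor (D + 1) (r j * w (u j)) + a * Complex.I) :
    ‖(∑ i ∈ Finset.range D, g ^ i / i.factorial) * ∏ j ∈ big, (1 + r j * w (u j)) ^ m j -
      Complex.exp ((θ * τ : ℝ) * Complex.I) *
        ∏ j, (1 + r j * (Complex.exp ((-orient (u j) * θ : ℝ) * Complex.I) - 1)) ^ m j‖ ≤
      (24 * (∑ j ∈ small, m j : ℕ) + 2 * (∑ j ∈ big, m j : ℕ) + 12) * η := by
  set z : ι → ℂ := fun j => Complex.exp ((-orient (u j) * θ : ℝ) * Complex.I) - 1 with hz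
  set Ms : ℕ := ∑ j ∈ small, m j with hMs
  set Mb : ℕ := ∑ j ∈ big, m j with hMb
  have hη0 : 0 ≤ η := by rw [hη]; positivity
  have horient : ∀ j, |orient (u j)| = 1 := fun j => by unfold orient; split_ifs <;> simp
  have hnz : ∀ j, ‖z j‖ ≤ |θ| := fun j => by
    refine (norm_exp_mul_I_sub_one_le _).trans ?_
    rw [abs_mul, abs_neg, horient, one_mul]
  have hrn : ∀ j (x : ℂ), ‖(r j : ℂ) * x‖ = r j * ‖x‖ := fun j x => by
    rw [norm_mul, Complex.norm_real, Real.norm_of_nonneg (hr0 j)]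
  have hwz : ∀ j, ‖(r j : ℂ) * w (u j) - r j * z j‖ ≤ η := fun j => by
    rw [← mul_sub, hrn]
    exact (mul_le_of_le_one_left (norm_nonneg _) (hr1 j)).trans (hw j)
  have hwn : ∀ j, ‖w (u j)‖ ≤ |θ| + η := fun j => by
    have := norm_add_le (z j) (w (u j) - z j)
    rw [add_sub_cancel] at this
    linarith [hnz j, hw j]
  have hsz : ∀ j ∈ small, ‖(r j : ℂ) * z j‖ ≤ 1 / 3 := fun j hj => by
    rw [hrn]
    exact (mul_le_mul_of_nonneg_left ((hnz j).trans (by linarith)) (hr0 j)).trans (hsmall j hj)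
  have hsw : ∀ j ∈ small, ‖(r j : ℂ) * w (u j)‖ ≤ 1 / 3 := fun j hj => by
    rw [hrn]
    exact (mul_le_mul_of_nonneg_left (hwn j) (hr0 j)).trans (hsmall j hj)
  have hf1 : ∀ j, ‖1 + (r j : ℂ) * z j‖ ≤ 1 := fun j =>
    norm_one_add_mul_exp_sub_one_le (hr0 j) (hr1 j) _
  -- the exact logarithm
  set G : ℂ := ∑ j ∈ small, m j * Complex.log (1 + r j * z j) with hG
  have hexpG : Complex.exp G = ∏ j ∈ small, (1 + r j * z j) ^ m j := by
    rw [hG, Complex.exp_sum]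
    refine Finset.prod_congr rfl fun j hj => ?_
    rw [Complex.exp_nat_mul, Complex.exp_log]
    exact Complex.slitPlane_ne_zero (Complex.mem_slitPlane_of_norm_lt_one
      (lt_of_le_of_lt (hsz j hj) (by norm_num)))
  -- Per unit of multiplicity: η for truncating the logarithm and 2η for rounding the angle; one
  -- more η comes from rounding the rotation.
  have hgG : ‖g - (G + (θ * τ : ℝ) * Complex.I)‖ ≤ 3 * Ms * η + η := by
    have e : g - (G + (θ * τ : ℝ) * Complex.I) =
        ∑ j ∈ small, (m j : ℂ) * ((Complex.logTaylor (D + 1) (r j * w (u j)) -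
          Complex.log (1 + r j * w (u j))) + (Complex.log (1 + r j * w (u j)) -
          Complex.log (1 + r j * z j))) + ((a - θ * τ : ℝ) : ℂ) * Complex.I := by
      simp only [sub_add_sub_cancel, mul_sub, Finset.sum_sub_distrib]
      rw [hg, hG]
      push_cast
      ring
    rw [e]
    refine (norm_add_le _ _).trans (add_le_add ?_ ?_)
    · refine (norm_sum_le _ _).trans ?_
      rw [hMs, Nat.cast_sum, Finset.mul_sum, Finset.sum_mul]
      refine Finset.sum_le_sum fun j hj => ?_
      rw [norm_mul, Complex.norm_natCast]
      have h1 := norm_logTaylor_sub_log_le D (hsw j hj)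
      have h2 := norm_log_sub_log_le (hsw j hj) (hsz j hj)
      have h3 := hwz j
      rw [← hη] at h1
      have h4 := norm_add_le (Complex.logTaylor (D + 1) (r j * w (u j)) -
          Complex.log (1 + r j * w (u j))) (Complex.log (1 + r j * w (u j)) -
          Complex.log (1 + r j * z j))
      have h5 := mul_le_mul_of_nonneg_left (h4.trans (by linarith :
        _ ≤ 3 * η)) (Nat.cast_nonneg (m j) : (0 : ℝ) ≤ m j)
      linarith
    · rw [norm_mul, Complex.norm_I, mul_one, Complex.norm_real]
      exact ha
  -- The rotation cancels the linear parts of the logarithms. What remains are the second-order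
  -- terms, the mismatch Δ of τ, and the linear parts of the factors in `big`, which have no
  -- logarithm to cancel them.
  have hlin : ‖G + (θ * τ : ℝ) * Complex.I‖ ≤ 3 * θ ^ 2 * S + |θ| * Δ + |θ| * Mb := by
    have hsplit : ∑ j, orient (u j) * (m j * r j) =
        ∑ j ∈ small, orient (u j) * (m j * r j) + ∑ j ∈ big, orient (u j) * (m j * r j) := by
      classical
      rw [← Finset.sum_union hdisj]
      symm
      refine Finset.sum_subset (Finset.subset_univ _) fun j _ hj => ?_
      rw [Finset.mem_union, not_or] at hj
      rw [hout j hj.1 hj.2]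
      ring
    have e : G + (θ * τ : ℝ) * Complex.I =
        ∑ j ∈ small, (m j : ℂ) * (Complex.log (1 + r j * z j) -
          r j * (-orient (u j) * θ : ℝ) * Complex.I) +
        ((θ * (τ - ∑ j, orient (u j) * (m j * r j)) +
          θ * ∑ j ∈ big, orient (u j) * (m j * r j) : ℝ) : ℂ) * Complex.I := by
      have e1 : ((∑ j ∈ small, orient (u j) * (m j * r j) : ℝ) : ℂ) * (θ * Complex.I) =
          ∑ j ∈ small, -((m j : ℂ) * (r j * (-orient (u j) * θ : ℝ) * Complex.I)) := by
        push_cast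
        rw [Finset.sum_mul]
        exact Finset.sum_congr rfl fun j _ => by ring
      rw [hsplit]
      simp only [mul_sub, Finset.sum_sub_distrib]
      rw [Finset.sum_neg_distrib] at e1
      push_cast at e1 ⊢
      linear_combination e1
    rw [e]
    refine (norm_add_le _ _).trans ?_
    have p1 : ‖∑ j ∈ small, (m j : ℂ) * (Complex.log (1 + r j * z j) -
          r j * (-orient (u j) * θ : ℝ) * Complex.I)‖ ≤ 3 * θ ^ 2 * S := by
      refine (norm_sum_le _ _).trans ?_
      have : ∑ j ∈ small, (3 * θ ^ 2) * (m j * r j) ≤ 3 * θ ^ 2 * S := by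
        rw [← Finset.mul_sum]
        refine mul_le_mul_of_nonneg_left (le_trans ?_ hS) (by positivity)
        exact Finset.sum_le_sum_of_subset_of_nonneg (Finset.subset_univ _)
          fun j _ _ => mul_nonneg (Nat.cast_nonneg _) (hr0 j)
      refine le_trans (Finset.sum_le_sum fun j hj => ?_) this
      rw [norm_mul, Complex.norm_natCast]
      have habs : |-orient (u j) * θ| = |θ| := by rw [abs_mul, abs_neg, horient, one_mul]
      have h1 := norm_log_one_add_sub_linear_le (r := r j) (θ := -orient (u j) * θ) (hr0 j) (hr1 j) (by
        rw [habs]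
        nlinarith [hsmall j hj, hr0 j])
      rw [← sq_abs (-orient (u j) * θ), habs, sq_abs] at h1
      have h5 := mul_le_mul_of_nonneg_left h1 (Nat.cast_nonneg (m j) : (0 : ℝ) ≤ m j)
      refine h5.trans (le_of_eq (by ring))
    have p2 : ‖((θ * (τ - ∑ j, orient (u j) * (m j * r j)) +
          θ * ∑ j ∈ big, orient (u j) * (m j * r j) : ℝ) : ℂ) * Complex.I‖ ≤
          |θ| * Δ + |θ| * Mb := by
      rw [norm_mul, Complex.norm_I, mul_one, Complex.norm_real, Real.norm_eq_abs]
      refine (abs_add_le _ _).trans ?_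
      rw [abs_mul, abs_mul]
      refine add_le_add (mul_le_mul_of_nonneg_left hτ (abs_nonneg _))
        (mul_le_mul_of_nonneg_left ?_ (abs_nonneg _))
      refine (Finset.abs_sum_le_sum_abs _ _).trans ?_
      rw [hMb, Nat.cast_sum]
      refine Finset.sum_le_sum fun j _ => ?_
      rw [abs_mul, horient, one_mul, abs_of_nonneg (mul_nonneg (Nat.cast_nonneg _) (hr0 j))]
      exact mul_le_of_le_one_right (Nat.cast_nonneg _) (hr1 j)
    linarith
  have hMsη : 0 ≤ (Ms : ℝ) * η := by positivity
  have hMbη : 0 ≤ (Mb : ℝ) * η := by positivity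
  have hgΓ : ‖g‖ ≤ Γ := by
    have := norm_add_le (g - (G + (θ * τ : ℝ) * Complex.I)) (G + (θ * τ : ℝ) * Complex.I)
    rw [sub_add_cancel] at this
    nlinarith
  have hT := norm_exp_sub_taylor_le hgΓ hD
  rw [← hη] at hT
  have hprod1 : ∀ s : Finset ι, ‖∏ j ∈ s, (1 + (r j : ℂ) * z j) ^ m j‖ ≤ 1 := fun s => by
    rw [norm_prod]
    refine Finset.prod_le_one (fun _ _ => norm_nonneg _) fun i _ => ?_
    rw [norm_pow]
    exact pow_le_one₀ (norm_nonneg _) (hf1 i)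
  -- The exact exponential is a rotated product of characteristic functions, so errors in the
  -- exponent are not amplified.
  have hexp1 : ‖Complex.exp (G + (θ * τ : ℝ) * Complex.I)‖ ≤ 1 := by
    rw [Complex.exp_add, norm_mul, Complex.norm_exp_ofReal_mul_I, mul_one, hexpG]
    exact hprod1 small
  have hE := norm_exp_sub_exp_le (a := g) hexp1 (by nlinarith)
  have hA : ‖(∑ i ∈ Finset.range D, g ^ i / i.factorial) -
      Complex.exp (G + (θ * τ : ℝ) * Complex.I)‖ ≤ 6 * (Ms * η) + 4 * η := by
    have := norm_add_le ((∑ i ∈ Finset.range D, g ^ i / i.factorial) - Complex.exp g)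
      (Complex.exp g - Complex.exp (G + (θ * τ : ℝ) * Complex.I))
    rw [sub_add_sub_cancel] at this
    linarith
  have hB := norm_prod_pow_sub_prod_pow_le big m (fun j => 1 + r j * w (u j))
    (fun j => 1 + r j * z j) hη0 (fun j _ => hf1 j) (fun j _ => by
      rw [add_sub_add_left_eq_sub]; exact hwz j) (by nlinarith)
  have htarget : Complex.exp ((θ * τ : ℝ) * Complex.I) * ∏ j, (1 + r j * z j) ^ m j =
      Complex.exp (G + (θ * τ : ℝ) * Complex.I) * ∏ j ∈ big, (1 + r j * z j) ^ m j := by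
    classical
    have h1 : ∏ j, (1 + r j * z j) ^ m j =
        (∏ j ∈ small, (1 + r j * z j) ^ m j) * ∏ j ∈ big, (1 + r j * z j) ^ m j := by
      rw [← Finset.prod_union hdisj]
      symm
      refine Finset.prod_subset (Finset.subset_univ _) fun j _ hj => ?_
      rw [Finset.mem_union, not_or] at hj
      rw [hout j hj.1 hj.2]
      simp
    rw [h1, Complex.exp_add, hexpG]
    ring
  rw [htarget]
  set e1 := ∑ i ∈ Finset.range D, g ^ i / (i.factorial : ℂ)
  set e2 := Complex.exp (G + (θ * τ : ℝ) * Complex.I)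
  set p1 := ∏ j ∈ big, (1 + (r j : ℂ) * w (u j)) ^ m j
  set p2 := ∏ j ∈ big, (1 + (r j : ℂ) * z j) ^ m j
  have e : e1 * p1 - e2 * p2 = (e1 - e2) * (p1 - p2) + (e1 - e2) * p2 + e2 * (p1 - p2) := by ring
  rw [e]
  refine norm_add₃_le.trans ?_
  rw [norm_mul, norm_mul, norm_mul]
  have b1 : ‖p1 - p2‖ ≤ 1 := hB.trans (by rw [← hMb]; nlinarith)
  have c1 := mul_le_mul_of_nonneg_left b1 (norm_nonneg (e1 - e2))
  have c2 := mul_le_mul_of_nonneg_left (hprod1 big) (norm_nonneg (e1 - e2))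
  have c3 := mul_le_mul_of_nonneg_right hexp1 (norm_nonneg (p1 - p2))
  rw [← hMb] at hB
  nlinarith

end Approximation

/-! ### The explicit polynomial system and its size. -/

section System

variable {ν : Type*}

theorem IsRatPolyC.re {d D : ℕ} {H : ℝ} {f : (ν → ℝ) → ℂ} (hD : 0 < D) (h : IsRatPolyC d D H f) :
    IsRatPoly d D H (fun y => (f y).re) := by
  obtain ⟨a, b, h1, h2, h3⟩ := h
  have := IsRatPolyC.nonneg_of hD h3
  exact h2.mono le_rfl dvd_rfl (by linarith)

theorem IsRatPolyC.im {d D : ℕ} {H : ℝ} {f : (ν → ℝ) → ℂ} (hD : 0 < D) (h : IsRatPolyC d D H f) :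
    IsRatPoly d D H (fun y => (f y).im) := by
  obtain ⟨a, b, h1, h2, h3⟩ := h
  have := IsRatPolyC.nonneg_of hD h2
  exact h3.mono le_rfl dvd_rfl (by linarith)

/-- A dyadic rational with denominator `2 ^ N`. -/
def IsDyadic (N : ℕ) (x : ℝ) : Prop := ∃ n : ℤ, x = n / 2 ^ N

theorem IsDyadic.isRatPoly {N : ℕ} {x : ℝ} (h : IsDyadic N x) :
    IsRatPoly 0 (2 ^ N) |x| (fun _ : ν → ℝ => x) := by
  obtain ⟨n, rfl⟩ := h
  simpa using IsRatPoly.div_const (ν := ν) n (D := 2 ^ N) (by positivity)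

theorem IsRatPolyC.const {N : ℕ} {z : ℂ} {H : ℝ} (h1 : IsDyadic N z.re) (h2 : IsDyadic N z.im)
    (hH : ‖z‖ ≤ H) : IsRatPolyC 0 (2 ^ N) (2 * H) (fun _ : ν → ℝ => z) := by
  refine (IsRatPolyC.of_re_im (f := fun _ => z) h1.isRatPoly h2.isRatPoly).mono le_rfl dvd_rfl ?_
  linarith [Complex.abs_re_le_norm z, Complex.abs_im_le_norm z]

theorem isRatPoly_measureFrom (u : Bool) (i : ν) :
    IsRatPoly 1 1 2 (fun y : ν → ℝ => measureFrom u (y i)) := by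
  unfold measureFrom
  cases u
  · simpa using (IsRatPoly.var i).mono le_rfl dvd_rfl (by norm_num)
  · have h := ((IsRatPoly.int_const (ν := ν) 1).mono (Nat.zero_le 1) dvd_rfl le_rfl).sub (IsRatPoly.var i)
    simp only [Int.cast_one, abs_one, one_add_one_eq_two] at h
    simpa using h

theorem isRatPolyC_measureFrom_mul {N : ℕ} (u : Bool) (i : ν) {z : ℂ} (h1 : IsDyadic N z.re)
    (h2 : IsDyadic N z.im) (hz : ‖z‖ ≤ 4) :
    IsRatPolyC 1 (2 ^ N) 16 (fun y : ν → ℝ => (measureFrom u (y i) : ℂ) * z) := by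
  have h := (IsRatPolyC.ofReal (isRatPoly_measureFrom u i)).mul one_pos (by positivity)
    (IsRatPolyC.const h1 h2 hz)
  exact h.mono le_rfl (by simp) (by norm_num)

theorem isRatPolyC_one_div (n : ℕ) (s : ℤ) (hs : |s| ≤ 1) (hn : 0 < n) :
    IsRatPolyC 0 n 1 (fun _ : ν → ℝ => ((s : ℂ) / n)) := by
  have h := (IsRatPolyC.ofReal (IsRatPoly.div_const (ν := ν) s hn))
  have hn' : (1 : ℝ) ≤ n := by exact_mod_cast hn
  have hs' : |(s : ℝ)| ≤ 1 := by exact_mod_cast hs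
  simpa using h.mono le_rfl dvd_rfl (show |(s : ℝ) / n| ≤ 1 by
    rw [abs_div, abs_of_pos (by linarith : (0 : ℝ) < n), div_le_one (by linarith)]; linarith)

theorem isRatPolyC_logTaylor {D N : ℕ} {f : (ν → ℝ) → ℂ} (hf : IsRatPolyC 1 (2 ^ N) 16 f) :
    IsRatPolyC D (2 ^ (N * D) * D.factorial) ((D + 1) * 16 ^ D)
      (fun y => Complex.logTaylor (D + 1) (f y)) := by
  simp only [Complex.logTaylor]
  have hsum := IsRatPolyC.sum (Finset.range (D + 1)) (d := D) (D := 2 ^ (N * D) * D.factorial)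
    (H := fun _ => (16 : ℝ) ^ D) (f := fun (j : ℕ) y => (-1) ^ (j + 1) * f y ^ j / j) (fun j hj => by
      have hjD : j ≤ D := by simpa [Nat.lt_succ_iff] using hj
      -- The term j = 0 of `logTaylor` is a division by zero, hence 0; for j ≥ 1 the denominator j
      -- divides D!.
      rcases Nat.eq_zero_or_pos j with rfl | hj0
      · simpa using (IsRatPolyC.ofReal (IsRatPolyC.zero_poly (ν := ν))).mono (Nat.zero_le D)
          dvd_rfl (by positivity : (0 : ℝ) ≤ 16 ^ D)
      · have h := (hf.pow (by positivity) j).mul (by positivity) hj0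
          (isRatPolyC_one_div (ν := ν) j ((-1) ^ (j + 1)) (by rw [abs_pow]; simp) hj0)
        have h2 := h.mono (d' := D) (D' := 2 ^ (N * D) * D.factorial) (H' := 16 ^ D) (by omega)
          (mul_dvd_mul (by rw [← pow_mul]; exact pow_dvd_pow 2 (Nat.mul_le_mul_left N hjD))
            (Nat.dvd_factorial hj0 hjD))
          (by rw [mul_one]; exact pow_le_pow_right₀ (by norm_num) hjD)
        convert h2 using 2 with y
        push_cast
        ring)
  refine hsum.mono le_rfl dvd_rfl (le_of_eq ?_)
  simp

/-- The exponent enters through two fresh variables, which keeps the degree at D instead of D². -/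
theorem isRatPolyC_expTaylor (D : ℕ) (i j : ν) :
    IsRatPolyC D D.factorial (D * 2 ^ D) (fun y : ν → ℝ =>
      ∑ n ∈ Finset.range D, ((y i : ℂ) + y j * Complex.I) ^ n / n.factorial) := by
  have hv : IsRatPolyC 1 1 2 (fun y : ν → ℝ => (y i : ℂ) + y j * Complex.I) := by
    refine (IsRatPolyC.of_re_im (H := 1) (H' := 1) ?_ ?_).mono le_rfl dvd_rfl (by norm_num)
    · simpa using IsRatPoly.var i
    · simpa using IsRatPoly.var j
  have hsum := IsRatPolyC.sum (Finset.range D) (d := D) (D := D.factorial)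
    (H := fun _ => (2 : ℝ) ^ D)
    (f := fun (n : ℕ) (y : ν → ℝ) => ((y i : ℂ) + y j * Complex.I) ^ n / n.factorial) (fun n hn => by
      have hnD : n ≤ D := (Finset.mem_range.1 hn).le
      have h := (hv.pow one_pos n).mul (by positivity) (Nat.factorial_pos n)
        (isRatPolyC_one_div (ν := ν) n.factorial 1 (by simp) (Nat.factorial_pos n))
      have h2 := h.mono (d' := D) (D' := D.factorial) (H' := 2 ^ D) (by omega)
        (by simpa using Nat.factorial_dvd_factorial hnD)
        (by rw [mul_one]; exact pow_le_pow_right₀ (by norm_num) hnD)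
      convert h2 using 2 with y
      push_cast
      ring)
  refine hsum.mono le_rfl dvd_rfl (le_of_eq ?_)
  simp

theorem factorial_le_two_pow (D : ℕ) : D.factorial ≤ 2 ^ (D * D) := by
  rw [pow_mul]
  exact (Nat.factorial_le_pow D).trans (Nat.pow_le_pow_left Nat.lt_two_pow_self.le D)

/-- Description of the solutions of the polynomial system. -/
structure FourierFeasible {k l : ℕ} (m : Fin k → ℕ) (u : Fin k → Bool) (small big : Finset (Fin k))
    (D : ℕ) (lo hi : Fin k → ℝ) (v₀ v₁ τ A : ℤ) (κ : ℝ) (w : Fin (2 * l + 1) → Bool → ℂ)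
    (a : Fin (2 * l + 1) → ℝ) (h : Fin (2 * l + 1) → ℂ) (x : Fin k → ℝ) : Prop where
  lo_le : ∀ j, lo j ≤ x j
  le_hi : ∀ j, x j ≤ hi j
  le_var : (v₀ : ℝ) ≤ ∑ j ∈ small ∪ big, m j * (x j * (1 - x j))
  var_le : ∑ j ∈ small ∪ big, m j * (x j * (1 - x j)) ≤ v₁
  mean_near : |(τ : ℝ) - ∑ j ∈ small ∪ big, orient (u j) * (m j * measureFrom (u j) (x j))| ≤ A
  fourier_near : ∑ n, ‖h n - (∑ i ∈ Finset.range D, (∑ j ∈ small, m j *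
      Complex.logTaylor (D + 1) (measureFrom (u j) (x j) * w n (u j)) + a n * Complex.I) ^ i /
        i.factorial) * ∏ j ∈ big, (1 + measureFrom (u j) (x j) * w n (u j)) ^ m j‖ ^ 2 ≤ κ

variable {k : ℕ}

/-- At each frequency the two auxiliary unknowns are tied to the exponent by pairs of opposite
inequalities. The count is 2k for the intervals, 4 for variance and mean, 4(2l + 1) for these ties,
and 1 for the Fourier residual. -/
theorem exists_fourierSystem {l : ℕ} (m : Fin k → ℕ) (u : Fin k → Bool) (small big : Finset (Fin k))
    {D : ℕ} (hD : 1 ≤ D) (lo hi : Fin k → ℝ) (v₀ v₁ τ A : ℤ) (κ : ℝ)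
    (w : Fin (2 * l + 1) → Bool → ℂ) (a : Fin (2 * l + 1) → ℝ) (h : Fin (2 * l + 1) → ℂ)
    (hlo : ∀ j, IsDyadic (D + 1) (lo j)) (hhi : ∀ j, IsDyadic (D + 1) (hi j))
    (hκ : IsDyadic (D + 1) κ) (hw1 : ∀ n c, IsDyadic (D + 1) (w n c).re)
    (hw2 : ∀ n c, IsDyadic (D + 1) (w n c).im) (ha : ∀ n, IsDyadic (D + 1) (a n))
    (hh1 : ∀ n, IsDyadic (D + 1) (h n).re) (hh2 : ∀ n, IsDyadic (D + 1) (h n).im)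
    (blo : ∀ j, |lo j| ≤ 1) (bhi : ∀ j, |hi j| ≤ 1) (bκ : |κ| ≤ 1) (bw : ∀ n c, ‖w n c‖ ≤ 4)
    (bh : ∀ n, ‖h n‖ ≤ 2 ^ D) (ba : ∀ n, |a n| ≤ 2 ^ D) (bl : 2 * l + 1 ≤ D)
    (bbig : ∑ j ∈ big, m j ≤ D) (bm : ((∑ j ∈ small ∪ big, m j : ℕ) : ℝ) ≤ 2 ^ D)
    (bv₀ : |(v₀ : ℝ)| ≤ 2 ^ D) (bv₁ : |(v₁ : ℝ)| ≤ 2 ^ D) (bτ : |(τ : ℝ)| ≤ 2 ^ D)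
    (bA : |(A : ℝ)| ≤ 2 ^ D) :
    ∃ S : PolySystem k, S.num = 2 * k + 8 * l + 9 ∧ S.aux = 4 * l + 2 ∧
      (∀ i, (S.poly i).totalDegree ≤ 4 * D) ∧
      (∀ i s, ratBits ((S.poly i).coeff s) ≤ 50 * D ^ 2) ∧
      ∀ x, S.IsSolution x ↔
        FourierFeasible m u small big D lo hi v₀ v₁ τ A κ w a h x := by
  classical
  let γ := (Fin k × Bool) ⊕ (Bool × Bool) ⊕ (Fin (2 * l + 1) × Bool × Bool) ⊕ Unit
  let e : Fin (2 * l + 1) × Bool ≃ Fin (4 * l + 2) :=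
    Fintype.equivFinOfCardEq (by simp; ring)
  let V := Fin k ⊕ Fin (4 * l + 2)
  let U : Fin (2 * l + 1) → V := fun n => Sum.inr (e (n, true))
  let W : Fin (2 * l + 1) → V := fun n => Sum.inr (e (n, false))
  let G : Fin (2 * l + 1) → (V → ℝ) → ℂ := fun n y => ∑ j ∈ small, (m j : ℂ) *
      Complex.logTaylor (D + 1) (measureFrom (u j) (y (Sum.inl j)) * w n (u j)) + a n * Complex.I
  let vr : (V → ℝ) → ℝ := fun y => ∑ j ∈ small ∪ big, m j * (y (Sum.inl j) * (1 - y (Sum.inl j)))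
  let mn : (V → ℝ) → ℝ := fun y => (τ : ℝ) - ∑ j ∈ small ∪ big,
    orient (u j) * (m j * measureFrom (u j) (y (Sum.inl j)))
  let Er : (V → ℝ) → ℝ := fun y => ∑ n, ‖h n - (∑ i ∈ Finset.range D,
    ((y (U n) : ℂ) + y (W n) * Complex.I) ^ i / i.factorial) *
      ∏ j ∈ big, (1 + measureFrom (u j) (y (Sum.inl j)) * w n (u j)) ^ m j‖ ^ 2
  let F : γ → (V → ℝ) → ℝ := fun i => match i with
    | .inl (j, true) => fun y => y (Sum.inl j) - lo j
    | .inl (j, false) => fun y => hi j - y (Sum.inl j)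
    | .inr (.inl (true, true)) => fun y => vr y - v₀
    | .inr (.inl (true, false)) => fun y => v₁ - vr y
    | .inr (.inl (false, true)) => fun y => A - mn y
    | .inr (.inl (false, false)) => fun y => mn y + A
    | .inr (.inr (.inl (n, true, true))) => fun y => y (U n) - (G n y).re
    | .inr (.inr (.inl (n, true, false))) => fun y => (G n y).re - y (U n)
    | .inr (.inr (.inl (n, false, true))) => fun y => y (W n) - (G n y).im
    | .inr (.inr (.inl (n, false, false))) => fun y => (G n y).im - y (W n)
    | .inr (.inr (.inr ())) => fun y => κ - Er y
  have two_pow_mono : ∀ {a b : ℕ}, a ≤ b → (2 : ℝ) ^ a ≤ 2 ^ b := fun hab =>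
    pow_le_pow_right₀ (by norm_num) hab
  have hDD : D ≤ D ^ 2 := Nat.le_self_pow (by norm_num) D
  have hD2 : (D : ℝ) ≤ 2 ^ D := by exact_mod_cast Nat.lt_two_pow_self.le
  have hone : (1 : ℝ) ≤ 2 ^ D := one_le_pow₀ (by norm_num)
  have hfac : ((D.factorial : ℕ) : ℝ) ≤ 2 ^ (D ^ 2) := by
    rw [sq]
    exact_mod_cast factorial_le_two_pow D
  -- size of the individual functions
  have fin_bound : ∀ {f : (V → ℝ) → ℝ} {d Den : ℕ} {H : ℝ} (c c' : ℕ), 0 < Den → d ≤ 4 * D →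
      (Den : ℝ) ≤ 2 ^ c → H ≤ 2 ^ c' → c + c' < 48 * D ^ 2 → IsRatPoly d Den H f →
      ∃ (Den : ℕ) (H : ℝ), 0 < Den ∧ H * Den < 2 ^ (48 * D ^ 2) ∧ IsRatPoly (4 * D) Den H f := by
    intro f d Den H c c' h0 hd h1 h2 h3 hf
    refine ⟨Den, H, h0, ?_, hf.mono hd dvd_rfl le_rfl⟩
    calc H * Den ≤ 2 ^ c' * 2 ^ c := by gcongr
      _ = 2 ^ (c' + c) := (pow_add _ _ _).symm
      _ < 2 ^ (48 * D ^ 2) := pow_lt_pow_right₀ (by norm_num) (by omega)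
  have rlo : ∀ {c : ℝ} (j : V), IsDyadic (D + 1) c → |c| ≤ 1 →
      IsRatPoly 1 (2 ^ (D + 1)) 2 (fun y : V → ℝ => y j - c) := by
    intro c j hc hc1
    refine (((IsRatPoly.var j).mono le_rfl (one_dvd _) le_rfl).sub
      (hc.isRatPoly.mono (Nat.zero_le 1) dvd_rfl hc1)).mono le_rfl dvd_rfl (by norm_num)
  have rvr : IsRatPoly 2 1 (2 * 2 ^ D) vr := by
    have h1 : ∀ j ∈ small ∪ big, IsRatPoly 2 1 (m j * 2)
        (fun y : V → ℝ => m j * (y (Sum.inl j) * (1 - y (Sum.inl j)))) := by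
      intro j _
      have h2 := ((IsRatPoly.int_const (ν := V) 1).mono (Nat.zero_le 1) dvd_rfl le_rfl).sub
        (IsRatPoly.var (Sum.inl j))
      have h3 := (IsRatPoly.int_const (ν := V) (m j)).mul ((IsRatPoly.var (Sum.inl j)).mul h2)
      simp only [Int.cast_natCast, Int.cast_one] at h3
      refine h3.mono le_rfl (by simp) ?_
      rw [abs_one, Nat.abs_cast]
      linarith
    refine (IsRatPoly.sum _ h1).mono le_rfl dvd_rfl ?_
    rw [← Finset.sum_mul, ← Nat.cast_sum]
    linarith
  have rmn : IsRatPoly 2 1 (3 * 2 ^ D) mn := by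
    have h1 : ∀ j ∈ small ∪ big, IsRatPoly 2 1 (m j * 2)
        (fun y : V → ℝ => orient (u j) * (m j * measureFrom (u j) (y (Sum.inl j)))) := by
      intro j _
      have ho : IsRatPoly 0 1 1 (fun _ : V → ℝ => orient (u j)) := by
        unfold orient
        split_ifs
        · simpa using IsRatPoly.int_const (ν := V) (-1)
        · simpa using IsRatPoly.int_const (ν := V) 1
      have h3 := ho.mul ((IsRatPoly.int_const (ν := V) (m j)).mul
        (isRatPoly_measureFrom (u j) (Sum.inl j)))
      simp only [Int.cast_natCast] at h3
      refine h3.mono (by norm_num) (by simp) ?_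
      rw [Nat.abs_cast]
      linarith
    have h2 := ((IsRatPoly.int_const (ν := V) τ).mono (Nat.zero_le 2) dvd_rfl le_rfl).sub
      (IsRatPoly.sum _ h1)
    refine h2.mono le_rfl dvd_rfl ?_
    rw [← Finset.sum_mul, ← Nat.cast_sum]
    linarith
  have rG : ∀ n, IsRatPolyC D (2 ^ ((D + 1) * D) * D.factorial) (2 ^ (6 * D + 1)) (G n) := by
    intro n
    have h1 : ∀ j ∈ small, IsRatPolyC D (2 ^ ((D + 1) * D) * D.factorial) (m j * ((D + 1) * 16 ^ D))
        (fun y : V → ℝ => (m j : ℂ) *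
          Complex.logTaylor (D + 1) (measureFrom (u j) (y (Sum.inl j)) * w n (u j))) := by
      intro j _
      have h2 := (IsRatPolyC.ofReal (IsRatPoly.int_const (ν := V) (m j))).mul one_pos (by positivity)
        (isRatPolyC_logTaylor (D := D)
          (isRatPolyC_measureFrom_mul (u j) (Sum.inl j : V) (hw1 n (u j)) (hw2 n (u j)) (bw n _)))
      simp only [Int.cast_natCast, Nat.abs_cast, Complex.ofReal_natCast, one_mul, zero_add] at h2
      exact h2
    have h2 : IsRatPolyC D (2 ^ ((D + 1) * D) * D.factorial) (2 ^ D)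
        (fun _ : V → ℝ => (a n : ℂ) * Complex.I) := by
      have h3 := IsRatPolyC.of_re_im (f := fun _ : V → ℝ => (a n : ℂ) * Complex.I)
        (d := 0) (D := 2 ^ (D + 1)) (H := 0) (H' := |a n|)
        (by simpa using IsRatPolyC.zero_poly) (by simpa using (ha n).isRatPoly)
      refine h3.mono (Nat.zero_le _) ?_ (by linarith [ba n])
      exact Dvd.dvd.mul_right (pow_dvd_pow 2 (Nat.le_mul_of_pos_right _ hD)) _
    refine ((IsRatPolyC.sum _ h1).add h2).mono le_rfl dvd_rfl ?_
    rw [← Finset.sum_mul, ← Nat.cast_sum]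
    have h4 : ((∑ j ∈ small, m j : ℕ) : ℝ) ≤ 2 ^ D := le_trans (by
      exact_mod_cast Finset.sum_le_sum_of_subset Finset.subset_union_left) bm
    have h5 : ((D : ℝ) + 1) * 16 ^ D ≤ 2 ^ D * 2 ^ (4 * D) := by
      rw [pow_mul (2 : ℝ) 4]
      norm_num
      exact_mod_cast Nat.lt_two_pow_self
    calc _ ≤ (2 : ℝ) ^ D * (2 ^ D * 2 ^ (4 * D)) + 2 ^ (6 * D) := by
          gcongr
          · norm_num
          · omega
      _ = _ := by rw [← pow_add, ← pow_add, pow_succ, show D + (D + 4 * D) = 6 * D by ring]; ring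
  have dG : ((2 ^ ((D + 1) * D) * D.factorial : ℕ) : ℝ) ≤ 2 ^ (3 * D ^ 2) := by
    push_cast
    calc (2 : ℝ) ^ ((D + 1) * D) * D.factorial ≤ 2 ^ (2 * D ^ 2) * 2 ^ (D ^ 2) :=
          mul_le_mul (two_pow_mono (by nlinarith)) hfac (by positivity) (by positivity)
      _ = _ := by rw [← pow_add]; ring_nf
  have rUG : ∀ n (i : V), IsRatPoly D (2 ^ ((D + 1) * D) * D.factorial) (1 + 2 ^ (6 * D + 1))
      (fun y => y i - (G n y).re) ∧ IsRatPoly D (2 ^ ((D + 1) * D) * D.factorial)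
      (1 + 2 ^ (6 * D + 1)) (fun y => y i - (G n y).im) := by
    intro n i
    have h1 := (IsRatPoly.var i).mono (d' := D) (D' := 2 ^ ((D + 1) * D) * D.factorial) hD
      (one_dvd _) le_rfl
    exact ⟨h1.sub ((rG n).re (by positivity)), h1.sub ((rG n).im (by positivity))⟩
  have bG : (1 : ℝ) + 2 ^ (6 * D + 1) ≤ 2 ^ (6 * D + 2) := by
    have : (1 : ℝ) ≤ 2 ^ (6 * D + 1) := one_le_pow₀ (by norm_num)
    rw [pow_succ _ (6 * D + 1)]
    linarith
  -- The residual has degree D from the exponential plus at most D from the factors in `big`;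
  -- squaring gives 4D. Its denominator collects those of h, of the exponential series and of the
  -- rounded angles.
  have rEr : ∃ (Den : ℕ) (H : ℝ), 0 < Den ∧ (Den : ℝ) ≤ 2 ^ (14 * D ^ 2) ∧ H ≤ 2 ^ (20 * D + 2) ∧
      IsRatPoly (4 * D) Den H (fun y => κ - Er y) := by
    have hden : (2 ^ (D + 1) * (D.factorial * 2 ^ ((D + 1) * D)) : ℕ) ≤ 2 ^ (7 * D ^ 2) := by
      calc 2 ^ (D + 1) * (D.factorial * 2 ^ ((D + 1) * D)) ≤
          2 ^ (D + 1) * (2 ^ (D * D) * 2 ^ ((D + 1) * D)) := by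
            gcongr
            exact factorial_le_two_pow D
        _ = 2 ^ (D + 1 + (D * D + (D + 1) * D)) := by simp only [← pow_add]
        _ ≤ _ := Nat.pow_le_pow_right (by norm_num) (by nlinarith)
    set Den := 2 ^ (D + 1) * (D.factorial * 2 ^ ((D + 1) * D)) with hDen
    have hDen0 : 0 < Den := by positivity
    have h1 : ∀ n, IsRatPolyC (2 * D) Den (2 ^ (9 * D)) (fun y => h n - (∑ i ∈ Finset.range D,
        ((y (U n) : ℂ) + y (W n) * Complex.I) ^ i / i.factorial) *
        ∏ j ∈ big, (1 + measureFrom (u j) (y (Sum.inl j)) * w n (u j)) ^ m j) := by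
      intro n
      have h2 := (IsRatPolyC.const (ν := V) (hh1 n) (hh2 n) (bh n)).mono (d' := 2 * D) (D' := Den)
        (Nat.zero_le _) (dvd_mul_right _ _) le_rfl
      have h3 : ∀ j ∈ big, IsRatPolyC 1 (2 ^ (D + 1)) 32
          (fun y : V → ℝ => 1 + measureFrom (u j) (y (Sum.inl j)) * w n (u j)) := fun j _ =>
        (((IsRatPolyC.one (ν := V)).mono (Nat.zero_le 1) (one_dvd _) le_rfl).add
          (isRatPolyC_measureFrom_mul (u j) (Sum.inl j : V) (hw1 n _) (hw2 n _) (bw n _))).mono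
          le_rfl dvd_rfl (by norm_num)
      have h4 := (isRatPolyC_expTaylor (ν := V) D (U n) (W n)).mul (Nat.factorial_pos D)
        (by positivity) (IsRatPolyC.prod_pow big (by positivity) m h3)
      have h5 := h4.mono (d' := 2 * D) (D' := Den) (H' := 2 ^ D * 2 ^ D * 2 ^ (5 * D)) (by
          rw [mul_one]; omega)
        (by
          rw [hDen, ← pow_mul]
          exact Dvd.dvd.mul_left (mul_dvd_mul_left _ (pow_dvd_pow 2 (Nat.mul_le_mul_left _ bbig))) _)
        (by
          rw [pow_mul (2 : ℝ) 5, show (2 : ℝ) ^ 5 = 32 by norm_num]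
          gcongr
          norm_num)
      refine (h2.sub h5).mono le_rfl dvd_rfl ?_
      rw [← pow_add, ← pow_add]
      have h6 : (2 : ℝ) * 2 ^ D ≤ 2 ^ (8 * D) := by
        rw [← pow_succ']
        exact two_pow_mono (by omega)
      have h7 : (2 : ℝ) ^ (D + D + 5 * D) ≤ 2 ^ (8 * D) := two_pow_mono (by omega)
      have h8 : (2 : ℝ) * 2 ^ (8 * D) ≤ 2 ^ (9 * D) := by
        rw [← pow_succ']
        exact two_pow_mono (by omega)
      linarith
    have h2 := IsRatPoly.sum Finset.univ fun n _ => (h1 n).norm_sq hDen0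
    have h3 := (hκ.isRatPoly (ν := V)).mono (d' := 2 * D + 2 * D) (D' := Den * Den) (Nat.zero_le _)
      (Dvd.dvd.mul_right (dvd_mul_right _ _) _) bκ
    refine ⟨Den * Den, _, by positivity, ?_, ?_, (h3.sub h2).mono (by omega) dvd_rfl le_rfl⟩
    · have h4 : (Den : ℝ) ≤ 2 ^ (7 * D ^ 2) := by exact_mod_cast hden
      push_cast
      calc (Den : ℝ) * Den ≤ 2 ^ (7 * D ^ 2) * 2 ^ (7 * D ^ 2) := by gcongr
        _ = _ := by rw [← pow_add]; ring_nf
    · rw [Finset.sum_const, Finset.card_univ, Fintype.card_fin, nsmul_eq_mul, ← pow_add]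
      have h4 : ((2 * l + 1 : ℕ) : ℝ) ≤ 2 ^ D := le_trans (by exact_mod_cast bl) hD2
      calc (1 : ℝ) + (2 * l + 1 : ℕ) * 2 ^ (9 * D + 9 * D) ≤
          2 ^ (20 * D) + 2 ^ D * 2 ^ (9 * D + 9 * D) := by
            gcongr
            exact one_le_pow₀ (by norm_num)
        _ ≤ 2 ^ (20 * D) + 2 ^ (20 * D) := by
            rw [← pow_add]
            have := two_pow_mono (show D + (9 * D + 9 * D) ≤ 20 * D by omega)
            linarith
        _ ≤ 2 ^ (20 * D + 2) := by rw [pow_add]; nlinarith [two_pow_mono (Nat.zero_le (20 * D))]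
  have two_pow_D : ∀ c : ℝ, c ≤ 2 ^ 3 → c * 2 ^ D ≤ 2 ^ (3 + D) := fun c hc => by
    rw [pow_add]
    gcongr
  have hF : ∀ i, ∃ (Den : ℕ) (H : ℝ), 0 < Den ∧ H * Den < 2 ^ (48 * D ^ 2) ∧
      IsRatPoly (4 * D) Den H (F i) := by
    have hsgn : ∀ {f : (V → ℝ) → ℝ} {c : ℤ}, |(c : ℝ)| ≤ 2 ^ D →
        IsRatPoly 2 1 (3 * 2 ^ D) f → IsRatPoly 2 1 (4 * 2 ^ D) (fun y => f y + c) ∧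
          IsRatPoly 2 1 (4 * 2 ^ D) (fun y => c - f y) := by
      intro f c hc hf
      have h1 := (IsRatPoly.int_const (ν := V) c).mono (Nat.zero_le 2) dvd_rfl hc
      exact ⟨(hf.add h1).mono le_rfl dvd_rfl (by linarith),
        (h1.sub hf).mono le_rfl dvd_rfl (by linarith)⟩
    have rvr' := rvr.mono (d' := 2) (D' := 1) (H' := 3 * 2 ^ D) le_rfl dvd_rfl (by linarith)
    rintro (⟨j, _ | _⟩ | ⟨_ | _, _ | _⟩ | ⟨n, _ | _, _ | _⟩ | ⟨⟩)
    · refine fin_bound (Den := 2 ^ (D + 1)) (H := 2) (D + 1) 1 (by positivity) (by omega : 1 ≤ _) (by norm_num)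
        (by norm_num) (by omega) ?_
      simpa [F] using (rlo (Sum.inl j) (hhi j) (bhi j)).neg
    · exact fin_bound (Den := 2 ^ (D + 1)) (H := 2) (D + 1) 1 (by positivity) (by omega : 1 ≤ _) (by norm_num) (by norm_num)
        (by omega) (rlo (Sum.inl j) (hlo j) (blo j))
    · exact fin_bound 0 (3 + D) one_pos (by omega) (by norm_num) (two_pow_D 4 (by norm_num)) (by omega)
        (hsgn bA rmn).1
    · exact fin_bound 0 (3 + D) one_pos (by omega) (by norm_num) (two_pow_D 4 (by norm_num)) (by omega)
        (hsgn bA rmn).2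
    · exact fin_bound 0 (3 + D) one_pos (by omega) (by norm_num) (two_pow_D 4 (by norm_num)) (by omega)
        (hsgn bv₁ rvr').2
    · refine fin_bound (d := 2) 0 (3 + D) one_pos (by omega) (by norm_num) (two_pow_D 4 (by norm_num)) (by omega) ?_
      simpa [F, sub_eq_add_neg] using
        (hsgn (c := -v₀) (by simpa using bv₀) rvr').1
    · refine fin_bound (d := D) (3 * D ^ 2) (6 * D + 2) (by positivity) (by omega) dG bG (by omega) ?_
      simpa [F] using (rUG n (W n)).2.neg
    · exact fin_bound (3 * D ^ 2) (6 * D + 2) (by positivity) (by omega) dG bG (by omega) (rUG n (W n)).2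
    · refine fin_bound (d := D) (3 * D ^ 2) (6 * D + 2) (by positivity) (by omega) dG bG (by omega) ?_
      simpa [F] using (rUG n (U n)).1.neg
    · exact fin_bound (3 * D ^ 2) (6 * D + 2) (by positivity) (by omega) dG bG (by omega) (rUG n (U n)).1
    · obtain ⟨Den, H, h0, h1, h2, h3⟩ := rEr
      exact fin_bound (14 * D ^ 2) (20 * D + 2) h0 le_rfl h1 h2 (by omega) h3
  obtain ⟨S, hS1, hS2, hS3, hS4, hS5⟩ := exists_polySystem F (4 * D) (48 * D ^ 2) hF
  refine ⟨S, ?_, hS1, hS3, fun i s => (hS4 i s).trans (by nlinarith), fun x => ?_⟩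
  · rw [hS2]
    simp [γ]
    ring
  · rw [hS5]
    constructor
    · rintro ⟨y, hy⟩
      have hG : ∀ n, (y (e (n, true)) : ℂ) + y (e (n, false)) * Complex.I = G n (Sum.elim x y) := by
        intro n
        have h1 := hy (.inr (.inr (.inl (n, true, true))))
        have h2 := hy (.inr (.inr (.inl (n, true, false))))
        have h3 := hy (.inr (.inr (.inl (n, false, true))))
        have h4 := hy (.inr (.inr (.inl (n, false, false))))
        simp only [F, U, W, Sum.elim_inr] at h1 h2 h3 h4
        refine Complex.ext ?_ ?_
        · simp only [Complex.add_re, Complex.ofReal_re, Complex.mul_re, Complex.I_re, mul_zero,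
            Complex.ofReal_im, Complex.I_im, zero_mul, sub_zero, add_zero]
          linarith
        · simp only [Complex.add_im, Complex.ofReal_im, Complex.mul_im, Complex.I_im, mul_one,
            Complex.ofReal_re, Complex.I_re, mul_zero, add_zero, zero_add]
          linarith
      refine ⟨fun j => ?_, fun j => ?_, ?_, ?_, ?_, ?_⟩
      · have := hy (.inl (j, true))
        simp only [F, Sum.elim_inl] at this
        linarith
      · have := hy (.inl (j, false))
        simp only [F, Sum.elim_inl] at this
        linarith
      · have := hy (.inr (.inl (true, true)))
        simp only [F, vr, Sum.elim_inl] at this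
        linarith
      · have := hy (.inr (.inl (true, false)))
        simp only [F, vr, Sum.elim_inl] at this
        linarith
      · have h1 := hy (.inr (.inl (false, true)))
        have h2 := hy (.inr (.inl (false, false)))
        simp only [F, mn, Sum.elim_inl] at h1 h2
        exact abs_le.2 ⟨by linarith, by linarith⟩
      · have := hy (.inr (.inr (.inr ())))
        simp only [F, Er, U, W, Sum.elim_inr, Sum.elim_inl, hG] at this
        exact sub_nonneg.1 this
    · intro hx
      -- The exponents depend on the main unknowns only, so the 0 put in for the auxiliary ones is a
      -- dummy.
      let y : Fin (4 * l + 2) → ℝ := fun i =>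
        if (e.symm i).2 then (G (e.symm i).1 (Sum.elim x 0)).re else (G (e.symm i).1 (Sum.elim x 0)).im
      have hG0 : ∀ n, G n (Sum.elim x y) = G n (Sum.elim x 0) := fun n => rfl
      have hU : ∀ n, Sum.elim x y (U n) = (G n (Sum.elim x y)).re := fun n => by
        simp [U, y, hG0]
      have hW : ∀ n, Sum.elim x y (W n) = (G n (Sum.elim x y)).im := fun n => by
        simp [W, y, hG0]
      refine ⟨y, ?_⟩
      rintro (⟨j, _ | _⟩ | ⟨_ | _, _ | _⟩ | ⟨n, _ | _, _ | _⟩ | ⟨⟩)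
      · exact sub_nonneg.2 (hx.le_hi j)
      · exact sub_nonneg.2 (hx.lo_le j)
      · have := (abs_le.1 hx.mean_near).1
        show 0 ≤ mn (Sum.elim x y) + A
        simp only [mn, Sum.elim_inl]
        linarith
      · have := (abs_le.1 hx.mean_near).2
        exact sub_nonneg.2 this
      · exact sub_nonneg.2 hx.var_le
      · exact sub_nonneg.2 hx.le_var
      · simp only [F, hW, sub_self, le_refl]
      · simp only [F, hW, sub_self, le_refl]
      · simp only [F, hU, sub_self, le_refl]
      · simp only [F, hU, sub_self, le_refl]
      · simp only [F, Er, hU, hW, Complex.re_add_im]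
        exact sub_nonneg.2 hx.fourier_near

end System

/-! ### Counting the parameters of an admissible pattern. -/

section PatternBounds

/-- The interval lies next to `1`. -/
def Cell.isUpper : Cell → Bool
  | .zero => false
  | .one => true
  | .lower _ => false
  | .upper _ => true

/-- The interval is not a single point. -/
def Cell.isBand : Cell → Bool
  | .zero => false
  | .one => false
  | .lower _ => true
  | .upper _ => true

/-- Largest distance of a point of the interval from the end it is measured from. -/
def Cell.reach (R : ℝ) : Cell → ℝ
  | .zero => 0
  | .one => 0
  | .lower i => bandHi R i
  | .upper i => bandHi R i

theorem cut_pos {R : ℝ} (h0 : 0 < R) (i : ℕ) : 0 < cut R i := pow_pos h0 _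

theorem cut_succ (R : ℝ) (i : ℕ) : cut R (i + 1) = cut R i ^ 2 := by
  rw [cut, cut, ← pow_mul, pow_succ]

theorem cut_anti {R : ℝ} (h0 : 0 < R) (h1 : R ≤ 1 / 4) {i j : ℕ} (hij : i ≤ j) :
    cut R j ≤ cut R i :=
  pow_le_pow_of_le_one h0.le (by linarith) (Nat.pow_le_pow_right (by norm_num) hij)

theorem cut_le {R : ℝ} (h0 : 0 < R) (h1 : R ≤ 1 / 4) (i : ℕ) : cut R i ≤ 1 / 4 :=
  (cut_anti h0 h1 (Nat.zero_le i)).trans (by simpa [cut] using h1)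

/-- Used in the form: a cut of size at least 1/n has index at most n. -/
theorem cut_mul_le {R : ℝ} (h0 : 0 < R) (h1 : R ≤ 1 / 4) (i : ℕ) : i * cut R i ≤ 1 := by
  have h2 : cut R i ≤ (1 / 2) ^ i := by
    calc cut R i ≤ (1 / 2) ^ 2 ^ i := pow_le_pow_left₀ h0.le (by linarith) _
      _ ≤ (1 / 2) ^ i := pow_le_pow_of_le_one (by norm_num) (by norm_num) Nat.lt_two_pow_self.le
  have h3 : (i : ℝ) ≤ 2 ^ i := by exact_mod_cast Nat.lt_two_pow_self.le
  calc (i : ℝ) * cut R i ≤ 2 ^ i * (1 / 2) ^ i :=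
        mul_le_mul h3 h2 (cut_pos h0 i).le (by positivity)
    _ = 1 := by rw [← mul_pow]; norm_num

/-- The cuts decay doubly exponentially, which turns the admissible numbers of distinct parameters
into a geometric series. -/
theorem two_pow_le_log_cut {R : ℝ} (h0 : 0 < R) (h1 : R ≤ 1 / 4) (i : ℕ) :
    (2 : ℝ) ^ i ≤ Real.log (1 / cut R i) := by
  rw [cut, one_div, Real.log_inv, Real.log_pow]
  have h2 : Real.log R ≤ -1 := by
    have h3 : Real.log R ≤ Real.log (1 / 4) := Real.log_le_log h0 h1
    have h4 : Real.log (1 / 4) = -(2 * Real.log 2) := by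
      rw [one_div, Real.log_inv, show (4 : ℝ) = 2 ^ 2 by norm_num, Real.log_pow]
      norm_num
    linarith [Real.log_two_gt_d9]
  push_cast
  nlinarith [pow_pos (two_pos : (0 : ℝ) < 2) i]

theorem bandHi_nonneg {R : ℝ} (h0 : 0 < R) (i : ℕ) : 0 ≤ bandHi R i := by
  cases i with
  | zero => norm_num [bandHi]
  | succ i => exact (cut_pos h0 i).le

theorem bandHi_le {R : ℝ} (h0 : 0 < R) (h1 : R ≤ 1 / 4) (i : ℕ) : bandHi R i ≤ 1 / 2 := by
  cases i with
  | zero => exact le_rfl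
  | succ i => exact (cut_le h0 h1 i).trans (by norm_num)

theorem bandLo_nonneg {R : ℝ} (h0 : 0 < R) (L i : ℕ) : 0 ≤ bandLo R L i := by
  unfold bandLo
  split_ifs
  · exact (cut_pos h0 i).le
  · exact le_rfl

theorem bandLo_le {R : ℝ} (h0 : 0 < R) (h1 : R ≤ 1 / 4) (L i : ℕ) : bandLo R L i ≤ 1 / 2 := by
  unfold bandLo
  split_ifs
  · exact (cut_le h0 h1 i).trans (by norm_num)
  · norm_num

variable {k : ℕ} {T : Pattern k} {C : ℕ} {ε μ V : ℝ}

theorem Pattern.a_mem (h0 : 0 < T.R) (h1 : T.R ≤ 1 / 4) (j : Fin k) : 0 ≤ T.a j ∧ T.a j ≤ 1 := by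
  unfold Pattern.a
  cases T.cell j with
  | zero => simp [Cell.lo]
  | one => simp [Cell.lo]
  | lower i =>
    have := bandLo_nonneg h0 T.L i
    have := bandLo_le h0 h1 T.L i
    simp only [Cell.lo]
    constructor <;> linarith
  | upper i =>
    have := bandHi_nonneg h0 i
    have := bandHi_le h0 h1 i
    simp only [Cell.lo]
    constructor <;> linarith

theorem Pattern.b_mem (h0 : 0 < T.R) (h1 : T.R ≤ 1 / 4) (j : Fin k) : 0 ≤ T.b j ∧ T.b j ≤ 1 := by
  unfold Pattern.b
  cases T.cell j with
  | zero => simp [Cell.hi]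
  | one => simp [Cell.hi]
  | lower i =>
    have := bandHi_nonneg h0 i
    have := bandHi_le h0 h1 i
    simp only [Cell.hi]
    constructor <;> linarith
  | upper i =>
    have := bandLo_nonneg h0 T.L i
    have := bandLo_le h0 h1 T.L i
    simp only [Cell.hi]
    constructor <;> linarith

/-- Every parameter lies in one of the finitely many intervals. -/
theorem Pattern.sum_le_sum_cells (hi : ∀ j i, (T.cell j = .lower i ∨ T.cell j = .upper i) → i ≤ T.L + 1)
    (f : Fin k → ℕ) : ∑ j, f j ≤ (∑ j with T.cell j = .zero, f j) + (∑ j with T.cell j = .one, f j) +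
      ∑ i ∈ Finset.range (T.L + 2),
        ((∑ j with T.cell j = .lower i, f j) + ∑ j with T.cell j = .upper i, f j) := by
  simp_rw [Finset.sum_filter, ← Finset.sum_add_distrib]
  rw [Finset.sum_comm, ← Finset.sum_add_distrib]
  refine Finset.sum_le_sum fun j _ => ?_
  have key : ∀ i ∈ Finset.range (T.L + 2), ((if T.cell j = .lower i then f j else 0) +
      if T.cell j = .upper i then f j else 0) ≤ ∑ i ∈ Finset.range (T.L + 2),
        ((if T.cell j = .lower i then f j else 0) + if T.cell j = .upper i then f j else 0) :=
    fun i hi => Finset.single_le_sum (f := fun i => (if T.cell j = .lower i then f j else 0) +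
      if T.cell j = .upper i then f j else 0) (fun _ _ => Nat.zero_le _) hi
  cases h : T.cell j with
  | zero => simp
  | one => simp
  | lower i =>
    have := key i (Finset.mem_range.2 (by have := hi j i (Or.inl h); omega))
    simp only [h, if_true] at this
    simp at this ⊢
    omega
  | upper i =>
    have := key i (Finset.mem_range.2 (by have := hi j i (Or.inr h); omega))
    simp only [h, if_true] at this
    simp at this ⊢
    omega

namespace Pattern.Admissible

theorem distinctIn_le_countIn (hT : T.Admissible C ε μ V) (c : Cell) : T.distinctIn c ≤ T.countIn c := by
  rw [Pattern.distinctIn, Pattern.countIn, Finset.card_eq_sum_ones]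
  exact Finset.sum_le_sum fun j _ => hT.mult_pos j

/-- The intervals up to index L contribute a geometric series; the two points and the two extreme
intervals contribute at most one parameter each. -/
theorem card_le (hT : T.Admissible C ε μ V) (hL : 0 ≤ Real.log (1 / ε)) :
    (k : ℝ) ≤ 4 + 4 * C * Real.log (1 / ε) := by
  have h := Pattern.sum_le_sum_cells hT.index_le (fun _ => 1)
  simp only [← Finset.card_eq_sum_ones, Finset.card_univ, Fintype.card_fin] at h
  rw [Finset.sum_range_succ] at h
  have hz : (Finset.univ.filter fun j => T.cell j = .zero).card ≤ 1 := hT.zero_le_one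
  have ho : (Finset.univ.filter fun j => T.cell j = .one).card ≤ 1 := hT.one_le_one
  have hl : (Finset.univ.filter fun j => T.cell j = .lower (T.L + 1)).card ≤ 1 :=
    (hT.distinctIn_le_countIn _).trans (hT.last_le_one _ (Or.inl rfl))
  have hu : (Finset.univ.filter fun j => T.cell j = .upper (T.L + 1)).card ≤ 1 :=
    (hT.distinctIn_le_countIn _).trans (hT.last_le_one _ (Or.inr rfl))
  have hs : ((∑ i ∈ Finset.range (T.L + 1), ((Finset.univ.filter fun j => T.cell j = .lower i).card +
      (Finset.univ.filter fun j => T.cell j = .upper i).card) : ℕ) : ℝ) ≤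
      4 * C * Real.log (1 / ε) := by
    push_cast
    have h1 : ∀ i ∈ Finset.range (T.L + 1), (((Finset.univ.filter fun j => T.cell j = .lower i).card : ℝ) +
        (Finset.univ.filter fun j => T.cell j = .upper i).card) ≤
        2 * C * Real.log (1 / ε) * (1 / 2) ^ i := by
      intro i hi
      have hi : i ≤ T.L := by simpa [Nat.lt_succ_iff] using hi
      have h2 : (C : ℝ) * (Real.log (1 / ε) / Real.log (1 / cut T.R i)) ≤
          C * Real.log (1 / ε) * (1 / 2) ^ i := by
        have h3 := two_pow_le_log_cut hT.R_pos hT.R_le i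
        rw [one_div_pow, mul_one_div, ← mul_div_assoc]
        exact div_le_div_of_nonneg_left (mul_nonneg (Nat.cast_nonneg _) hL) (by positivity) h3
      have e1 := hT.distinct_le i hi (.lower i) (Or.inl rfl)
      have e2 := hT.distinct_le i hi (.upper i) (Or.inr rfl)
      simp only [Pattern.distinctIn] at e1 e2
      linarith
    refine (Finset.sum_le_sum h1).trans ?_
    rw [← Finset.mul_sum]
    have h2 : ∑ i ∈ Finset.range (T.L + 1), (1 / 2 : ℝ) ^ i ≤ 2 :=
      le_of_le_of_eq (summable_geometric_two.sum_le_tsum _ fun _ _ => by positivity) tsum_geometric_two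
    have h3 : 0 ≤ 2 * (C : ℝ) * Real.log (1 / ε) := by positivity
    nlinarith
  have h' : (k : ℝ) ≤ 1 + 1 + (((∑ i ∈ Finset.range (T.L + 1),
      ((Finset.univ.filter fun j => T.cell j = .lower i).card +
      (Finset.univ.filter fun j => T.cell j = .upper i).card) : ℕ) : ℝ) + (1 + 1)) := by
    exact_mod_cast h.trans (by gcongr)
  linarith

/-- All cuts up to index L are at least ε^C, and V is polynomial in 1/ε. The point cells are
excluded: the multiplicity of 1 is only known to be near the mean. -/
theorem mult_le (hT : T.Admissible C ε μ V) (h0 : 0 < ε) (h1 : ε ≤ 1 / 2)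
    (hV : V ≤ (1 / ε) ^ C) (j : Fin k) (hj : (T.cell j).isBand) :
    (T.mult j : ℝ) ≤ (C + 1) * (1 / ε) ^ (2 * C) := by
  have hε : 1 ≤ 1 / ε := by rw [le_div_iff₀ h0]; linarith
  have hself : T.mult j ≤ T.countIn (T.cell j) :=
    Finset.single_le_sum (f := T.mult) (fun _ _ => Nat.zero_le _)
      (Finset.mem_filter.2 ⟨Finset.mem_univ j, rfl⟩)
  have hone : (1 : ℝ) ≤ (1 / ε) ^ (2 * C) := one_le_pow₀ hε
  have hband : ∀ i, (T.cell j = .lower i ∨ T.cell j = .upper i) →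
      (T.mult j : ℝ) ≤ (C + 1) * (1 / ε) ^ (2 * C) := by
    intro i hi
    have hself' : (T.mult j : ℝ) ≤ T.countIn (T.cell j) := by exact_mod_cast hself
    rcases Nat.lt_or_ge T.L i with hlt | hle
    · have hi' : i = T.L + 1 := le_antisymm (hT.index_le j i hi) hlt
      subst hi'
      have h2 : (T.countIn (T.cell j) : ℝ) ≤ 1 := by exact_mod_cast hT.last_le_one _ hi
      nlinarith [(Nat.cast_nonneg C : (0 : ℝ) ≤ C)]
    · have h2 := hT.count_le i hle _ hi
      have h3 : ε ^ C ≤ cut T.R i := hT.last_lower.trans (cut_anti hT.R_pos hT.R_le hle)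
      have h4 : V / cut T.R i ≤ (1 / ε) ^ (2 * C) := by
        calc V / cut T.R i ≤ (1 / ε) ^ C / ε ^ C :=
              div_le_div₀ (by positivity) hV (by positivity) h3
          _ = (1 / ε) ^ (2 * C) := by rw [two_mul, pow_add, one_div_pow]; ring
      have h5 := mul_le_mul_of_nonneg_left h4 (Nat.cast_nonneg C : (0 : ℝ) ≤ C)
      linarith
  cases h : T.cell j with
  | zero => simp [h, Cell.isBand] at hj
  | one => simp [h, Cell.isBand] at hj
  | lower i => exact hband i (Or.inl h)
  | upper i => exact hband i (Or.inr h)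

/-- The parameters for which `reach * z` is not small have total multiplicity `O(log (1/ε))`. -/
theorem sum_mult_big_le (hT : T.Admissible C ε μ V) (hL : 0 < Real.log (1 / ε)) (hV0 : 0 ≤ V)
    {z : ℝ} (hz0 : 0 ≤ z) (hz : z ≤ C) (hzV : z ^ 2 * V ≤ C ^ 2 * Real.log (1 / ε)) :
    ((∑ j with (T.cell j).isBand ∧ 1 / 4 < (T.cell j).reach T.R * z, T.mult j : ℕ) : ℝ) ≤
      2 + 2176 * C ^ 7 * Real.log (1 / ε) := by
  rcases Nat.eq_zero_or_pos C with rfl | hC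
  · have hz' : z = 0 := le_antisymm (by simpa using hz) hz0
    subst hz'
    rw [Finset.filter_false_of_mem]
    · simp
    · intro j _ hj
      have := hj.2
      norm_num at this
  have hC1 : (1 : ℝ) ≤ C := by exact_mod_cast hC
  set n : ℕ := 16 * C ^ 2 with hn
  have hn0 : (0 : ℝ) < n := by positivity
  -- a band that contributes has a cut of constant size
  have hcut : ∀ i ≤ T.L, 1 / 4 < bandHi T.R i * z → i ≤ n ∧ V / cut T.R i ≤
      64 * C ^ 4 * Real.log (1 / ε) := by
    intro i _ hi
    have hcp := cut_pos hT.R_pos i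
    -- For i = 0 the angle exceeds 1/2, so V = O(log(1/ε)), and admissibility keeps R away from 0.
    -- For i + 1 the bounds z ≤ C and B_i ≤ 1/4 force z ≥ 1 and B_i ≥ 1/(4C), and B_{i+1} is the
    -- square of B_i.
    have hmain : 1 / (n : ℝ) ≤ cut T.R i ∧ V ≤ 4 * C ^ 2 * Real.log (1 / ε) := by
      have hnC : (n : ℝ) = 16 * (C : ℝ) ^ 2 := by rw [hn]; push_cast; ring
      cases i with
      | zero =>
        simp only [bandHi] at hi
        have hz2 : 1 / 2 < z := by linarith
        have hV4 : V ≤ 4 * C ^ 2 * Real.log (1 / ε) := by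
          have hz4 : 1 / 4 ≤ z ^ 2 := by nlinarith
          nlinarith [mul_le_mul_of_nonneg_right hz4 hV0]
        refine ⟨?_, hV4⟩
        simp only [cut, pow_zero, pow_one]
        rcases hT.R_lower with hR | hR
        · rw [hR, div_le_div_iff₀ hn0 (by norm_num), hnC]
          nlinarith
        · have h2 : Real.log (1 / ε) ≤ C * (T.R ^ 2 * (4 * C ^ 2 * Real.log (1 / ε))) := by
            refine hR.trans ?_
            gcongr
          have h3 : 1 ≤ 4 * (C : ℝ) ^ 3 * T.R ^ 2 := by
            by_contra hneg
            push Not at hneg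
            nlinarith
          have h4 : 1 ≤ (4 * (C : ℝ) ^ 2 * T.R) ^ 2 := by
            have : (C : ℝ) ^ 3 ≤ C ^ 4 := pow_le_pow_right₀ hC1 (by norm_num)
            have h5 : 4 * (C : ℝ) ^ 3 * T.R ^ 2 ≤ 16 * C ^ 4 * T.R ^ 2 := by
              gcongr
              linarith [pow_nonneg (by linarith : (0 : ℝ) ≤ C) 4]
            calc (1 : ℝ) ≤ 16 * C ^ 4 * T.R ^ 2 := h3.trans h5
              _ = _ := by ring
          have h5 : 1 ≤ 4 * (C : ℝ) ^ 2 * T.R := by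
            have : 0 ≤ 4 * (C : ℝ) ^ 2 * T.R := by have := hT.R_pos; positivity
            nlinarith
          rw [div_le_iff₀ hn0, hnC]
          have := hT.R_pos
          nlinarith [mul_pos (mul_pos (by linarith : (0 : ℝ) < C) (by linarith : (0 : ℝ) < C)) this]
      | succ i =>
        simp only [bandHi] at hi
        have hc4 := cut_le hT.R_pos hT.R_le i
        have hcp' := cut_pos hT.R_pos i
        have hz1 : 1 ≤ z := by nlinarith
        have h2 : 1 ≤ 4 * C * cut T.R i := by nlinarith
        refine ⟨?_, ?_⟩
        · rw [cut_succ, div_le_iff₀ hn0, hnC]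
          calc (1 : ℝ) ≤ (4 * C * cut T.R i) ^ 2 := one_le_pow₀ h2
            _ = _ := by ring
        · have : V ≤ z ^ 2 * V := le_mul_of_one_le_left hV0 (one_le_pow₀ hz1)
          have h3 : 0 ≤ (C : ℝ) ^ 2 * Real.log (1 / ε) := by positivity
          linarith
    obtain ⟨h1, h2⟩ := hmain
    rw [div_le_iff₀ hn0] at h1
    constructor
    · have h3 := cut_mul_le hT.R_pos hT.R_le i
      have h4 : (i : ℝ) * cut T.R i ≤ n * cut T.R i := by linarith [mul_comm (n : ℝ) (cut T.R i)]
      exact_mod_cast le_of_mul_le_mul_right h4 hcp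
    · rw [div_le_iff₀ hcp]
      have hnC : (n : ℝ) = 16 * (C : ℝ) ^ 2 := by rw [hn]; push_cast; ring
      rw [hnC] at h1
      calc V ≤ 4 * C ^ 2 * Real.log (1 / ε) * 1 := by linarith
        _ ≤ 4 * C ^ 2 * Real.log (1 / ε) * (cut T.R i * (16 * (C : ℝ) ^ 2)) := by gcongr
        _ = _ := by ring
  have h := Pattern.sum_le_sum_cells hT.index_le
    (fun j => if (T.cell j).isBand ∧ 1 / 4 < (T.cell j).reach T.R * z then T.mult j else 0)
  rw [← Finset.sum_filter] at h
  have hz1 : ∑ j with T.cell j = .zero,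
      (if (T.cell j).isBand ∧ 1 / 4 < (T.cell j).reach T.R * z then T.mult j else 0) = 0 := by
    refine Finset.sum_eq_zero fun j hj => if_neg ?_
    rw [(Finset.mem_filter.1 hj).2]
    simp [Cell.isBand]
  have hz2 : ∑ j with T.cell j = .one,
      (if (T.cell j).isBand ∧ 1 / 4 < (T.cell j).reach T.R * z then T.mult j else 0) = 0 := by
    refine Finset.sum_eq_zero fun j hj => if_neg ?_
    rw [(Finset.mem_filter.1 hj).2]
    simp [Cell.isBand]
  rw [hz1, hz2, Finset.sum_range_succ] at h
  have hle : ∀ c : Cell, ∑ j with T.cell j = c,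
      (if (T.cell j).isBand ∧ 1 / 4 < (T.cell j).reach T.R * z then T.mult j else 0) ≤ T.countIn c :=
    fun c => Finset.sum_le_sum fun j _ => by split_ifs <;> omega
  have hl := (hle (.lower (T.L + 1))).trans (hT.last_le_one _ (Or.inl rfl))
  have hu := (hle (.upper (T.L + 1))).trans (hT.last_le_one _ (Or.inr rfl))
  have hband : ∀ i ≤ T.L, ∀ c : Cell, (c = .lower i ∨ c = .upper i) → ((∑ j with T.cell j = c,
      (if (T.cell j).isBand ∧ 1 / 4 < (T.cell j).reach T.R * z then T.mult j else 0) : ℕ) : ℝ) ≤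
      if i ≤ n then 64 * C ^ 5 * Real.log (1 / ε) else 0 := by
    intro i hi c hc
    by_cases hb : 1 / 4 < bandHi T.R i * z
    · obtain ⟨h2, h3⟩ := hcut i hi hb
      rw [if_pos h2]
      calc _ ≤ (T.countIn c : ℝ) := by exact_mod_cast hle c
        _ ≤ C * (V / cut T.R i) := hT.count_le i hi c hc
        _ ≤ C * (64 * C ^ 4 * Real.log (1 / ε)) := by gcongr
        _ = _ := by ring
    · rw [Finset.sum_eq_zero]
      · split_ifs
        · rw [Nat.cast_zero]
          positivity
        · rw [Nat.cast_zero]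
      · intro j hj
        refine if_neg fun hh => hb ?_
        rw [(Finset.mem_filter.1 hj).2] at hh
        rcases hc with rfl | rfl <;> exact hh.2
  have hs : ((∑ i ∈ Finset.range (T.L + 1), ((∑ j with T.cell j = .lower i,
      (if (T.cell j).isBand ∧ 1 / 4 < (T.cell j).reach T.R * z then T.mult j else 0)) +
      ∑ j with T.cell j = .upper i,
      (if (T.cell j).isBand ∧ 1 / 4 < (T.cell j).reach T.R * z then T.mult j else 0)) : ℕ) : ℝ) ≤
      (n + 1) * (128 * C ^ 5 * Real.log (1 / ε)) := by
    rw [Nat.cast_sum]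
    calc _ ≤ ∑ i ∈ Finset.range (T.L + 1),
          if i ≤ n then 128 * C ^ 5 * Real.log (1 / ε) else 0 := by
          refine Finset.sum_le_sum fun i hi => ?_
          have hi : i ≤ T.L := by simpa [Nat.lt_succ_iff] using hi
          have e1 := hband i hi _ (Or.inl rfl)
          have e2 := hband i hi _ (Or.inr rfl)
          rw [Nat.cast_add]
          split_ifs at e1 e2 ⊢ <;> linarith
      _ = ∑ i ∈ (Finset.range (T.L + 1)).filter (· ≤ n), 128 * C ^ 5 * Real.log (1 / ε) := by
          rw [Finset.sum_filter]
      _ ≤ ∑ i ∈ Finset.range (n + 1), 128 * C ^ 5 * Real.log (1 / ε) := by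
          refine Finset.sum_le_sum_of_subset_of_nonneg ?_ fun _ _ _ => by positivity
          intro i hi
          exact Finset.mem_range.2 (Nat.lt_succ_of_le (Finset.mem_filter.1 hi).2)
      _ = _ := by simp
  have h' := (Nat.cast_le (α := ℝ)).2 (h.trans (Nat.add_le_add_left (Nat.add_le_add_left
    (Nat.add_le_add hl hu) _) _))
  rw [Nat.cast_add, Nat.cast_add, Nat.cast_add _ (1 + 1)] at h'
  push_cast at h' hs ⊢
  -- The final constant is 17C² indices times 128C⁵, that is 2176C⁷.
  have hnC : (n : ℝ) + 1 ≤ 17 * (C : ℝ) ^ 2 := by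
    rw [hn]
    push_cast
    nlinarith
  have hfin : ((n : ℝ) + 1) * (128 * C ^ 5 * Real.log (1 / ε)) ≤ 2176 * C ^ 7 * Real.log (1 / ε) := by
    calc _ ≤ 17 * (C : ℝ) ^ 2 * (128 * C ^ 5 * Real.log (1 / ε)) := by gcongr
      _ = _ := by ring
  linarith

end Pattern.Admissible

end PatternBounds

/-! ### Dyadic rounding. -/

section Rounding

/-- Largest multiple of `2 ^ (-N)` below `x`. -/
def roundDown (N : ℕ) (x : ℝ) : ℝ := ⌊x * 2 ^ N⌋ / 2 ^ N

/-- Smallest multiple of `2 ^ (-N)` above `x`. -/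
def roundUp (N : ℕ) (x : ℝ) : ℝ := ⌈x * 2 ^ N⌉ / 2 ^ N

/-- Coordinatewise rounding of a complex number. -/
def roundComplex (N : ℕ) (z : ℂ) : ℂ := ⟨roundDown N z.re, roundDown N z.im⟩

theorem isDyadic_roundDown (N : ℕ) (x : ℝ) : IsDyadic N (roundDown N x) := ⟨_, rfl⟩

theorem isDyadic_roundUp (N : ℕ) (x : ℝ) : IsDyadic N (roundUp N x) := ⟨_, rfl⟩

theorem roundDown_le (N : ℕ) (x : ℝ) : roundDown N x ≤ x := by
  rw [roundDown, div_le_iff₀ (by positivity)]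
  exact Int.floor_le _

theorem le_roundUp (N : ℕ) (x : ℝ) : x ≤ roundUp N x := by
  rw [roundUp, le_div_iff₀ (by positivity)]
  exact Int.le_ceil _

theorem sub_le_roundDown (N : ℕ) (x : ℝ) : x - (1 / 2) ^ N ≤ roundDown N x := by
  rw [roundDown, le_div_iff₀ (by positivity), sub_mul, ← mul_pow]
  norm_num
  linarith [Int.lt_floor_add_one (x * 2 ^ N)]

theorem roundUp_le_add (N : ℕ) (x : ℝ) : roundUp N x ≤ x + (1 / 2) ^ N := by
  rw [roundUp, div_le_iff₀ (by positivity), add_mul, ← mul_pow]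
  norm_num
  linarith [Int.ceil_lt_add_one (x * 2 ^ N)]

theorem roundDown_nonneg (N : ℕ) {x : ℝ} (hx : 0 ≤ x) : 0 ≤ roundDown N x :=
  div_nonneg (by exact_mod_cast Int.floor_nonneg.2 (by positivity)) (by positivity)

theorem roundUp_le_one (N : ℕ) {x : ℝ} (hx : x ≤ 1) : roundUp N x ≤ 1 := by
  rw [roundUp, div_le_one (by positivity)]
  have : ⌈x * 2 ^ N⌉ ≤ (2 ^ N : ℤ) := Int.ceil_le.2 (by
    push_cast
    exact mul_le_of_le_one_left (by positivity) hx)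
  exact_mod_cast this

theorem abs_roundDown_sub_le (N : ℕ) (x : ℝ) : |roundDown N x - x| ≤ (1 / 2) ^ N :=
  abs_le.2 ⟨by linarith [sub_le_roundDown N x], by
    linarith [roundDown_le N x, pow_nonneg (by norm_num : (0 : ℝ) ≤ 1 / 2) N]⟩

/-- One extra binary place absorbs the sum of the two coordinate errors. -/
theorem norm_roundComplex_sub_le (D : ℕ) (z : ℂ) : ‖roundComplex (D + 1) z - z‖ ≤ (1 / 2) ^ D := by
  refine (Complex.norm_le_abs_re_add_abs_im _).trans ?_
  have h1 := abs_roundDown_sub_le (D + 1) z.re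
  have h2 := abs_roundDown_sub_le (D + 1) z.im
  simp only [roundComplex, Complex.sub_re, Complex.sub_im]
  rw [pow_succ] at h1 h2
  linarith

/-- With `roundUp_zero`: outward rounding does not move the ends of [0,1], so parameters in the
point cells stay exactly 0 or 1, whatever their multiplicity. -/
theorem roundDown_one (N : ℕ) : roundDown N 1 = 1 := by
  have : ⌊(2 : ℝ) ^ N⌋ = (2 : ℤ) ^ N := by
    rw [show (2 : ℝ) ^ N = ((2 ^ N : ℤ) : ℝ) by push_cast; rfl, Int.floor_intCast]
  rw [roundDown, one_mul, this]
  push_cast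
  exact div_self (by positivity)

theorem roundUp_zero (N : ℕ) : roundUp N 0 = 0 := by simp [roundUp]

end Rounding

/-! ### The approximation applied to a pattern. -/

section Core

variable {k : ℕ}

namespace Pattern

/-- Is the `j`-th parameter measured from `1`? -/
def upper (T : Pattern k) (j : Fin k) : Bool := (T.cell j).isUpper

/-- Nonconstant parameters whose Fourier factor stays away from `0` at angles up to `z`. -/
def smallSet (T : Pattern k) (z : ℝ) : Finset (Fin k) :=
  Finset.univ.filter fun j => (T.cell j).isBand ∧ ¬ 1 / 4 < (T.cell j).reach T.R * z

/-- The other nonconstant parameters. -/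
def bigSet (T : Pattern k) (z : ℝ) : Finset (Fin k) :=
  Finset.univ.filter fun j => (T.cell j).isBand ∧ 1 / 4 < (T.cell j).reach T.R * z

/-- Number of parameters near or equal to `1`. -/
def upperCount (T : Pattern k) : ℕ := ∑ j with T.upper j, T.mult j

theorem disjoint_smallSet_bigSet (T : Pattern k) (z : ℝ) : Disjoint (T.smallSet z) (T.bigSet z) :=
  Finset.disjoint_filter.2 fun _ _ h1 h2 => h1.2 h2.2

theorem smallSet_union_bigSet (T : Pattern k) (z : ℝ) :
    T.smallSet z ∪ T.bigSet z = Finset.univ.filter fun j => (T.cell j).isBand = true := by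
  ext j
  simp only [smallSet, bigSet, Finset.mem_union, Finset.mem_filter, Finset.mem_univ, true_and]
  tauto

variable {T : Pattern k}

theorem mem_unitInterval (h0 : 0 < T.R) (h1 : T.R ≤ 1 / 4) {N : ℕ} {x : Fin k → ℝ}
    (hlo : ∀ j, roundDown N (T.a j) ≤ x j) (hhi : ∀ j, x j ≤ roundUp N (T.b j)) (j : Fin k) :
    0 ≤ x j ∧ x j ≤ 1 :=
  ⟨(roundDown_nonneg N (T.a_mem h0 h1 j).1).trans (hlo j),
    (hhi j).trans (roundUp_le_one N (T.b_mem h0 h1 j).2)⟩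

theorem measureFrom_nonneg {u : Bool} {x : ℝ} (h0 : 0 ≤ x) (h1 : x ≤ 1) : 0 ≤ measureFrom u x := by
  unfold measureFrom
  split_ifs <;> linarith

theorem measureFrom_le_one {u : Bool} {x : ℝ} (h0 : 0 ≤ x) (h1 : x ≤ 1) : measureFrom u x ≤ 1 := by
  unfold measureFrom
  split_ifs <;> linarith

theorem measureFrom_le_reach {N : ℕ} {x : Fin k → ℝ} (hlo : ∀ j, roundDown N (T.a j) ≤ x j)
    (hhi : ∀ j, x j ≤ roundUp N (T.b j)) (j : Fin k) :
    measureFrom (T.upper j) (x j) ≤ (T.cell j).reach T.R + (1 / 2) ^ N := by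
  have h1 := (sub_le_roundDown N _).trans (hlo j)
  have h2 := (hhi j).trans (roundUp_le_add N _)
  unfold Pattern.a at h1
  unfold Pattern.b at h2
  unfold measureFrom Pattern.upper
  cases h : T.cell j <;> simp [h, Cell.isUpper, Cell.reach, Cell.lo, Cell.hi] at h1 h2 ⊢ <;> linarith

/-- Parameters pinned to 0 or 1 have trivial factors after reorientation, so their possibly huge
multiplicities never enter the polynomials or the error bounds. -/
theorem measureFrom_eq_zero {N : ℕ} {x : Fin k → ℝ} (hlo : ∀ j, roundDown N (T.a j) ≤ x j)
    (hhi : ∀ j, x j ≤ roundUp N (T.b j)) (hx : ∀ j, 0 ≤ x j ∧ x j ≤ 1) (j : Fin k)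
    (hj : (T.cell j).isBand = false) : measureFrom (T.upper j) (x j) = 0 := by
  have h1 := hlo j
  have h2 := hhi j
  have h3 := hx j
  unfold Pattern.a at h1
  unfold Pattern.b at h2
  unfold measureFrom Pattern.upper
  cases h : T.cell j with
  | zero =>
    simp only [h, Cell.hi, roundUp_zero] at h2
    simp only [Cell.isUpper]
    exact le_antisymm h2 h3.1
  | one =>
    simp only [h, Cell.lo, roundDown_one] at h1
    simp only [Cell.isUpper, if_true]
    linarith
  | lower i => simp [h, Cell.isBand] at hj
  | upper i => simp [h, Cell.isBand] at hj

theorem sum_measureFrom_outside {E : Type*} [AddCommMonoid E] (z : ℝ) {x : Fin k → ℝ}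
    (hout : ∀ j, (T.cell j).isBand = false → measureFrom (T.upper j) (x j) = 0)
    (f : Fin k → E) (hf : ∀ j, measureFrom (T.upper j) (x j) = 0 → f j = 0) :
    ∑ j ∈ T.smallSet z ∪ T.bigSet z, f j = ∑ j, f j := by
  rw [smallSet_union_bigSet]
  refine Finset.sum_subset (Finset.subset_univ _) fun j _ hj => hf j (hout j ?_)
  simpa using hj

theorem reach_le (h0 : 0 < T.R) (h1 : T.R ≤ 1 / 4) (j : Fin k) : (T.cell j).reach T.R ≤ 1 / 2 := by
  cases T.cell j with
  | zero => norm_num [Cell.reach]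
  | one => norm_num [Cell.reach]
  | lower i => exact bandHi_le h0 h1 i
  | upper i => exact bandHi_le h0 h1 i

theorem reach_nonneg (h0 : 0 < T.R) (j : Fin k) : 0 ≤ (T.cell j).reach T.R := by
  cases T.cell j with
  | zero => norm_num [Cell.reach]
  | one => norm_num [Cell.reach]
  | lower i => exact bandHi_nonneg h0 i
  | upper i => exact bandHi_nonneg h0 i

/-- The mean in terms of the distances from the ends. -/
theorem sum_mult_mul_eq (T : Pattern k) (x : Fin k → ℝ) : ∑ j, T.mult j * x j =
    T.upperCount + ∑ j, orient (T.upper j) * (T.mult j * measureFrom (T.upper j) (x j)) := by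
  rw [upperCount, Finset.sum_filter, Nat.cast_sum, ← Finset.sum_add_distrib]
  refine Finset.sum_congr rfl fun j _ => ?_
  unfold orient measureFrom
  split_ifs <;> push_cast <;> ring

theorem prod_one_add_mul_eq (T : Pattern k) (x : Fin k → ℝ) (θ : ℝ) :
    ∏ j, (1 + (x j : ℂ) * (Complex.exp ((-θ : ℝ) * Complex.I) - 1)) ^ T.mult j =
      Complex.exp ((-(θ * T.upperCount) : ℝ) * Complex.I) *
        ∏ j, (1 + (measureFrom (T.upper j) (x j) : ℂ) *
          (Complex.exp ((-orient (T.upper j) * θ : ℝ) * Complex.I) - 1)) ^ T.mult j := by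
  simp_rw [fun j => one_add_mul_measureFrom (T.upper j) (x j) θ, mul_pow]
  rw [Finset.prod_mul_distrib]
  congr 1
  simp_rw [ite_pow, one_pow, Finset.prod_ite, Finset.prod_const_one, mul_one]
  rw [Finset.prod_pow_eq_pow_sum, ← Complex.exp_nat_mul, ← upperCount]
  congr 1
  push_cast
  ring

/-- Rounded Fourier angles. -/
def roundedFactor (D : ℕ) (θ : ℝ) (u : Bool) : ℂ :=
  roundComplex (D + 1) (Complex.exp ((-orient u * θ : ℝ) * Complex.I) - 1)

/-- The rotation by t and the one extracted from the upper parameters combine into an angle multiple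
of t - `upperCount`, which the constraint on the mean makes close to the signed sum of distances
from the ends. -/
theorem approx_fourier (h0 : 0 < T.R) (h1 : T.R ≤ 1 / 4) {D : ℕ} {x : Fin k → ℝ}
    (hlo : ∀ j, roundDown (D + 1) (T.a j) ≤ x j) (hhi : ∀ j, x j ≤ roundUp (D + 1) (T.b j))
    {z θ v Δ Γ : ℝ} {t : ℤ} (hz : |θ| ≤ z)
    (hvar : ∑ j ∈ T.smallSet z ∪ T.bigSet z, T.mult j * (x j * (1 - x j)) ≤ v)
    (hmean : |((t - T.upperCount : ℤ) : ℝ) - ∑ j ∈ T.smallSet z ∪ T.bigSet z,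
      orient (T.upper j) * (T.mult j * measureFrom (T.upper j) (x j))| ≤ Δ)
    (hη : (1 / 2 : ℝ) ^ D * (z + 2) ≤ 1 / 12)
    (hη1 : (3 * (∑ j ∈ T.smallSet z, T.mult j : ℕ) + (∑ j ∈ T.bigSet z, T.mult j : ℕ) + 1) *
      (1 / 2 : ℝ) ^ D ≤ 1 / 2)
    (hΓ : 1 + 3 * z ^ 2 * (4 * v) + z * Δ + z * (∑ j ∈ T.bigSet z, T.mult j : ℕ) ≤ Γ)
    (hD : 6 * Γ ≤ D) :
    ‖(∑ i ∈ Finset.range D, (∑ j ∈ T.smallSet z, T.mult j *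
        Complex.logTaylor (D + 1) (measureFrom (T.upper j) (x j) * roundedFactor D θ (T.upper j)) +
        roundDown (D + 1) (θ * (t - T.upperCount : ℤ)) * Complex.I) ^ i / i.factorial) *
        ∏ j ∈ T.bigSet z, (1 + measureFrom (T.upper j) (x j) * roundedFactor D θ (T.upper j)) ^
          T.mult j -
      Complex.exp ((θ * t : ℝ) * Complex.I) *
        ∏ j, (1 + (x j : ℂ) * (Complex.exp ((-θ : ℝ) * Complex.I) - 1)) ^ T.mult j‖ ≤
      (24 * (∑ j ∈ T.smallSet z, T.mult j : ℕ) + 2 * (∑ j ∈ T.bigSet z, T.mult j : ℕ) + 12) *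
        (1 / 2) ^ D := by
  have hx := mem_unitInterval h0 h1 hlo hhi
  have hr0 : ∀ j, 0 ≤ measureFrom (T.upper j) (x j) := fun j => measureFrom_nonneg (hx j).1 (hx j).2
  have hr1 : ∀ j, measureFrom (T.upper j) (x j) ≤ 1 := fun j => measureFrom_le_one (hx j).1 (hx j).2
  have hη0 : (0 : ℝ) < (1 / 2) ^ D := by positivity
  have hout := measureFrom_eq_zero hlo hhi hx
  have hz0 : 0 ≤ z := (abs_nonneg θ).trans hz
  have hreach : ∀ j, measureFrom (T.upper j) (x j) ≤ (T.cell j).reach T.R + (1 / 2) ^ D := fun j => by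
    refine (measureFrom_le_reach hlo hhi j).trans (add_le_add_right ?_ _)
    exact pow_le_pow_of_le_one (by norm_num) (by norm_num) (Nat.le_succ D)
  rw [sum_measureFrom_outside z hout _ fun j hj => by rw [hj]; ring] at hmean
  rw [sum_measureFrom_outside z hout _ fun j hj => by
    unfold measureFrom at hj
    split_ifs at hj <;> simp [hj]] at hvar
  -- Distances from the chosen end are at most 1/2 plus rounding, hence at most 3/4, so r ≤ 4r(1 -
  -- r): the first moment is controlled by the variance.
  have hS : ∑ j, T.mult j * measureFrom (T.upper j) (x j) ≤ 4 * v := by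
    refine le_trans ?_ (mul_le_mul_of_nonneg_left hvar (by norm_num : (0 : ℝ) ≤ 4))
    rw [Finset.mul_sum]
    refine Finset.sum_le_sum fun j _ => ?_
    have e : x j * (1 - x j) = measureFrom (T.upper j) (x j) * (1 - measureFrom (T.upper j) (x j)) := by
      unfold measureFrom
      split_ifs <;> ring
    have h3 : measureFrom (T.upper j) (x j) ≤ 3 / 4 := by
      have := reach_le h0 h1 j
      have := hreach j
      nlinarith
    rw [e]
    have h4 : measureFrom (T.upper j) (x j) ≤ 4 * (measureFrom (T.upper j) (x j) *
        (1 - measureFrom (T.upper j) (x j))) := by nlinarith [hr0 j]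
    have := mul_le_mul_of_nonneg_left h4 (Nat.cast_nonneg (T.mult j) : (0 : ℝ) ≤ T.mult j)
    linarith
  have hS0 : 0 ≤ 4 * v := le_trans (Finset.sum_nonneg fun j _ =>
    mul_nonneg (Nat.cast_nonneg _) (hr0 j)) hS
  have key := norm_approx_sub_le T.mult T.upper (fun j => measureFrom (T.upper j) (x j))
    (T.smallSet z) (T.bigSet z) (T.disjoint_smallSet_bigSet z) hr0 hr1 (fun j hs hb => hout j (by
      by_contra hne
      have : j ∈ T.smallSet z ∪ T.bigSet z := by
        rw [smallSet_union_bigSet]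
        simpa using hne
      rcases Finset.mem_union.1 this with h | h
      · exact hs h
      · exact hb h))
    (θ := θ) (η := (1 / 2) ^ D) (a := roundDown (D + 1) (θ * (t - T.upperCount : ℤ)))
    (τ := (t - T.upperCount : ℤ)) (Δ := Δ) (S := 4 * v) (Γ := Γ) (D := D) rfl
    (roundedFactor D θ) (fun j hj => ?_) (fun j => norm_roundComplex_sub_le _ _)
    ((abs_roundDown_sub_le _ _).trans (pow_le_pow_of_le_one (by norm_num) (by norm_num) (Nat.le_succ D)))
    hmean hS hη1 (le_trans ?_ hΓ) hD rfl
  · rw [prod_one_add_mul_eq, ← mul_assoc, ← Complex.exp_add]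
    convert key using 5
    push_cast
    ring
  -- Rounding of intervals and angles raises 1/4 by at most 1/12, which explains the threshold 1/3
  -- for the logarithms.
  · have hj' := not_lt.1 (Finset.mem_filter.1 hj).2.2
    have h3 := hreach j
    have h4 := reach_le h0 h1 j
    have h5 := reach_nonneg h0 j
    have hη2 : (1 / 2 : ℝ) ^ D ≤ 1 := pow_le_one₀ (by norm_num) (by norm_num)
    calc measureFrom (T.upper j) (x j) * (|θ| + (1 / 2) ^ D) ≤
          ((T.cell j).reach T.R + (1 / 2) ^ D) * (z + (1 / 2) ^ D) := by
          gcongr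
      _ = (T.cell j).reach T.R * z + ((T.cell j).reach T.R + z + (1 / 2) ^ D) * (1 / 2) ^ D := by ring
      _ ≤ 1 / 4 + (z + 2) * (1 / 2) ^ D :=
          add_le_add hj' (mul_le_mul_of_nonneg_right (by linarith) hη0.le)
      _ ≤ 1 / 3 := by linarith
  · have : θ ^ 2 ≤ z ^ 2 := by
      rw [← sq_abs θ]
      exact pow_le_pow_left₀ (abs_nonneg _) hz 2
    have hΔ : 0 ≤ Δ := (abs_nonneg _).trans hmean
    gcongr

end Pattern

end Core

/-! ### Quantitative consequences of compatibility with some distribution. -/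

section Sizes

/-- Number of bits and Taylor terms: a multiple of `log (1/ε)`. -/
def precision (A : ℕ) (ε : ℝ) : ℕ := A * ⌈2 * Real.log (1 / ε)⌉₊

theorem log_one_div_le {ε : ℝ} (h0 : 0 < ε) : Real.log (1 / ε) ≤ 1 / ε := by
  have := Real.log_le_sub_one_of_pos (show 0 < 1 / ε by positivity)
  linarith

theorem le_precision (A : ℕ) (ε : ℝ) : A * (2 * Real.log (1 / ε)) ≤ precision A ε := by
  rw [precision, Nat.cast_mul]
  exact mul_le_mul_of_nonneg_left (Nat.le_ceil _) (Nat.cast_nonneg A)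

theorem precision_le (A : ℕ) {ε : ℝ} (h0 : 0 < ε) (h1 : ε ≤ 1 / 2) :
    (precision A ε : ℝ) ≤ 4 * A * Real.log (1 / ε) := by
  have hL := log_one_div_ge h0 h1
  rw [precision, Nat.cast_mul]
  have := Nat.ceil_lt_add_one (show 0 ≤ 2 * Real.log (1 / ε) by linarith)
  have h2 : (⌈2 * Real.log (1 / ε)⌉₊ : ℝ) ≤ 4 * Real.log (1 / ε) := by linarith
  have := mul_le_mul_of_nonneg_left h2 (Nat.cast_nonneg A : (0 : ℝ) ≤ A)
  linarith

/-- Since 2 log 2 > 1, each unit of A pays for one factor 1/ε; a constant c costs c units because c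
≤ 2^c ≤ (1/ε)^c. -/
theorem mul_pow_le_two_pow_precision {ε : ℝ} (h0 : 0 < ε) (h1 : ε ≤ 1 / 2) {A : ℕ} (c n : ℕ)
    (hA : c + n ≤ A) : c * (1 / ε) ^ n ≤ 2 ^ precision A ε := by
  have hx : 2 ≤ 1 / ε := by rw [le_div_iff₀ h0]; linarith
  have h2 : 1 / ε ≤ 2 ^ ⌈2 * Real.log (1 / ε)⌉₊ := by
    have hL := log_one_div_ge h0 h1
    rw [← Real.log_le_log_iff (by positivity) (by positivity), Real.log_pow]
    have := Nat.le_ceil (2 * Real.log (1 / ε))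
    nlinarith [Real.log_two_gt_d9]
  calc (c : ℝ) * (1 / ε) ^ n ≤ (1 / ε) ^ c * (1 / ε) ^ n := by
        gcongr
        calc (c : ℝ) ≤ 2 ^ c := by exact_mod_cast Nat.lt_two_pow_self.le
          _ ≤ (1 / ε) ^ c := pow_le_pow_left₀ (by norm_num) hx c
    _ = (1 / ε) ^ (c + n) := (pow_add _ _ _).symm
    _ ≤ (1 / ε) ^ A := pow_le_pow_right₀ (by linarith) hA
    _ ≤ (2 ^ ⌈2 * Real.log (1 / ε)⌉₊) ^ A := pow_le_pow_left₀ (by positivity) h2 A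
    _ = _ := by rw [← pow_mul, mul_comm, precision]

/-- The input data of the system is consistent with the distribution `pbd p`. -/
structure Compatible (C : ℕ) (α β ε sd mean : ℝ) (M l : ℕ) (h : ℤ → ℂ) {k : ℕ} (T : Pattern k)
    {n : ℕ} (p : Fin n → I) : Prop where
  eps_pos : 0 < ε
  eps_le : ε ≤ 1 / 2
  beta_pos : 0 < β
  le_cutoff : β * Real.log (1 / ε) ≤ l
  cutoff_le : (l : ℝ) ≤ C * Real.log (1 / ε)
  var_le : distVar (pbd p) ≤ (1 / ε) ^ C
  le_sd : √(distVar (pbd p)) / 2 ≤ sd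
  sd_le : sd ≤ 2 * √(distVar (pbd p)) + 1
  mean_near : |distMean (pbd p) - mean| ≤ sd
  le_modulus : 150 * (Real.log (1 / ε) + √(distVar (pbd p) * Real.log (1 / ε))) ≤ M
  modulus_le : (M : ℝ) ≤ α * (Real.log (1 / ε) + √(distVar (pbd p) * Real.log (1 / ε)))
  fourier_near : ∑ ξ ∈ Finset.Icc (-(l : ℤ)) l, ‖h ξ - dft M (pbd p) ξ‖ ^ 2 < ε ^ 2 / 16
  admissible : T.Admissible C ε (distMean (pbd p)) (distVar (pbd p))

/-- The largest Fourier angle in use. -/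
def maxAngle (M l : ℕ) : ℝ := 2 * Real.pi * l / M

/-- The `n`-th frequency. -/
def freq (l : ℕ) (n : Fin (2 * l + 1)) : ℤ := n - l

/-- The `n`-th Fourier angle. -/
def angle (M l : ℕ) (n : Fin (2 * l + 1)) : ℝ := 2 * Real.pi * freq l n / M

theorem freq_natAbs_le (l : ℕ) (n : Fin (2 * l + 1)) : |((freq l n : ℤ) : ℝ)| ≤ l := by
  have h1 : |freq l n| ≤ (l : ℤ) := by
    have := n.2
    unfold freq
    rw [abs_le]
    omega
  exact_mod_cast h1

theorem abs_angle_le (M l : ℕ) (n : Fin (2 * l + 1)) : |angle M l n| ≤ maxAngle M l := by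
  rw [angle, maxAngle, abs_div, abs_mul, Nat.abs_cast, abs_of_pos (by positivity : 0 < 2 * Real.pi)]
  have := freq_natAbs_le l n
  gcongr

theorem sum_freq (l : ℕ) (f : ℤ → ℝ) :
    ∑ n, f (freq l n) = ∑ ξ ∈ Finset.Icc (-(l : ℤ)) l, f ξ := by
  refine Finset.sum_bij (fun n _ => freq l n) (fun n _ => ?_) (fun a _ b _ hab => ?_)
    (fun ξ hξ => ?_) (fun _ _ => rfl)
  · have := n.2
    simp only [freq, Finset.mem_Icc]
    omega
  · have hab : (a : ℤ) - l = b - l := hab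
    exact Fin.ext (by omega)
  · rw [Finset.mem_Icc] at hξ
    refine ⟨⟨(ξ + l).toNat, by omega⟩, Finset.mem_univ _, ?_⟩
    simp only [freq]
    omega

theorem norm_dft_pbd_le_one {ι : Type*} [Fintype ι] (M : ℕ) (p : ι → I) (ξ : ℤ) :
    ‖dft M (pbd p) ξ‖ ≤ 1 := by
  rw [dft_pbd, norm_prod]
  exact Finset.prod_le_one (fun _ _ => norm_nonneg _) fun i _ =>
    norm_one_add_mul_exp_sub_one_le (p i).2.1 (p i).2.2 _

namespace Compatible

variable {C : ℕ} {α β ε sd mean : ℝ} {M l : ℕ} {h : ℤ → ℂ} {k : ℕ} {T : Pattern k} {n : ℕ}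
  {p : Fin n → I}

theorem log_ge (H : Compatible C α β ε sd mean M l h T p) : 0.69 ≤ Real.log (1 / ε) :=
  log_one_div_ge H.eps_pos H.eps_le

theorem one_le_C (H : Compatible C α β ε sd mean M l h T p) : 1 ≤ C := by
  by_contra hC
  have hC : C = 0 := by omega
  have h1 := H.cutoff_le
  have h2 := H.le_cutoff
  rw [hC, Nat.cast_zero, zero_mul] at h1
  nlinarith [mul_pos H.beta_pos (by linarith [H.log_ge] : 0 < Real.log (1 / ε))]

theorem var_nonneg (_ : Compatible C α β ε sd mean M l h T p) : 0 ≤ distVar (pbd p) :=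
  variance_nonneg _ _

/-- With L = log(1/ε), dividing 2πl = O(CL) by M ≥ 150(L + √(VL)) gives z(L + √(VL)) ≤ CL. The first
summand yields z ≤ C, the second z²V ≤ C²L. -/
theorem maxAngle_bounds (H : Compatible C α β ε sd mean M l h T p) :
    0 ≤ maxAngle M l ∧ maxAngle M l ≤ C ∧
      maxAngle M l ^ 2 * distVar (pbd p) ≤ C ^ 2 * Real.log (1 / ε) := by
  have hL := H.log_ge
  have hV := H.var_nonneg
  have hM := H.le_modulus
  have hl := H.cutoff_le
  set L := Real.log (1 / ε)
  set V := distVar (pbd p)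
  set Y := √(V * L) with hY
  have hY0 : 0 ≤ Y := Real.sqrt_nonneg _
  have hY2 : Y ^ 2 = V * L := Real.sq_sqrt (by nlinarith)
  have hM0 : (0 : ℝ) < M := by linarith
  have hz0 : 0 ≤ maxAngle M l := by unfold maxAngle; positivity
  have hzX : maxAngle M l * (L + Y) ≤ C * L := by
    have h1 : maxAngle M l * M = 2 * Real.pi * l := by
      unfold maxAngle
      field_simp
    have h2 : 2 * Real.pi * (l : ℝ) ≤ 8 * (C * L) := by
      have := Real.pi_le_four
      have : (0 : ℝ) ≤ l := Nat.cast_nonneg l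
      nlinarith [Real.pi_pos]
    have h3 := mul_le_mul_of_nonneg_left hM hz0
    have h4 : 0 ≤ (C : ℝ) * L := by positivity
    nlinarith
  refine ⟨hz0, ?_, ?_⟩
  · have h1 : maxAngle M l * L ≤ C * L := by nlinarith
    exact le_of_mul_le_mul_right h1 (by linarith)
  · have h1 : (maxAngle M l * Y) ^ 2 ≤ (C * L) ^ 2 :=
      pow_le_pow_left₀ (by positivity) (by nlinarith) 2
    rw [mul_pow, hY2] at h1
    have h2 : maxAngle M l ^ 2 * V * L ≤ C ^ 2 * L * L := by nlinarith
    exact le_of_mul_le_mul_right h2 (by linarith)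

theorem one_le_inv (H : Compatible C α β ε sd mean M l h T p) : 2 ≤ 1 / ε := by
  rw [le_div_iff₀ H.eps_pos]
  linarith [H.eps_le]

theorem sqrt_var_le (H : Compatible C α β ε sd mean M l h T p) :
    √(distVar (pbd p)) ≤ (1 / ε) ^ C := by
  have h1 : (1 : ℝ) ≤ (1 / ε) ^ C := one_le_pow₀ (by linarith [H.one_le_inv])
  exact Real.sqrt_le_iff.2 ⟨by linarith, by nlinarith [H.var_le]⟩

theorem sd_nonneg (H : Compatible C α β ε sd mean M l h T p) : 0 ≤ sd :=
  le_trans (by positivity) H.le_sd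

theorem sd_le_pow (H : Compatible C α β ε sd mean M l h T p) : sd ≤ 3 * (1 / ε) ^ C := by
  have h1 : (1 : ℝ) ≤ (1 / ε) ^ C := one_le_pow₀ (by linarith [H.one_le_inv])
  linarith [H.sqrt_var_le, H.sd_le]

theorem four_mul_sd_sq_le (H : Compatible C α β ε sd mean M l h T p) :
    4 * sd ^ 2 ≤ 32 * distVar (pbd p) + 8 := by
  have h1 := pow_le_pow_left₀ H.sd_nonneg H.sd_le 2
  have h2 := Real.sq_sqrt H.var_nonneg
  nlinarith [sq_nonneg (2 * √(distVar (pbd p)) - 1)]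

theorem card_le' (H : Compatible C α β ε sd mean M l h T p) :
    (k : ℝ) ≤ 10 * C * Real.log (1 / ε) := by
  have h1 := H.admissible.card_le (by linarith [H.log_ge])
  have hC : (1 : ℝ) ≤ C := by exact_mod_cast H.one_le_C
  nlinarith [H.log_ge]

theorem sum_mult_le (H : Compatible C α β ε sd mean M l h T p) :
    ((∑ j with (T.cell j).isBand = true, T.mult j : ℕ) : ℝ) ≤
      (20 * C ^ 2 : ℕ) * (1 / ε) ^ (2 * C + 1) := by
  have hx := H.one_le_inv
  have hC : (1 : ℝ) ≤ C := by exact_mod_cast H.one_le_C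
  have hk : (k : ℝ) ≤ 10 * C * (1 / ε) :=
    H.card_le'.trans (mul_le_mul_of_nonneg_left (log_one_div_le H.eps_pos) (by positivity))
  rw [Nat.cast_sum]
  calc _ ≤ ∑ j with (T.cell j).isBand = true, ((C : ℝ) + 1) * (1 / ε) ^ (2 * C) :=
        Finset.sum_le_sum fun j hj => H.admissible.mult_le H.eps_pos H.eps_le H.var_le j
          (Finset.mem_filter.1 hj).2
    _ ≤ ∑ j : Fin k, ((C : ℝ) + 1) * (1 / ε) ^ (2 * C) :=
        Finset.sum_le_sum_of_subset_of_nonneg (Finset.subset_univ _) fun _ _ _ => by positivity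
    _ = k * ((C + 1) * (1 / ε) ^ (2 * C)) := by simp
    _ ≤ (10 * C * (1 / ε)) * ((2 * C) * (1 / ε) ^ (2 * C)) := by
        gcongr
        linarith
    _ = _ := by push_cast; ring

theorem sum_big_le (H : Compatible C α β ε sd mean M l h T p) :
    ((∑ j ∈ T.bigSet (maxAngle M l), T.mult j : ℕ) : ℝ) ≤ 2180 * C ^ 7 * Real.log (1 / ε) := by
  obtain ⟨h1, h2, h3⟩ := H.maxAngle_bounds
  have hL := H.log_ge
  have h4 := H.admissible.sum_mult_big_le (by linarith) H.var_nonneg h1 h2 h3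
  have hC : (1 : ℝ) ≤ (C : ℝ) ^ 7 := one_le_pow₀ (by exact_mod_cast H.one_le_C)
  unfold Pattern.bigSet
  nlinarith

/-- Neither term need be polynomial in 1/ε, but the difference is: the upper parameters are those
equal to 1, whose number is near the mean by `ones_near`, plus polynomially many in bands. -/
theorem abs_shift_le (H : Compatible C α β ε sd mean M l h T p) :
    |((⌊mean⌋ - T.upperCount : ℤ) : ℝ)| ≤ (30 * C ^ 2 : ℕ) * (1 / ε) ^ (2 * C + 1) := by
  have hx := H.one_le_inv
  have hC : (1 : ℝ) ≤ (C : ℝ) ^ 2 := one_le_pow₀ (by exact_mod_cast H.one_le_C)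
  have hB := H.sum_mult_le
  have h1 : T.countIn .one ≤ T.upperCount := by
    unfold Pattern.countIn Pattern.upperCount
    refine Finset.sum_le_sum_of_subset fun j hj => ?_
    have := (Finset.mem_filter.1 hj).2
    exact Finset.mem_filter.2 ⟨Finset.mem_univ j, by rw [Pattern.upper, this]; rfl⟩
  have h2 : T.upperCount ≤ T.countIn .one + ∑ j with (T.cell j).isBand = true, T.mult j := by
    unfold Pattern.countIn Pattern.upperCount
    rw [Finset.sum_filter, Finset.sum_filter, Finset.sum_filter, ← Finset.sum_add_distrib]
    refine Finset.sum_le_sum fun j _ => ?_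
    unfold Pattern.upper
    cases T.cell j <;> simp [Cell.isUpper, Cell.isBand]
  have h1' : (T.countIn .one : ℝ) ≤ T.upperCount := by exact_mod_cast h1
  have h2' : (T.upperCount : ℝ) ≤ T.countIn .one +
      ((∑ j with (T.cell j).isBand = true, T.mult j : ℕ) : ℝ) := by exact_mod_cast h2
  have h3 := abs_le.1 H.admissible.ones_near
  have h4 := abs_le.1 H.mean_near
  have h5 := Int.floor_le mean
  have h6 := Int.lt_floor_add_one mean
  have h7 := H.sd_le_pow
  have hp1 : (1 : ℝ) ≤ (1 / ε) ^ (2 * C + 1) := one_le_pow₀ (by linarith)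
  have hp2 : (1 / ε) ^ C ≤ (1 / ε) ^ (2 * C + 1) := pow_le_pow_right₀ (by linarith) (by omega)
  generalize (∑ j with (T.cell j).isBand = true, T.mult j) = N at hB h2'
  push_cast at hB ⊢
  have h8 : (1 / ε) ^ (2 * C + 1) ≤ C ^ 2 * (1 / ε) ^ (2 * C + 1) :=
    le_mul_of_one_le_left (by linarith) hC
  exact abs_le.2 ⟨by linarith, by linarith⟩

end Compatible

end Sizes

/-! ### Choice of the constants of the system and the total truncation error. -/

section Assembly

/-- Working precision of the system, in bits. -/
def digits (C : ℕ) (ε : ℝ) : ℕ := precision (100000 * C ^ 8) ε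

/-- Lower bound that the system imposes on the variance. -/
def minVar (sd : ℝ) : ℤ := ⌊(max 0 (sd - 1)) ^ 2 / 8⌋

/-- Upper bound that the system imposes on the variance. -/
def maxVar (sd : ℝ) : ℤ := ⌈4 * sd ^ 2⌉

/-- Admitted distance from the guess of the mean. -/
def meanSlack (sd : ℝ) : ℤ := ⌈sd⌉ + 1

/-- Rotated and rounded value of the given Fourier transform. -/
def target (D : ℕ) (mean : ℝ) (M l : ℕ) (h : ℤ → ℂ) (n : Fin (2 * l + 1)) : ℂ :=
  roundComplex (D + 1)
    (h (freq l n) * Complex.exp ((angle M l n * ⌊mean⌋ : ℝ) * Complex.I))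

/-- Truncated expression for the rotated Fourier transform at the angle `θ`. -/
def Pattern.truncatedDft {k : ℕ} (T : Pattern k) (D : ℕ) (z θ : ℝ) (t : ℤ) (x : Fin k → ℝ) : ℂ :=
  (∑ i ∈ Finset.range D, (∑ j ∈ T.smallSet z, T.mult j *
        Complex.logTaylor (D + 1) (measureFrom (T.upper j) (x j) * roundedFactor D θ (T.upper j)) +
        roundDown (D + 1) (θ * (t - T.upperCount : ℤ)) * Complex.I) ^ i / i.factorial) *
        ∏ j ∈ T.bigSet z, (1 + measureFrom (T.upper j) (x j) * roundedFactor D θ (T.upper j)) ^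
          T.mult j

/-- Solutions of the system built from the data. -/
def Pattern.Feasible {k : ℕ} (T : Pattern k) (D : ℕ) (ε sd mean : ℝ) (M l : ℕ) (h : ℤ → ℂ)
    (x : Fin k → ℝ) : Prop :=
  FourierFeasible (l := l) T.mult T.upper (T.smallSet (maxAngle M l)) (T.bigSet (maxAngle M l)) D
    (fun j => roundDown (D + 1) (T.a j)) (fun j => roundUp (D + 1) (T.b j)) (minVar sd) (maxVar sd)
    (⌊mean⌋ - T.upperCount) (meanSlack sd) (roundDown (D + 1) (0.09 * ε ^ 2))
    (fun n => Pattern.roundedFactor D (angle M l n))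
    (fun n => roundDown (D + 1) (angle M l n * (⌊mean⌋ - T.upperCount : ℤ)))
    (target D mean M l h) x

/-- The truncation at 0 matters: for sd < 1 the square of sd - 1 need not be below 4V. -/
theorem max_zero_sub_one_sq_le {sd V : ℝ} (h0 : 0 ≤ V) (h : sd ≤ 2 * √V + 1) :
    (max 0 (sd - 1)) ^ 2 ≤ 4 * V := by
  have h1 : max 0 (sd - 1) ≤ 2 * √V := max_le (by positivity) (by linarith)
  have h2 := pow_le_pow_left₀ (le_max_left 0 (sd - 1)) h1 2
  rw [mul_pow, Real.sq_sqrt h0] at h2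
  linarith

theorem minVar_nonneg (sd : ℝ) : 0 ≤ minVar sd := Int.floor_nonneg.2 (by positivity)

theorem norm_exp_mul_I_sub_one_le_two (x : ℝ) : ‖Complex.exp (x * Complex.I) - 1‖ ≤ 2 := by
  refine (norm_sub_le _ _).trans ?_
  rw [Complex.norm_exp_ofReal_mul_I, norm_one]
  norm_num

theorem norm_roundedFactor_le (D : ℕ) (θ : ℝ) (u : Bool) : ‖Pattern.roundedFactor D θ u‖ ≤ 4 := by
  have h1 := norm_roundComplex_sub_le D (Complex.exp ((-orient u * θ : ℝ) * Complex.I) - 1)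
  have h2 := norm_exp_mul_I_sub_one_le_two (-orient u * θ)
  have h3 : (1 / 2 : ℝ) ^ D ≤ 1 := pow_le_one₀ (by norm_num) (by norm_num)
  have h4 := norm_le_norm_add_norm_sub' (roundComplex (D + 1)
    (Complex.exp ((-orient u * θ : ℝ) * Complex.I) - 1))
    (Complex.exp ((-orient u * θ : ℝ) * Complex.I) - 1)
  unfold Pattern.roundedFactor
  linarith

theorem le_digits (C : ℕ) (ε : ℝ) :
    200000 * (C : ℝ) ^ 8 * Real.log (1 / ε) ≤ digits C ε := by
  have := le_precision (100000 * C ^ 8) ε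
  push_cast at this
  unfold digits
  linarith

namespace Compatible

variable {C : ℕ} {α β ε sd mean : ℝ} {M l : ℕ} {h : ℤ → ℂ} {k : ℕ} {T : Pattern k} {n : ℕ}
  {p : Fin n → I}

theorem pow_le_C_pow (H : Compatible C α β ε sd mean M l h T p) {i : ℕ} (hi : i ≤ 8) :
    C ^ i ≤ C ^ 8 := Nat.pow_le_pow_right H.one_le_C hi

theorem mul_pow_le (H : Compatible C α β ε sd mean M l h T p) (c n : ℕ)
    (hc : c + n ≤ 100000 * C ^ 8) : c * (1 / ε) ^ n ≤ 2 ^ digits C ε :=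
  mul_pow_le_two_pow_precision H.eps_pos H.eps_le c n hc

theorem mul_half_pow_le (H : Compatible C α β ε sd mean M l h T p) (c n : ℕ)
    (hc : c + n ≤ 100000 * C ^ 8) : c * (1 / 2) ^ digits C ε ≤ ε ^ n := by
  have h1 := H.mul_pow_le c n hc
  rw [one_div_pow, mul_one_div, div_le_iff₀ (pow_pos H.eps_pos n)] at h1
  rw [one_div_pow, mul_one_div, div_le_iff₀ (by positivity)]
  linarith

theorem one_le_C_pow (H : Compatible C α β ε sd mean M l h T p) (i : ℕ) : (1 : ℝ) ≤ (C : ℝ) ^ i :=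
  one_le_pow₀ (by exact_mod_cast H.one_le_C)

theorem cast_pow_le (H : Compatible C α β ε sd mean M l h T p) {i : ℕ} (hi : i ≤ 8) :
    (C : ℝ) ^ i ≤ (C : ℝ) ^ 8 := by
  exact_mod_cast H.pow_le_C_pow hi

theorem cutoff_le_digits (H : Compatible C α β ε sd mean M l h T p) : 2 * l + 1 ≤ digits C ε := by
  have h1 := le_digits C ε
  have h2 := H.cutoff_le
  have h3 := H.log_ge
  have h4 := H.cast_pow_le (i := 1) (by norm_num)
  have h5 := H.one_le_C_pow 8
  have h6 : (C : ℝ) * Real.log (1 / ε) ≤ (C : ℝ) ^ 8 * Real.log (1 / ε) := by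
    rw [pow_one] at h4
    exact mul_le_mul_of_nonneg_right h4 (by linarith)
  have h7 : 0.69 ≤ (C : ℝ) ^ 8 * Real.log (1 / ε) := by nlinarith
  have : (2 * l + 1 : ℝ) ≤ digits C ε := by linarith
  exact_mod_cast this

theorem sum_big_le_digits (H : Compatible C α β ε sd mean M l h T p) :
    ∑ j ∈ T.bigSet (maxAngle M l), T.mult j ≤ digits C ε := by
  have h1 := le_digits C ε
  have h2 := H.sum_big_le
  have h3 := H.log_ge
  have h4 := H.cast_pow_le (i := 7) (by norm_num)
  have h6 := mul_le_mul_of_nonneg_right h4 (by linarith : 0 ≤ Real.log (1 / ε))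
  have h7 : 0 ≤ (C : ℝ) ^ 8 * Real.log (1 / ε) := by positivity
  have : ((∑ j ∈ T.bigSet (maxAngle M l), T.mult j : ℕ) : ℝ) ≤ digits C ε := by linarith
  exact_mod_cast this

theorem one_le_inv_pow (H : Compatible C α β ε sd mean M l h T p) (i : ℕ) :
    (1 : ℝ) ≤ (1 / ε) ^ i := one_le_pow₀ (by linarith [H.one_le_inv])

theorem maxVar_le (H : Compatible C α β ε sd mean M l h T p) :
    (maxVar sd : ℝ) ≤ 32 * distVar (pbd p) + 9 := by
  have h1 := (Int.ceil_lt_add_one (4 * sd ^ 2)).le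
  have h2 := H.four_mul_sd_sq_le
  unfold maxVar
  linarith

theorem meanSlack_le (H : Compatible C α β ε sd mean M l h T p) :
    (meanSlack sd : ℝ) ≤ 2 * √(distVar (pbd p)) + 3 := by
  have h1 := (Int.ceil_lt_add_one sd).le
  have h2 := H.sd_le
  unfold meanSlack
  push_cast
  linarith

theorem minVar_le (H : Compatible C α β ε sd mean M l h T p) :
    (minVar sd : ℝ) ≤ distVar (pbd p) / 2 := by
  have h1 := Int.floor_le ((max 0 (sd - 1)) ^ 2 / 8)
  have h2 := max_zero_sub_one_sq_le H.var_nonneg H.sd_le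
  unfold minVar
  linarith

/-- As √V ≥ 4, sd - 1 ≥ √V/4, whose square over 8 is V/128; the 1 lost to the floor costs at most
another factor 2. -/
theorem le_minVar (H : Compatible C α β ε sd mean M l h T p)
    (hV : 1000 * Real.log (1 / ε) ≤ distVar (pbd p)) : distVar (pbd p) / 256 ≤ minVar sd := by
  have h1 := (Int.lt_floor_add_one ((max 0 (sd - 1)) ^ 2 / 8)).le
  have h2 := Real.sq_sqrt H.var_nonneg
  have h3 := H.le_sd
  have h4 := H.log_ge
  have h5 : 4 ≤ √(distVar (pbd p)) := Real.le_sqrt_of_sq_le (by linarith)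
  have h6 : √(distVar (pbd p)) / 4 ≤ max 0 (sd - 1) := le_max_of_le_right (by linarith)
  have h7 := pow_le_pow_left₀ (by positivity) h6 2
  unfold minVar
  nlinarith

theorem norm_given_le (H : Compatible C α β ε sd mean M l h T p) {ξ : ℤ}
    (hξ : ξ ∈ Finset.Icc (-(l : ℤ)) l) : ‖h ξ‖ ≤ 2 := by
  have h1 := (Finset.single_le_sum (f := fun ξ => ‖h ξ - dft M (pbd p) ξ‖ ^ 2)
    (fun _ _ => by positivity) hξ).trans H.fourier_near.le
  have h2 : ‖h ξ - dft M (pbd p) ξ‖ ≤ 1 := by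
    have := H.eps_pos
    have := H.eps_le
    refine abs_le_of_sq_le_sq' ?_ zero_le_one |>.2
    nlinarith
  have h3 := norm_dft_pbd_le_one M p ξ
  have h4 := norm_le_norm_add_norm_sub' (h ξ) (dft M (pbd p) ξ)
  linarith

theorem freq_mem (l : ℕ) (n : Fin (2 * l + 1)) : freq l n ∈ Finset.Icc (-(l : ℤ)) l := by
  have := n.2
  simp only [freq, Finset.mem_Icc]
  omega

theorem norm_target_sub_le (D : ℕ) (mean : ℝ) (M l : ℕ) (h : ℤ → ℂ) (n : Fin (2 * l + 1)) :
    ‖target D mean M l h n - Complex.exp ((angle M l n * ⌊mean⌋ : ℝ) * Complex.I) *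
      h (freq l n)‖ ≤ (1 / 2) ^ D := by
  rw [mul_comm]
  exact norm_roundComplex_sub_le _ _

theorem norm_target_le (H : Compatible C α β ε sd mean M l h T p) (D : ℕ) (n : Fin (2 * l + 1)) :
    ‖target D mean M l h n‖ ≤ 3 := by
  have h1 := norm_target_sub_le D mean M l h n
  have h2 := H.norm_given_le (freq_mem l n)
  have h3 := norm_le_norm_add_norm_sub' (target D mean M l h n)
    (Complex.exp ((angle M l n * ⌊mean⌋ : ℝ) * Complex.I) * h (freq l n))
  rw [norm_mul, Complex.norm_exp_ofReal_mul_I, one_mul] at h3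
  have h4 : (1 / 2 : ℝ) ^ D ≤ 1 := pow_le_one₀ (by norm_num) (by norm_num)
  linarith

/-- The distribution enters only through the size bounds; the system is written from the data, so it
serves every compatible distribution. -/
theorem exists_system (H : Compatible C α β ε sd mean M l h T p) :
    ∃ S : PolySystem k, S.num = 2 * k + 8 * l + 9 ∧ S.aux = 4 * l + 2 ∧
      (∀ i, (S.poly i).totalDegree ≤ 4 * digits C ε) ∧
      (∀ i s, ratBits ((S.poly i).coeff s) ≤ 50 * digits C ε ^ 2) ∧
      ∀ x, S.IsSolution x ↔ T.Feasible (digits C ε) ε sd mean M l h x := by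
  have hε := H.eps_pos
  have hε' := H.eps_le
  have hC := H.one_le_C
  have hC1 := H.pow_le_C_pow (i := 1) (by norm_num)
  have hC2 := H.pow_le_C_pow (i := 2) (by norm_num)
  have hC3 := H.pow_le_C_pow (i := 3) (by norm_num)
  have hC8 : 1 ≤ C ^ 8 := Nat.one_le_pow _ _ hC
  rw [pow_one] at hC1
  have hsd := H.sd_nonneg
  have hη0 : (0 : ℝ) ≤ (1 / 2) ^ (digits C ε + 1) := by positivity
  have hη : (1 / 2 : ℝ) ^ (digits C ε + 1) ≤ 1 := pow_le_one₀ (by norm_num) (by norm_num)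
  have hx := H.one_le_inv_pow (2 * C + 1)
  have hp2 : (1 / ε) ^ C ≤ (1 / ε) ^ (2 * C + 1) :=
    pow_le_pow_right₀ (by linarith [H.one_le_inv]) (by omega)
  have h41 : (maxVar sd : ℝ) ≤ 2 ^ digits C ε := by
    have h1 := H.mul_pow_le 41 C (by omega)
    have h2 := H.maxVar_le
    have h3 := H.var_le
    have h4 := H.one_le_inv_pow C
    push_cast at h1
    linarith
  have hv1 : 0 ≤ (maxVar sd : ℝ) := le_trans (by positivity) (Int.le_ceil (4 * sd ^ 2))
  refine exists_fourierSystem T.mult T.upper (T.smallSet (maxAngle M l)) (T.bigSet (maxAngle M l))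
    (by have := H.cutoff_le_digits; omega) _ _ _ _ _ _ _ _ _ _
    (fun _ => isDyadic_roundDown _ _) (fun _ => isDyadic_roundUp _ _) (isDyadic_roundDown _ _)
    (fun _ _ => isDyadic_roundDown _ _) (fun _ _ => isDyadic_roundDown _ _)
    (fun _ => isDyadic_roundDown _ _) (fun _ => isDyadic_roundDown _ _)
    (fun _ => isDyadic_roundDown _ _) (fun j => ?_) (fun j => ?_) ?_
    (fun _ _ => norm_roundedFactor_le _ _ _) (fun n => ?_) (fun n => ?_) H.cutoff_le_digits
    H.sum_big_le_digits ?_ ?_ ?_ ?_ ?_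
  · have h1 := T.a_mem H.admissible.R_pos H.admissible.R_le j
    rw [abs_of_nonneg (roundDown_nonneg _ h1.1)]
    exact (roundDown_le _ _).trans h1.2
  · have h1 := T.b_mem H.admissible.R_pos H.admissible.R_le j
    rw [abs_of_nonneg (h1.1.trans (le_roundUp _ _))]
    exact roundUp_le_one _ h1.2
  · rw [abs_of_nonneg (roundDown_nonneg _ (by positivity))]
    exact (roundDown_le _ _).trans (by nlinarith)
  · have h1 := H.mul_pow_le 3 0 (by omega)
    have h2 := H.norm_target_le (digits C ε) n
    norm_num at h1
    linarith
  · have h1 := H.mul_pow_le (31 * C ^ 3) (2 * C + 1) (by omega)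
    have h2 := abs_roundDown_sub_le (digits C ε + 1)
      (angle M l n * (⌊mean⌋ - T.upperCount : ℤ))
    have h3 := abs_sub_abs_le_abs_sub (roundDown (digits C ε + 1)
      (angle M l n * (⌊mean⌋ - T.upperCount : ℤ))) (angle M l n * (⌊mean⌋ - T.upperCount : ℤ))
    have h4 := mul_le_mul ((abs_angle_le M l n).trans H.maxAngle_bounds.2.1) H.abs_shift_le
      (abs_nonneg _) (Nat.cast_nonneg C)
    rw [← abs_mul] at h4
    have h5 := H.one_le_C_pow 3
    push_cast at h1 h4 ⊢
    push_cast at h2 h3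
    have h6 : 1 ≤ (C : ℝ) ^ 3 * (1 / ε) ^ (2 * C + 1) := by nlinarith
    nlinarith
  · have h1 := H.mul_pow_le (20 * C ^ 2) (2 * C + 1) (by omega)
    rw [Pattern.smallSet_union_bigSet]
    exact H.sum_mult_le.trans h1
  · have h1 := minVar_nonneg sd
    have h2 := H.minVar_le
    have h3 := H.mul_pow_le 41 C (by omega)
    have h4 := H.var_le
    have h5 := H.var_nonneg
    have h6 := H.one_le_inv_pow C
    rw [abs_of_nonneg (by exact_mod_cast h1)]
    push_cast at h3
    linarith
  · rwa [abs_of_nonneg hv1]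
  · exact H.abs_shift_le.trans (H.mul_pow_le (30 * C ^ 2) (2 * C + 1) (by omega))
  · have h1 := H.meanSlack_le
    have h2 := H.sqrt_var_le
    have h3 := H.mul_pow_le 5 C (by omega)
    have h4 := H.one_le_inv_pow C
    have h5 : 0 ≤ (meanSlack sd : ℝ) := by
      have : (0 : ℤ) ≤ ⌈sd⌉ + 1 := by have := Int.ceil_nonneg hsd; omega
      exact_mod_cast this
    rw [abs_of_nonneg h5]
    push_cast at h3
    linarith

/-- The multiplicities and the number of frequencies are polynomial in 1/ε, and the working
precision was chosen to beat both. -/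
theorem total_error_le (H : Compatible C α β ε sd mean M l h T p) :
    (2 * l + 1) * ((24 * (∑ j ∈ T.smallSet (maxAngle M l), T.mult j : ℕ) +
      2 * (∑ j ∈ T.bigSet (maxAngle M l), T.mult j : ℕ) + 12) * (1 / 2 : ℝ) ^ digits C ε +
        (1 / 2) ^ digits C ε) ≤ 0.03 * ε ∧
    (3 * (∑ j ∈ T.smallSet (maxAngle M l), T.mult j : ℕ) +
      (∑ j ∈ T.bigSet (maxAngle M l), T.mult j : ℕ) + 1) * (1 / 2 : ℝ) ^ digits C ε ≤ 1 / 2 := by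
  have hε := H.eps_pos
  have hC := H.one_le_C
  have hC1 := H.pow_le_C_pow (i := 1) (by norm_num)
  have hC2 := H.pow_le_C_pow (i := 2) (by norm_num)
  have hC3 := H.pow_le_C_pow (i := 3) (by norm_num)
  rw [pow_one] at hC1
  have hC' : (1 : ℝ) ≤ C := by exact_mod_cast hC
  have h1 := H.sum_mult_le
  rw [← Pattern.smallSet_union_bigSet T (maxAngle M l),
    Finset.sum_union (Pattern.disjoint_smallSet_bigSet T _)] at h1
  generalize (∑ j ∈ T.smallSet (maxAngle M l), T.mult j) = a at h1 ⊢
  generalize (∑ j ∈ T.bigSet (maxAngle M l), T.mult j) = b at h1 ⊢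
  have h2 := H.mul_pow_le (53300 * C ^ 3) (2 * C + 3) (by omega)
  have h3 := H.mul_half_pow_le (53300 * C ^ 3) (2 * C + 3) (by omega)
  have h4 := H.mul_half_pow_le (162 * C ^ 2) (2 * C + 1) (by omega)
  have hη0 : (0 : ℝ) < (1 / 2) ^ digits C ε := by positivity
  set η := (1 / 2 : ℝ) ^ digits C ε with hη
  push_cast at h1 h3 h4
  have hP1 := H.one_le_inv_pow (2 * C + 1)
  have hPε : (1 / ε) ^ (2 * C + 1) * ε ^ (2 * C + 1) = 1 := by
    rw [← mul_pow, one_div_mul_cancel hε.ne', one_pow]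
  have hC21 := H.one_le_C_pow 2
  have hX : 1 ≤ (C : ℝ) ^ 2 * (1 / ε) ^ (2 * C + 1) := by nlinarith
  have ha : (0 : ℝ) ≤ a := Nat.cast_nonneg a
  have hb : (0 : ℝ) ≤ b := Nat.cast_nonneg b
  set P := (1 / ε) ^ (2 * C + 1)
  have hl : (2 * l + 1 : ℝ) ≤ 3 * C * (1 / ε) := by
    have h5 := H.cutoff_le
    have h6 := mul_le_mul_of_nonneg_left (log_one_div_le hε) (by linarith : (0 : ℝ) ≤ C)
    have h7 := H.one_le_inv
    nlinarith
  constructor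
  · have h5 : ((24 * a + 2 * b + 12) * η + η : ℝ) ≤ 533 * (C ^ 2 * P) * η := by
      have : (24 * a + 2 * b + 13 : ℝ) ≤ 533 * (C ^ 2 * P) := by linarith
      nlinarith
    calc _ ≤ (3 * C * (1 / ε)) * (533 * (C ^ 2 * P) * η) := by
          gcongr
      _ = 0.03 * (53300 * C ^ 3 * η) * (P * (1 / ε)) := by ring
      _ ≤ 0.03 * ε ^ (2 * C + 3) * (P * (1 / ε)) := by gcongr
      _ = 0.03 * (P * ε ^ (2 * C + 1)) * (ε * (ε * (1 / ε))) := by ring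
      _ = 0.03 * ε := by rw [hPε, mul_one_div_cancel hε.ne']; ring
  · have h5 : (3 * a + b + 1 : ℝ) ≤ 81 * (C ^ 2 * P) := by linarith
    calc _ ≤ 81 * (C ^ 2 * P) * η := by gcongr
      _ = 1 / 2 * P * (162 * C ^ 2 * η) := by ring
      _ ≤ 1 / 2 * P * ε ^ (2 * C + 1) := by gcongr
      _ = 1 / 2 := by rw [mul_assoc, hPε, mul_one]

/-- Each term is O(log(1/ε)) because z²V is; the term with √V is reduced to this one by 2z√V ≤ 1 +
z²V. -/
theorem exponent_le (H : Compatible C α β ε sd mean M l h T p) :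
    1 + 3 * maxAngle M l ^ 2 * (4 * maxVar sd) + maxAngle M l * meanSlack sd +
      maxAngle M l * (∑ j ∈ T.bigSet (maxAngle M l), T.mult j : ℕ) ≤
        2800 * (C : ℝ) ^ 8 * Real.log (1 / ε) := by
  obtain ⟨h1, h2, h3⟩ := H.maxAngle_bounds
  have hL := H.log_ge
  have hv := H.maxVar_le
  have hA := H.meanSlack_le
  have hB := H.sum_big_le
  have hC8 := H.one_le_C_pow 8
  have hC2 := H.cast_pow_le (i := 2) (by norm_num)
  have hC1 := H.cast_pow_le (i := 1) (by norm_num)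
  have hV := Real.sq_sqrt H.var_nonneg
  rw [pow_one] at hC1
  generalize (∑ j ∈ T.bigSet (maxAngle M l), T.mult j) = b at hB ⊢
  set z := maxAngle M l
  set L := Real.log (1 / ε)
  set V := distVar (pbd p)
  have e1 : z ^ 2 * maxVar sd ≤ z ^ 2 * (32 * V + 9) := mul_le_mul_of_nonneg_left hv (sq_nonneg z)
  have e2 : z * meanSlack sd ≤ z * (2 * √V + 3) := mul_le_mul_of_nonneg_left hA h1
  have e3 : z * (2 * √V) ≤ 1 + z ^ 2 * V := by nlinarith [sq_nonneg (z * √V - 1)]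
  have e4 : z * b ≤ C * (2180 * C ^ 7 * L) := mul_le_mul h2 hB (Nat.cast_nonneg b) (Nat.cast_nonneg C)
  have e5 : z ^ 2 ≤ (C : ℝ) ^ 2 := pow_le_pow_left₀ h1 h2 2
  have e6 : (C : ℝ) ^ 2 * L ≤ C ^ 8 * L := mul_le_mul_of_nonneg_right hC2 (by linarith)
  have e7 : (C : ℝ) ^ 8 * 0.69 ≤ C ^ 8 * L := mul_le_mul_of_nonneg_left hL (by linarith)
  have e8 : C * (2180 * C ^ 7 * L) = 2180 * ((C : ℝ) ^ 8 * L) := by ring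
  nlinarith

/-- Shared by both directions: once intervals, variance and mean are constrained, the truncated
residual agrees with the true rotated one up to 0.03ε in ℓ². -/
theorem fourier_gap (H : Compatible C α β ε sd mean M l h T p) {q : Fin k → I}
    (hlo : ∀ j, roundDown (digits C ε + 1) (T.a j) ≤ q j)
    (hhi : ∀ j, (q j : ℝ) ≤ roundUp (digits C ε + 1) (T.b j))
    (hvar : ∑ j ∈ T.smallSet (maxAngle M l) ∪ T.bigSet (maxAngle M l),
      (T.mult j : ℝ) * (q j * (1 - q j)) ≤ maxVar sd)
    (hmean : |((⌊mean⌋ - T.upperCount : ℤ) : ℝ) -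
      ∑ j ∈ T.smallSet (maxAngle M l) ∪ T.bigSet (maxAngle M l),
        orient (T.upper j) * (T.mult j * measureFrom (T.upper j) (q j))| ≤ meanSlack sd) :
    ∑ i, ‖(target (digits C ε) mean M l h i -
        T.truncatedDft (digits C ε) (maxAngle M l) (angle M l i) ⌊mean⌋ fun j => q j) -
      Complex.exp ((angle M l i * ⌊mean⌋ : ℝ) * Complex.I) *
        (h (freq l i) - dft M (pbdMult T.mult q) (freq l i))‖ ^ 2 ≤ (0.03 * ε) ^ 2 := by
  obtain ⟨h1, h2, h3⟩ := H.maxAngle_bounds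
  obtain ⟨h4, h5⟩ := H.total_error_le
  have hC := H.one_le_C
  have hη1 : (1 / 2 : ℝ) ^ digits C ε * (maxAngle M l + 2) ≤ 1 / 12 := by
    have hC1 := H.pow_le_C_pow (i := 1) (by norm_num)
    rw [pow_one] at hC1
    have h6 := H.mul_half_pow_le (12 * (C + 2)) 0 (by omega)
    push_cast at h6
    have h7 : (0 : ℝ) < (1 / 2) ^ digits C ε := by positivity
    nlinarith
  have hD : 6 * (2800 * (C : ℝ) ^ 8 * Real.log (1 / ε)) ≤ digits C ε := by
    have h6 := le_digits C ε
    have h7 := H.log_ge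
    have h8 : 0 ≤ (C : ℝ) ^ 8 * Real.log (1 / ε) := by positivity
    linarith
  set δ : ℝ := (24 * (∑ j ∈ T.smallSet (maxAngle M l), T.mult j : ℕ) +
      2 * (∑ j ∈ T.bigSet (maxAngle M l), T.mult j : ℕ) + 12) * (1 / 2 : ℝ) ^ digits C ε +
        (1 / 2) ^ digits C ε with hδ
  have hδ0 : 0 ≤ δ := by positivity
  calc _ ≤ ∑ _i : Fin (2 * l + 1), δ ^ 2 := Finset.sum_le_sum fun i _ => by
        refine pow_le_pow_left₀ (norm_nonneg _) ?_ 2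
        have e1 := norm_target_sub_le (digits C ε) mean M l h i
        have e2 := Pattern.approx_fourier H.admissible.R_pos H.admissible.R_le hlo hhi
          (abs_angle_le M l i) hvar hmean hη1 h5 H.exponent_le hD
        rw [dft_pbdMult]
        refine (le_of_eq (congrArg norm ?_)).trans ((norm_sub_le _ _).trans
          ((add_le_add e1 e2).trans (by rw [hδ]; linarith)))
        rw [Pattern.truncatedDft, angle]
        ring
    _ = (2 * l + 1) * δ ^ 2 := by simp
    _ ≤ ((2 * l + 1) * δ) ^ 2 := by
        rw [mul_pow]
        have : (1 : ℝ) ≤ 2 * l + 1 := by linarith [(Nat.cast_nonneg l : (0 : ℝ) ≤ l)]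
        nlinarith [mul_nonneg (mul_nonneg (by linarith : (0 : ℝ) ≤ 2 * l + 1) (sq_nonneg δ))
          (by linarith : (0 : ℝ) ≤ 2 * l)]
    _ ≤ _ := pow_le_pow_left₀ (by positivity) h4 2

end Compatible

end Assembly

/-! ### Completeness and soundness of the system. -/

section Correctness

namespace Compatible

variable {C : ℕ} {α β ε sd mean : ℝ} {M l : ℕ} {h : ℤ → ℂ} {k : ℕ} {T : Pattern k} {n : ℕ}
  {p : Fin n → I}

theorem sum_eq_distVar (H : Compatible C α β ε sd mean M l h T p) {q : Fin k → I} {N : ℕ} (z : ℝ)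
    (hlo : ∀ j, roundDown N (T.a j) ≤ q j) (hhi : ∀ j, (q j : ℝ) ≤ roundUp N (T.b j)) :
    ∑ j ∈ T.smallSet z ∪ T.bigSet z, (T.mult j : ℝ) * (q j * (1 - q j)) =
      distVar (pbdMult T.mult q) := by
  rw [distVar_pbdMult]
  refine Pattern.sum_measureFrom_outside z (Pattern.measureFrom_eq_zero hlo hhi
    (Pattern.mem_unitInterval H.admissible.R_pos H.admissible.R_le hlo hhi)) _ fun j hj => ?_
  unfold measureFrom at hj
  split_ifs at hj <;> simp [hj]

theorem shift_sub_sum_eq (H : Compatible C α β ε sd mean M l h T p) {q : Fin k → I} {N : ℕ} (z : ℝ)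
    (hlo : ∀ j, roundDown N (T.a j) ≤ q j) (hhi : ∀ j, (q j : ℝ) ≤ roundUp N (T.b j)) :
    ((⌊mean⌋ - T.upperCount : ℤ) : ℝ) - ∑ j ∈ T.smallSet z ∪ T.bigSet z,
        orient (T.upper j) * (T.mult j * measureFrom (T.upper j) (q j)) =
      ⌊mean⌋ - distMean (pbdMult T.mult q) := by
  rw [distMean_pbdMult, Pattern.sum_mult_mul_eq, Pattern.sum_measureFrom_outside z
    (Pattern.measureFrom_eq_zero hlo hhi
      (Pattern.mem_unitInterval H.admissible.R_pos H.admissible.R_le hlo hhi)) _ fun j hj => by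
        rw [hj, mul_zero, mul_zero]]
  push_cast
  ring

theorem sum_rotated_eq (mean : ℝ) (M l : ℕ) (f : ℤ → ℂ) :
    ∑ i, ‖Complex.exp ((angle M l i * ⌊mean⌋ : ℝ) * Complex.I) * f (freq l i)‖ ^ 2 =
      ∑ ξ ∈ Finset.Icc (-(l : ℤ)) l, ‖f ξ‖ ^ 2 := by
  rw [← sum_freq l fun ξ => ‖f ξ‖ ^ 2]
  refine Finset.sum_congr rfl fun i _ => ?_
  rw [norm_mul, Complex.norm_exp_ofReal_mul_I, one_mul]

/-- The true residual 0.26ε and the truncation error 0.03ε add up to 0.29ε, below the threshold 0.3ε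
with room for rounding it. -/
theorem feasible (H : Compatible C α β ε sd mean M l h T p) (hβ : 200000 ≤ β) {q : Fin k → I}
    (hq : ∀ j, T.a j ≤ q j ∧ (q j : ℝ) ≤ T.b j)
    (htv : tvDist (pbd p) (pbdMult T.mult q) < ε / l)
    (hm : distMean (pbdMult T.mult q) = distMean (pbd p))
    (hv : distVar (pbdMult T.mult q) ≤ distVar (pbd p))
    (hv' : distVar (pbd p) / 2 ≤ distVar (pbdMult T.mult q)) :
    T.Feasible (digits C ε) ε sd mean M l h fun j => (q j : ℝ) := by
  have hε := H.eps_pos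
  have hL := H.log_ge
  have hlo : ∀ j, roundDown (digits C ε + 1) (T.a j) ≤ q j := fun j =>
    (roundDown_le _ _).trans (hq j).1
  have hhi : ∀ j, (q j : ℝ) ≤ roundUp (digits C ε + 1) (T.b j) := fun j =>
    (hq j).2.trans (le_roundUp _ _)
  have hvar : ∑ j ∈ T.smallSet (maxAngle M l) ∪ T.bigSet (maxAngle M l),
      (T.mult j : ℝ) * (q j * (1 - q j)) ≤ maxVar sd := by
    rw [H.sum_eq_distVar _ hlo hhi]
    have h1 := Int.le_ceil (4 * sd ^ 2)
    have h2 := pow_le_pow_left₀ (by positivity) H.le_sd 2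
    rw [div_pow, Real.sq_sqrt H.var_nonneg] at h2
    unfold maxVar
    linarith
  have hmean : |((⌊mean⌋ - T.upperCount : ℤ) : ℝ) -
      ∑ j ∈ T.smallSet (maxAngle M l) ∪ T.bigSet (maxAngle M l),
        orient (T.upper j) * (T.mult j * measureFrom (T.upper j) (q j))| ≤ meanSlack sd := by
    rw [H.shift_sub_sum_eq _ hlo hhi, hm]
    have h1 := Int.le_ceil sd
    have h2 := abs_le.1 H.mean_near
    have h3 := Int.floor_le mean
    have h4 := Int.lt_floor_add_one mean
    unfold meanSlack
    push_cast
    exact abs_le.2 ⟨by linarith, by linarith⟩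
  have hl : 120000 ≤ l := by
    have h1 := H.le_cutoff
    have : (120000 : ℝ) ≤ l := by nlinarith
    exact_mod_cast this
  refine ⟨hlo, hhi, ?_, hvar, hmean, ?_⟩
  · rw [H.sum_eq_distVar _ hlo hhi]
    exact H.minVar_le.trans hv'
  have h1 := H.fourier_gap hlo hhi hvar hmean
  have h2 : ∑ i, ‖Complex.exp ((angle M l i * ⌊mean⌋ : ℝ) * Complex.I) *
      (h (freq l i) - dft M (pbdMult T.mult q) (freq l i))‖ ^ 2 ≤ (0.26 * ε) ^ 2 := by
    rw [sum_rotated_eq mean M l fun ξ => h ξ - dft M (pbdMult T.mult q) ξ]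
    exact sum_norm_sub_dft_sq_le_of_tvDist p _ hε hl h H.fourier_near.le htv.le
  have h3 := sum_norm_sub_sq_le (b := 0.26 * ε) Finset.univ _ (fun i => -(Complex.exp ((angle M l i * ⌊mean⌋ : ℝ) *
    Complex.I) * (h (freq l i) - dft M (pbdMult T.mult q) (freq l i)))) (by positivity)
    (by positivity) h1 (by simpa only [norm_neg] using h2)
  simp only [sub_neg_eq_add, sub_add_cancel] at h3
  refine h3.trans (le_trans ?_ (sub_le_roundDown _ _))
  -- Rounding the threshold down costs at most ε²/400, less than 0.09ε² - 0.29²ε².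
  have h4 := H.mul_half_pow_le 200 2 (by
    have := Nat.one_le_pow 8 C H.one_le_C
    omega)
  rw [pow_succ (1 / 2 : ℝ)]
  push_cast at h4
  nlinarith [sq_nonneg ε]

/-- A solution has true residual at most 0.3ε + 0.03ε, within the 0.35ε that `tvDist_lt_of_fourier`
allows. -/
theorem sound (H : Compatible C α β ε sd mean M l h T p) (hβ : 17 * |α| + 128 * α ^ 2 + 100 ≤ β)
    {x : Fin k → ℝ} (hx : T.Feasible (digits C ε) ε sd mean M l h x) :
    ∃ q : Fin k → I, (∀ j, (q j : ℝ) = x j) ∧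
      (∀ j, T.a j - ε ^ C ≤ x j ∧ x j ≤ T.b j + ε ^ C) ∧
      tvDist (pbd p) (pbdMult T.mult q) < ε / 2 := by
  have hε := H.eps_pos
  obtain ⟨hlo, hhi, hvar', hvar, hmean, hfourier⟩ := hx
  have hx01 := Pattern.mem_unitInterval H.admissible.R_pos H.admissible.R_le hlo hhi
  obtain ⟨q, rfl⟩ : ∃ q : Fin k → I, (fun j => (q j : ℝ)) = x := ⟨fun j => ⟨x j, hx01 j⟩, rfl⟩
  have hη : (1 / 2 : ℝ) ^ (digits C ε + 1) ≤ ε ^ C := by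
    have h1 := H.mul_half_pow_le 1 C (by
      have := H.pow_le_C_pow (i := 1) (by norm_num)
      have := Nat.one_le_pow 8 C H.one_le_C
      rw [pow_one] at *
      omega)
    have h2 : (0 : ℝ) < (1 / 2) ^ digits C ε := by positivity
    rw [pow_succ]
    push_cast at h1
    linarith
  refine ⟨q, fun _ => rfl, fun j => ⟨?_, ?_⟩, ?_⟩
  · linarith [sub_le_roundDown (digits C ε + 1) (T.a j), hlo j]
  · linarith [roundUp_le_add (digits C ε + 1) (T.b j), hhi j]
  have h1 := H.fourier_gap hlo hhi hvar hmean
  rw [H.sum_eq_distVar _ hlo hhi] at hvar hvar'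
  rw [H.shift_sub_sum_eq _ hlo hhi] at hmean
  refine tvDist_lt_of_fourier p _ hε H.eps_le hβ H.le_modulus H.modulus_le H.le_cutoff
    (hvar.trans H.maxVar_le) (fun hV => (H.le_minVar hV).trans hvar') ?_ h H.fourier_near.le ?_
  -- The slack 2√V + 3, the floor 1 and the guess error 2√V + 1 add up to 4√V + 5.
  · have h2 := abs_le.1 hmean
    have h3 := abs_le.1 H.mean_near
    have h4 := Int.floor_le mean
    have h5 := Int.lt_floor_add_one mean
    have h6 := H.meanSlack_le
    have h7 := H.sd_le
    exact abs_le.2 ⟨by unfold pbdMult at h2; linarith, by unfold pbdMult at h2; linarith⟩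
  · have h2 : ∑ i, ‖target (digits C ε) mean M l h i -
        T.truncatedDft (digits C ε) (maxAngle M l) (angle M l i) ⌊mean⌋ fun j => q j‖ ^ 2 ≤
        (0.3 * ε) ^ 2 := by
      refine hfourier.trans ((roundDown_le _ _).trans (le_of_eq ?_))
      ring
    have h3 := sum_norm_sub_sq_le Finset.univ _ _ (by positivity) (by positivity) h2 h1
    simp only [sub_sub_cancel] at h3
    rw [sum_rotated_eq mean M l fun ξ => h ξ - dft M (pbdMult T.mult q) ξ] at h3
    refine h3.trans ?_
    nlinarith [sq_nonneg ε]

end Compatible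

end Correctness

end

theorem theorem10 :
    ∃ c₀ : ℝ, 0 < c₀ ∧ ∀ α : ℝ, ∃ β : ℝ, 0 < β ∧ ∀ C : ℕ, ∃ K : ℝ,
    ∀ (ε : ℝ), 0 < ε → ε ≤ 1 / 2 →
    -- the data from which the system is built
    ∀ (sd mean : ℝ) (M l : ℕ) (h : ℤ → ℂ) (k : ℕ) (T : Pattern k),
    β * Real.log (1 / ε) ≤ l → (l : ℝ) ≤ C * Real.log (1 / ε) →
    -- the system depends on the data only, not on `P`
    ∃ S : PolySystem k,
    ∀ (n : ℕ) (p : Fin n → I),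
    distVar (pbd p) ≤ (1 / ε) ^ C →
    √(distVar (pbd p)) / 2 ≤ sd → sd ≤ 2 * √(distVar (pbd p)) + 1 →
    |distMean (pbd p) - mean| ≤ sd →
    c₀ * (Real.log (1 / ε) + √(distVar (pbd p) * Real.log (1 / ε))) ≤ M →
    (M : ℝ) ≤ α * (Real.log (1 / ε) + √(distVar (pbd p) * Real.log (1 / ε))) →
    ∑ ξ ∈ Finset.Icc (-(l : ℤ)) l, ‖h ξ - dft M (pbd p) ξ‖ ^ 2 < ε ^ 2 / 16 →
    T.Admissible C ε (distMean (pbd p)) (distVar (pbd p)) →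
    -- size of the system
    (S.num : ℝ) ≤ K * Real.log (1 / ε) ∧
    (S.aux : ℝ) ≤ K * Real.log (1 / ε) ∧
    (∀ i, ((S.poly i).totalDegree : ℝ) ≤ K * Real.log (1 / ε)) ∧
    (∀ i s, (ratBits ((S.poly i).coeff s) : ℝ) ≤ K * Real.log (1 / ε) ^ 2) ∧
    -- (i) completeness
    (∀ q : Fin k → I, (∀ j, T.a j ≤ q j ∧ (q j : ℝ) ≤ T.b j) →
      tvDist (pbd p) (pbdMult T.mult q) < ε / l →
      distMean (pbdMult T.mult q) = distMean (pbd p) →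
      distVar (pbdMult T.mult q) ≤ distVar (pbd p) →
      distVar (pbd p) / 2 ≤ distVar (pbdMult T.mult q) →
      S.IsSolution fun j => (q j : ℝ)) ∧
    -- (ii) soundness
    (∀ x : Fin k → ℝ, S.IsSolution x →
      ∃ q : Fin k → I, (∀ j, (q j : ℝ) = x j) ∧
        (∀ j, T.a j - ε ^ C ≤ x j ∧ x j ≤ T.b j + ε ^ C) ∧
        tvDist (pbd p) (pbdMult T.mult q) < ε / 2) := by 
  refine ⟨150, by norm_num, fun α => ⟨17 * |α| + 128 * α ^ 2 + 200000, by positivity, fun C => ?_⟩⟩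
  -- With A = 100000C⁸ and D ≤ 4A log(1/ε): 800A² bounds the bits 50D², 16A the degree 4D, and 28C +
  -- 20 the numbers of inequalities and auxiliary unknowns.
  refine ⟨800 * (100000 * (C : ℝ) ^ 8) ^ 2 + 16 * (100000 * (C : ℝ) ^ 8) + 28 * C + 20,
    fun ε hε hε' sd mean M l h k T hl hl' => ?_⟩
  -- The system has to be fixed before the distribution. If no distribution is compatible with the
  -- data, any system will do; otherwise one compatible distribution certifies the sizes for all.
  by_cases hcomp : ∃ (n : ℕ) (p : Fin n → I),
      Compatible C α (17 * |α| + 128 * α ^ 2 + 200000) ε sd mean M l h T p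
  · obtain ⟨n₀, p₀, H₀⟩ := hcomp
    obtain ⟨S, hnum, haux, hdeg, hbits, hsol⟩ := H₀.exists_system
    refine ⟨S, fun n p hV hsd hsd' hmean hM hM' hfourier hadm => ?_⟩
    have H : Compatible C α (17 * |α| + 128 * α ^ 2 + 200000) ε sd mean M l h T p :=
      ⟨hε, hε', by positivity, hl, hl', hV, hsd, hsd', hmean, hM, hM', hfourier, hadm⟩
    have hL := H.log_ge
    have hk := H.card_le'
    have hD : (digits C ε : ℝ) ≤ 4 * (100000 * (C : ℝ) ^ 8) * Real.log (1 / ε) := by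
      have := precision_le (100000 * C ^ 8) hε hε'
      push_cast at this
      exact this
    set L := Real.log (1 / ε)
    have hD2 := pow_le_pow_left₀ (Nat.cast_nonneg _) hD 2
    have hCL : 0 ≤ (C : ℝ) * L := by positivity
    have hAL : 0 ≤ (C : ℝ) ^ 8 * L := by positivity
    have hAL2 : 0 ≤ ((C : ℝ) ^ 8) ^ 2 * L := by positivity
    refine ⟨?_, ?_, fun i => ?_, fun i s => ?_, fun q hq htv hm hv hv' => ?_, fun x hx => ?_⟩
    · rw [hnum]
      push_cast
      linarith
    · rw [haux]
      push_cast
      linarith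
    · have : ((S.poly i).totalDegree : ℝ) ≤ 4 * digits C ε := by exact_mod_cast hdeg i
      linarith
    · have h1 : (ratBits ((S.poly i).coeff s) : ℝ) ≤ 50 * digits C ε ^ 2 := by
        exact_mod_cast hbits i s
      have h2 : 0 ≤ (C : ℝ) ^ 8 * L ^ 2 := by positivity
      have h3 : 0 ≤ (C : ℝ) * L ^ 2 := by positivity
      linarith [sq_nonneg L]
    · exact (hsol _).2 (H.feasible (by linarith [abs_nonneg α, sq_nonneg α]) hq htv hm hv hv')
    · exact H.sound (by linarith) ((hsol x).1 hx)
  · exact ⟨⟨0, 0, Fin.elim0⟩, fun n p hV hsd hsd' hmean hM hM' hfourier hadm =>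
      (hcomp ⟨n, p, hε, hε', by positivity, hl, hl', hV, hsd, hsd', hmean, hM, hM', hfourier,
        hadm⟩).elim⟩
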